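/- Let $0\to M\xrightarrow{i}\Lambda\xrightarrow{d}B\to 0$ be an exact sequence of lattices (free abelian groups of finite rank) and let $P\subset\Lambda_{\mathbb Q}$ be a polyhedron, i.e. an intersection of finitely many closed half-spaces. For $y\in\Lambda_{\mathbb Q}^\vee$ let $\mathrm{face}_y(P)$ be the set of points of $P$ where $\langle -,y\rangle$ attains its minimum on $P$; the faces of $P$ are the nonempty sets of this form. For a face $F$ of $P$ put $N_FP=\{y\mid \mathrm{face}_y(P)\supset F\}$, a cone in the dual space. Put $F_M=F\cap M_{\mathbb Q}$ and $P_M=P\cap M_{\mathbb Q}$. A face $F$ of $P$ is called $M$-stable if $M_{\mathbb Q}$ meets its relative interior and $\langle F\rangle+M_{\mathbb Q}=\Lambda_{\mathbb Q}$, where $\langle F\rangle$ is the vector space spanned by the differences of points of $F$. Let $C(P)\subset\mathbb Q\times\Lambda_{\mathbb Q}$ be the closure of the cone generated by $\{1\}\times P$, let $R=\mathbb C[C(P)\cap(\mathbb Z\times\Lambda)]$, graded by the first coordinate, and let $X_P=\mathrm{Proj}\,R$. The torus $T_B=\mathrm{Hom}_{\mathbb Z}(B,\mathbb C^*)$ acts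 on $R$ by $t\cdot e^{(n,\lambda)}=t(d(\lambda))\,e^{(n,\lambda)}$, hence on $X_P$ and on $\mathcal O(1)$. The stable locus $X_P^s$ is the union of the affine open sets $D_+(f)$, where $f\in R^{T_B}$ is homogeneous of positive degree and all closed points of $D_+(f)$ have finite stabilizers in $T_B$ and $T_B$-orbits that are closed in $D_+(f)$. The stable GIT quotient $X_P^s/\!\!/T_B$ is the open subscheme of $X_P/\!\!/T_B=\mathrm{Proj}\,R^{T_B}$ that is the union of the open sets $D_+(f)$ of $\mathrm{Proj}\,R^{T_B}$ over all homogeneous $f\in R^{T_B}$ of positive degree such that $D_+(f)\subset X^s_P$ in $X_P$. Then the sets of cones $$N^s(P_M)=\{N_{F_M}P_M\subset M_{\mathbb Q}^\vee\mid F\subset P\text{ is an }M\text{-stable face}\},\qquad N(P_M)=\{N_GP_M\mid G\text{ is a face of }P_M\}$$ are generalized fans in $M^\vee$ (finite sets of rational polyhedral cones, closed under taking faces, in which any two cones intersect in a common face; cones containing lines are allowed), and $N^s(P_M)\subset N(P_M)$. If $P$ is full-dimensional, i.e. its affine span is $\Lambda_{\mathbb Q}$, then all cones in $N^s(P_M)$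 are strictly convex, so that $N^s(P_M)$ is a fan. The toric variety of $N^s(P_M)$, i.e. the scheme obtained by gluing the charts $\mathrm{Spec}\,\mathbb C[\sigma^\vee\cap M]$, $\sigma\in N^s(P_M)$, along common faces, is isomorphic over $\mathbb C$ to the stable GIT quotient $X_P^s/\!\!/T_B$. -/

import Mathlib

open CategoryTheory CategoryTheory.Limits AlgebraicGeometry TopologicalSpace
open scoped TensorProduct AddMonoidAlgebra

noncomputable section

/-! ### Polyhedra in a rational vector space and their normal fans -/

namespace Polyhedral

variable {V : Type} [AddCommGroup V] [Module ℚ V]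

/-- A polyhedron: an intersection of finitely many closed half-spaces (possibly empty). -/
def IsPolyhedron (P : Set V) : Prop :=
  ∃ s : Finset (Module.Dual ℚ V × ℚ), P = {x | ∀ p ∈ s, p.2 ≤ p.1 x}

/-- `face_y(P)`: the points of `P` at which the functional `y` attains its minimum on `P`. -/
def face (P : Set V) (y : Module.Dual ℚ V) : Set V :=
  {x | x ∈ P ∧ ∀ z ∈ P, y x ≤ y z}

/-- The faces of `P`: the nonempty sets `face_y(P)`. -/
def IsFace (P F : Set V) : Prop :=
  F.Nonempty ∧ ∃ y : Module.Dual ℚ V, F = face P y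

/-- The normal cone `N_F P = {y | ⟨F, y⟩ ≤ ⟨P, y⟩}`; for `F ⊆ P` this is the set of all `y`
with `F ⊆ face_y(P)`. -/
def normalCone (P F : Set V) : PointedCone ℚ (Module.Dual ℚ V) where
  carrier := {y | ∀ x ∈ F, ∀ z ∈ P, y x ≤ y z}
  add_mem' := fun ha hb x hx z hz => add_le_add (ha x hx z hz) (hb x hx z hz)
  zero_mem' := fun _ _ _ _ => le_refl _
  smul_mem' := fun c _ hy x hx z hz => mul_le_mul_of_nonneg_left (hy x hx z hz) c.2

/-- The set of normal cones of the faces of `P`. -/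
def normalCones (P : Set V) : Set (PointedCone ℚ (Module.Dual ℚ V)) :=
  {σ | ∃ F, IsFace P F ∧ σ = normalCone P F}

/-- The relative interior `inn(F)`, for the canonical topology of a (finite-dimensional) rational
vector space. -/
def relInterior (F : Set V) : Set V :=
  letI : TopologicalSpace V := moduleTopology ℚ V
  intrinsicInterior ℚ F

/-- The closed cone over `P` in `ℚ × V`, i.e. the closure of the cone generated by `{1} × P`.
For a nonempty convex `P` the latter cone is `{t (1, x) | 0 ≤ t, x ∈ P}`. -/
def coneOver (P : Set V) : PointedCone ℚ (ℚ × V) :=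
  letI : TopologicalSpace (ℚ × V) := moduleTopology ℚ (ℚ × V)
  haveI : ContinuousAdd (ℚ × V) := ModuleTopology.continuousAdd ℚ (ℚ × V)
  haveI : ContinuousSMul ℚ (ℚ × V) := ModuleTopology.continuousSMul ℚ (ℚ × V)
  haveI : ContinuousConstSMul ℚ (ℚ × V) := inferInstance
  (PointedCone.hull ℚ ((fun x => ((1 : ℚ), x)) '' P)).closure

/-- A face of a polyhedral cone `σ` in the dual of `V`: the intersection of `σ` with a supporting
hyperplane `u^⊥`, where `u ∈ V` is nonnegative on `σ` (`u = 0` gives `σ` itself). -/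
def IsConeFace (τ σ : PointedCone ℚ (Module.Dual ℚ V)) : Prop :=
  ∃ u : V, (∀ y ∈ σ, 0 ≤ y u) ∧ ∀ y, y ∈ τ ↔ y ∈ σ ∧ y u = 0

end Polyhedral

/-! ### Fans and their toric varieties -/

namespace Toric

open Polyhedral

/-- The rational vector space `Λ_ℚ` spanned by a lattice `Λ`. -/
abbrev QSpan (Λ : Type) [AddCommGroup Λ] : Type := ℚ ⊗[ℤ] Λ

/-- The vector `1 ⊗ m` of `Λ_ℚ` given by a lattice vector `m`. -/
abbrev latticeVec {Λ : Type} [AddCommGroup Λ] (m : Λ) : QSpan Λ := (1 : ℚ) ⊗ₜ[ℤ] m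

/-- A generalized fan in the dual lattice `M^∨`: a finite set of rational polyhedral cones in
`M^∨_ℚ`, closed under taking faces, any two of which intersect in a common face. Cones
containing lines are allowed. -/
structure GenFan (M : Type) [AddCommGroup M] where
  cones : Set (PointedCone ℚ (Module.Dual ℚ (QSpan M)))
  finite : cones.Finite
  polyhedral : ∀ σ ∈ cones, σ.FG
  face_mem : ∀ σ ∈ cones, ∀ τ, IsConeFace τ σ → τ ∈ cones
  inter_face : ∀ σ ∈ cones, ∀ τ ∈ cones, IsConeFace (σ ⊓ τ) σ

/-- A fan: a generalized fan whose cones are strictly convex, i.e. contain no line. -/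
def GenFan.IsFan {M : Type} [AddCommGroup M] (Δ : GenFan M) : Prop :=
  ∀ σ ∈ Δ.cones, ∀ y, y ∈ σ → -y ∈ σ → y = 0

section Chart

variable {M : Type} [AddCommGroup M]

/-- The monoid `σ^∨ ∩ M`. -/
def dualMonoid (σ : PointedCone ℚ (Module.Dual ℚ (QSpan M))) : AddSubmonoid M where
  carrier := {m | ∀ y ∈ σ, 0 ≤ y (latticeVec m)}
  add_mem' := by
    intro a b ha hb y hy
    have h := add_nonneg (ha y hy) (hb y hy)
    simpa [latticeVec, TensorProduct.tmul_add] using h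
  zero_mem' := by
    intro y _
    simp [latticeVec]

theorem mem_dualMonoid {σ : PointedCone ℚ (Module.Dual ℚ (QSpan M))} {m : M} :
    m ∈ dualMonoid σ ↔ ∀ y ∈ σ, 0 ≤ y (latticeVec m) := Iff.rfl

theorem dualMonoid_anti {σ τ : PointedCone ℚ (Module.Dual ℚ (QSpan M))} (h : τ ≤ σ) :
    dualMonoid σ ≤ dualMonoid τ := fun _ hm y hy => hm y (h hy)

/-- The inclusion `ℂ[σ^∨ ∩ M] → ℂ[τ^∨ ∩ M]` for cones `τ ⊆ σ`. -/
def chartMap {σ τ : PointedCone ℚ (Module.Dual ℚ (QSpan M))} (h : τ ≤ σ) :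
    ℂ[dualMonoid σ] →ₐ[ℂ] ℂ[dualMonoid τ] :=
  AddMonoidAlgebra.mapDomainAlgHom ℂ ℂ (AddSubmonoid.inclusion (dualMonoid_anti h))

theorem chartMap_single {σ τ : PointedCone ℚ (Module.Dual ℚ (QSpan M))} (h : τ ≤ σ)
    (a : dualMonoid σ) (c : ℂ) : chartMap h (AddMonoidAlgebra.single a c) =
      AddMonoidAlgebra.single (AddSubmonoid.inclusion (dualMonoid_anti h) a) c := by
  simp [chartMap]

theorem chartMap_refl (σ : PointedCone ℚ (Module.Dual ℚ (QSpan M))) :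
    chartMap (le_refl σ) = AlgHom.id ℂ ℂ[dualMonoid σ] := by
  refine AlgHom.ext fun x => ?_
  induction x using AddMonoidAlgebra.induction_linear with
  | zero => simp
  | add x y hx hy => rw [map_add, map_add, hx, hy]
  | single a c => rw [chartMap_single]; rfl

theorem chartMap_comp {σ τ υ : PointedCone ℚ (Module.Dual ℚ (QSpan M))} (h : τ ≤ σ)
    (h' : υ ≤ τ) : (chartMap h').comp (chartMap h) = chartMap (h'.trans h) := by
  refine AlgHom.ext fun x => ?_
  induction x using AddMonoidAlgebra.induction_linear with
  | zero => simp
  | add x y hx hy => rw [map_add, map_add, hx, hy]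
  | single a c => rw [AlgHom.comp_apply, chartMap_single, chartMap_single, chartMap_single]; rfl

/-- Denominators can be cleared in `M_ℚ`. -/
theorem exists_lattice_multiple (u : QSpan M) :
    ∃ (k : ℕ) (m : M), 0 < k ∧ (k : ℚ) • u = latticeVec m := by
  induction u using TensorProduct.induction_on with
  | zero => exact ⟨1, 0, one_pos, by simp [latticeVec]⟩
  | tmul q m =>
    refine ⟨q.den, q.num • m, q.den_pos, ?_⟩
    rw [latticeVec, TensorProduct.smul_tmul', TensorProduct.tmul_smul, TensorProduct.smul_tmul']
    congr 1
    rw [smul_eq_mul, mul_comm, Rat.mul_den_eq_num, zsmul_eq_mul, mul_one]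
  | add a b ha hb =>
    obtain ⟨k, m, hk, h⟩ := ha
    obtain ⟨k', m', hk', h'⟩ := hb
    refine ⟨k * k', k' • m + k • m', Nat.mul_pos hk hk', ?_⟩
    have e1 : latticeVec (k' • m) = (k' : ℚ) • latticeVec m := by
      rw [latticeVec, latticeVec, TensorProduct.tmul_smul, Nat.cast_smul_eq_nsmul]
    have e2 : latticeVec (k • m') = (k : ℚ) • latticeVec m' := by
      rw [latticeVec, latticeVec, TensorProduct.tmul_smul, Nat.cast_smul_eq_nsmul]
    have e3 : latticeVec (k' • m + k • m') = latticeVec (k' • m) + latticeVec (k • m') :=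
      TensorProduct.tmul_add _ _ _
    rw [e3, e1, e2, ← h, ← h', smul_add, smul_smul, smul_smul]
    push_cast
    rw [mul_comm (k' : ℚ)]

/-- A face of a cone is cut out by a lattice vector. -/
theorem exists_lattice_of_isConeFace {σ τ : PointedCone ℚ (Module.Dual ℚ (QSpan M))}
    (h : IsConeFace τ σ) :
    ∃ m : M, m ∈ dualMonoid σ ∧ ∀ y, y ∈ τ ↔ y ∈ σ ∧ y (latticeVec m) = 0 := by
  obtain ⟨u, hu, hτ⟩ := h
  obtain ⟨k, m, hk, hm⟩ := exists_lattice_multiple u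
  have hk' : (0 : ℚ) < k := by exact_mod_cast hk
  refine ⟨m, fun y hy => ?_, fun y => ?_⟩
  · rw [← hm, map_smul]
    exact mul_nonneg hk'.le (hu y hy)
  · rw [hτ, ← hm, map_smul, smul_eq_mul, mul_eq_zero, or_iff_right hk'.ne']

/-- If `τ = σ ∩ m^⊥` then every element of `τ^∨ ∩ M` lies in `σ^∨ ∩ M` after adding a multiple
of `m`. -/
theorem exists_add_nsmul_mem {σ τ : PointedCone ℚ (Module.Dual ℚ (QSpan M))} (hσ : σ.FG) {m : M}
    (hm : m ∈ dualMonoid σ) (hτ : ∀ y, y ∈ τ ↔ y ∈ σ ∧ y (latticeVec m) = 0) {a : M}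
    (ha : a ∈ dualMonoid τ) : ∃ k : ℕ, ∀ l, k ≤ l → a + l • m ∈ dualMonoid σ := by
  classical
  obtain ⟨s, hs⟩ := hσ
  have hsσ : ∀ g ∈ s, g ∈ σ := fun g hg => hs ▸ Submodule.subset_span hg
  have key : ∀ g ∈ s, ∃ k : ℕ, ∀ l : ℕ, k ≤ l →
      0 ≤ g (latticeVec a) + l * g (latticeVec m) := by
    intro g hg
    rcases (hm g (hsσ g hg)).eq_or_lt with h0 | h0
    · refine ⟨0, fun l _ => ?_⟩
      rw [← h0, mul_zero, add_zero]
      exact ha g ((hτ g).2 ⟨hsσ g hg, h0.symm⟩)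
    · obtain ⟨k, hk⟩ := exists_nat_ge (-(g (latticeVec a)) / g (latticeVec m))
      refine ⟨k, fun l hl => ?_⟩
      rw [div_le_iff₀ h0] at hk
      have : (k : ℚ) * g (latticeVec m) ≤ l * g (latticeVec m) :=
        mul_le_mul_of_nonneg_right (by exact_mod_cast hl) h0.le
      linarith
  choose! k hk using key
  refine ⟨s.sup k, fun l hl y hy => ?_⟩
  have e : latticeVec (a + l • m) = latticeVec a + (l : ℚ) • latticeVec m := by
    rw [latticeVec, TensorProduct.tmul_add, TensorProduct.tmul_smul, Nat.cast_smul_eq_nsmul]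
  rw [e]
  rw [← hs] at hy
  induction hy using Submodule.span_induction with
  | mem g hg =>
    rw [map_add, map_smul, smul_eq_mul]
    exact hk g hg l ((Finset.le_sup hg).trans hl)
  | zero => simp
  | add y z _ _ h1 h2 => exact add_nonneg h1 h2
  | smul c y _ h1 => exact mul_nonneg c.2 h1

/-- For a face `τ = σ ∩ m^⊥` of `σ`, the ring `ℂ[τ^∨ ∩ M]` is the localization of
`ℂ[σ^∨ ∩ M]` at the monomial `e^m`. -/
theorem chartMap_isLocalization {σ τ : PointedCone ℚ (Module.Dual ℚ (QSpan M))} (hσ : σ.FG)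
    (h : τ ≤ σ) {m : M} (hm : m ∈ dualMonoid σ)
    (hτ : ∀ y, y ∈ τ ↔ y ∈ σ ∧ y (latticeVec m) = 0) :
    letI := (chartMap h).toRingHom.toAlgebra
    IsLocalization.Away (AddMonoidAlgebra.single (⟨m, hm⟩ : dualMonoid σ) (1 : ℂ))
      ℂ[dualMonoid τ] := by
  let _ := (chartMap h).toRingHom.toAlgebra
  have hmap : ∀ x, algebraMap ℂ[dualMonoid σ] ℂ[dualMonoid τ] x = chartMap h x := fun _ => rfl
  have hsingle := @chartMap_single M _ σ τ h
  have hneg : -m ∈ dualMonoid τ := by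
    intro y hy
    have := ((hτ y).1 hy).2
    rw [latticeVec, TensorProduct.tmul_neg, map_neg, this, neg_zero]
  have hinj : Function.Injective (chartMap h) :=
    AddMonoidAlgebra.mapDomain_injective (AddSubmonoid.inclusion_injective _)
  set r : ℂ[dualMonoid σ] := AddMonoidAlgebra.single ⟨m, hm⟩ (1 : ℂ) with hr
  refine IsLocalization.Away.mk r ?_ (fun z => ?_) (fun a b hab => ⟨0, ?_⟩)
  · refine IsUnit.of_mul_eq_one (AddMonoidAlgebra.single (⟨-m, hneg⟩ : dualMonoid τ) (1 : ℂ)) ?_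
    rw [hmap, hsingle, AddMonoidAlgebra.single_mul_single, mul_one, AddMonoidAlgebra.one_def]
    congr 1
    ext
    simp
  · induction z using AddMonoidAlgebra.induction_linear with
    | zero => exact ⟨0, 0, by simp⟩
    | add x y hx hy =>
      obtain ⟨k, a, ha⟩ := hx
      obtain ⟨l, b, hb⟩ := hy
      refine ⟨k + l, a * r ^ l + b * r ^ k, ?_⟩
      rw [map_add, map_mul, map_mul, ← ha, ← hb, map_pow, map_pow]
      ring
    | single a c =>
      obtain ⟨k, hk⟩ := exists_add_nsmul_mem hσ hm hτ a.2
      refine ⟨k, AddMonoidAlgebra.single ⟨a + k • m, hk k le_rfl⟩ c, ?_⟩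
      rw [hmap, hmap, hsingle, hsingle, AddMonoidAlgebra.single_pow,
        AddMonoidAlgebra.single_mul_single, one_pow, mul_one]
      congr 1
  · rw [hinj hab]

end Chart

section Variety

variable {M : Type} [AddCommGroup M] (Δ : GenFan M)

/-- The diagram of affine charts `U_σ = Spec ℂ[σ^∨ ∩ M]`, `σ ∈ Δ`, and the maps `U_τ → U_σ`
for `τ ⊆ σ` (in a fan, `τ ⊆ σ` means that `τ` is a face of `σ`). -/
def GenFan.diagram : Δ.cones ⥤ Scheme where
  obj σ := Spec (CommRingCat.of ℂ[dualMonoid σ.1])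
  map f := Spec.map (CommRingCat.ofHom (chartMap f.le).toRingHom)
  map_id σ := by
    rw [← Spec.map_id]
    congr 1
    exact CommRingCat.hom_ext (congrArg AlgHom.toRingHom (chartMap_refl σ.1))
  map_comp f g := by
    rw [← Spec.map_comp]
    congr 1
    exact CommRingCat.hom_ext (congrArg AlgHom.toRingHom (chartMap_comp g.le f.le)).symm

theorem GenFan.face_of_le {τ σ : Δ.cones} (h : τ ≤ σ) : IsConeFace τ.1 σ.1 := by
  have := Δ.inter_face σ.1 σ.2 τ.1 τ.2
  rwa [inf_eq_right.2 h] at this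

theorem GenFan.range_map {τ σ : Δ.cones} (f : τ ⟶ σ) {m : M} (hm : m ∈ dualMonoid σ.1)
    (hτ : ∀ y, y ∈ τ.1 ↔ y ∈ σ.1 ∧ y (latticeVec m) = 0) :
    Set.range (Δ.diagram.map f) = (PrimeSpectrum.basicOpen
      (AddMonoidAlgebra.single (⟨m, hm⟩ : dualMonoid σ.1) (1 : ℂ)) : Set (PrimeSpectrum _)) := by
  let _ := (chartMap f.le).toRingHom.toAlgebra
  have := chartMap_isLocalization (Δ.polyhedral σ.1 σ.2) f.le hm hτ
  exact PrimeSpectrum.localization_away_comap_range ℂ[dualMonoid τ.1] _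

instance GenFan.isOpenImmersion_map {τ σ : Δ.cones} (f : τ ⟶ σ) :
    IsOpenImmersion (Δ.diagram.map f) := by
  obtain ⟨m, hm, hτ⟩ := exists_lattice_of_isConeFace (Δ.face_of_le f.le)
  let _ := (chartMap f.le).toRingHom.toAlgebra
  have := chartMap_isLocalization (Δ.polyhedral σ.1 σ.2) f.le hm hτ
  exact IsOpenImmersion.of_isLocalization
    (AddMonoidAlgebra.single (⟨m, hm⟩ : dualMonoid σ.1) (1 : ℂ))

instance GenFan.isLocallyDirected : (Δ.diagram ⋙ Scheme.forget).IsLocallyDirected where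
  cond := by
    intro i j k fi fj xi xj h
    replace h : Δ.diagram.map fi xi = Δ.diagram.map fj xj := h
    obtain ⟨m, hm, hi⟩ := exists_lattice_of_isConeFace (Δ.face_of_le fi.le)
    obtain ⟨n, hn, hj⟩ := exists_lattice_of_isConeFace (Δ.face_of_le fj.le)
    let l : Δ.cones := ⟨i.1 ⊓ j.1, Δ.face_mem i.1 i.2 _ (Δ.inter_face i.1 i.2 j.1 j.2)⟩
    have hli : l ≤ i := inf_le_left (a := i.1) (b := j.1)
    have hlj : l ≤ j := inf_le_right (a := i.1) (b := j.1)
    have hlk : l ≤ k := hli.trans fi.le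
    have hl : ∀ y, y ∈ l.1 ↔ y ∈ k.1 ∧ y (latticeVec (m + n)) = 0 := by
      intro y
      have e : y (latticeVec (m + n)) = y (latticeVec m) + y (latticeVec n) := by
        rw [latticeVec, TensorProduct.tmul_add, map_add]
      have hl' : y ∈ l.1 ↔ y ∈ i.1 ∧ y ∈ j.1 := Iff.rfl
      rw [hl', hi, hj, e]
      constructor
      · rintro ⟨⟨h1, h2⟩, -, h3⟩
        exact ⟨h1, by rw [h2, h3, add_zero]⟩
      · rintro ⟨h1, h2⟩
        have a1 := hm y h1
        have a2 := hn y h1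
        exact ⟨⟨h1, by linarith⟩, h1, by linarith⟩
    have hp1 : Δ.diagram.map fi xi ∈ Set.range (Δ.diagram.map fi) := ⟨xi, rfl⟩
    have hp2 : Δ.diagram.map fi xi ∈ Set.range (Δ.diagram.map fj) := ⟨xj, h.symm⟩
    have hp : Δ.diagram.map fi xi ∈ Set.range (Δ.diagram.map (homOfLE hlk)) := by
      rw [Δ.range_map fi hm hi] at hp1
      rw [Δ.range_map fj hn hj] at hp2
      rw [Δ.range_map (homOfLE hlk) (add_mem hm hn) hl]
      have e : AddMonoidAlgebra.single (⟨m + n, add_mem hm hn⟩ : dualMonoid k.1) (1 : ℂ) =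
          AddMonoidAlgebra.single (⟨m, hm⟩ : dualMonoid k.1) (1 : ℂ) *
            AddMonoidAlgebra.single (⟨n, hn⟩ : dualMonoid k.1) (1 : ℂ) := by
        rw [AddMonoidAlgebra.single_mul_single, mul_one]
        rfl
      rw [e, PrimeSpectrum.basicOpen_mul]
      exact ⟨hp1, hp2⟩
    obtain ⟨x, hx⟩ := hp
    refine ⟨l, homOfLE hli, homOfLE hlj, x, ?_, ?_⟩
    · apply (Δ.diagram.map fi).isOpenEmbedding.injective
      rw [← hx]
      change Δ.diagram.map fi (Δ.diagram.map (homOfLE hli) x) = _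
      rw [← Scheme.Hom.comp_apply, ← Functor.map_comp]
      rfl
    · apply (Δ.diagram.map fj).isOpenEmbedding.injective
      rw [← h, ← hx]
      change Δ.diagram.map fj (Δ.diagram.map (homOfLE hlj) x) = _
      rw [← Scheme.Hom.comp_apply, ← Functor.map_comp]
      rfl

/-- The toric variety of a (generalized) fan: the charts `U_σ` glued along the open immersions
`U_τ → U_σ` for `τ` a face of `σ`. -/
def GenFan.variety : Scheme := colimit Δ.diagram

/-- The structure morphism of the toric variety of a fan. -/
def GenFan.varietyToSpec : Δ.variety ⟶ Spec (CommRingCat.of ℂ) :=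
  colimit.desc Δ.diagram
    { pt := Spec (CommRingCat.of ℂ)
      ι :=
        { app := fun σ => Spec.map (CommRingCat.ofHom (algebraMap ℂ ℂ[dualMonoid σ.1]))
          naturality := by
            intro τ σ f
            dsimp [GenFan.diagram]
            rw [← Spec.map_comp, Category.comp_id]
            congr 1
            exact CommRingCat.hom_ext (RingHom.ext fun x => (chartMap f.le).commutes x) } }

end Variety

end Toric

/-! ### Geometric invariant theory quotients of `Proj` -/

namespace GIT

/-- An action of a group `G` on a graded `ℂ`-algebra by graded algebra automorphisms. It induces
an action of `G` on `Proj` together with a linearization of `O(1)`. -/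
structure GradedAction {R : Type} [CommRing R] [Algebra ℂ R] (𝒜 : ℕ → Submodule ℂ R)
    (G : Type) [Group G] where
  act : G →* (R ≃ₐ[ℂ] R)
  act_mem : ∀ g n, ∀ r ∈ 𝒜 n, act g r ∈ 𝒜 n

variable {R : Type} [CommRing R] [Algebra ℂ R] {𝒜 : ℕ → Submodule ℂ R}
  {G : Type} [Group G] (ρ : GradedAction 𝒜 G)

namespace GradedAction

/-- The subalgebra `R^G` of invariants. -/
def invariants : Subalgebra ℂ R where
  carrier := {r | ∀ g, ρ.act g r = r}
  mul_mem' := fun ha hb g => by rw [map_mul, ha g, hb g]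
  add_mem' := fun ha hb g => by rw [map_add, ha g, hb g]
  algebraMap_mem' := fun c g => (ρ.act g).commutes c

/-- The grading of `R^G` induced by the grading of `R`. -/
def invGrading (n : ℕ) : Submodule ℂ ρ.invariants :=
  (𝒜 n).comap ρ.invariants.val.toLinearMap

variable [GradedAlgebra 𝒜]

theorem decompose_act (g : G) (r : R) (n : ℕ) :
    (DirectSum.decompose 𝒜 (ρ.act g r) n : R) = ρ.act g (DirectSum.decompose 𝒜 r n) := by
  classical
  induction r using DirectSum.Decomposition.inductionOn 𝒜 with
  | zero => simp
  | @homogeneous i a =>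
    rw [DirectSum.decompose_coe, DirectSum.decompose_of_mem 𝒜 (ρ.act_mem g i a a.2)]
    by_cases h : i = n
    · subst h
      rw [DirectSum.of_eq_same, DirectSum.of_eq_same]
    · rw [DirectSum.of_eq_of_ne _ _ _ (Ne.symm h), DirectSum.of_eq_of_ne _ _ _ (Ne.symm h)]
      simp
  | add a b ha hb =>
    rw [map_add, DirectSum.decompose_add, DirectSum.decompose_add, DirectSum.add_apply,
      DirectSum.add_apply, Submodule.coe_add, Submodule.coe_add, map_add, ha, hb]

theorem decompose_mem_invariants {r : R} (hr : r ∈ ρ.invariants) (n : ℕ) :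
    (DirectSum.decompose 𝒜 r n : R) ∈ ρ.invariants := by
  intro g
  rw [← ρ.decompose_act, hr g]

instance invGrading_gradedMonoid : SetLike.GradedMonoid ρ.invGrading where
  one_mem := SetLike.GradedOne.one_mem (A := 𝒜)
  mul_mem := fun _ _ _ _ ha hb => SetLike.GradedMul.mul_mem (A := 𝒜) ha hb

theorem invGrading_isInternal : DirectSum.IsInternal ρ.invGrading := by
  classical
  let φ : (n : ℕ) → ρ.invGrading n →+ 𝒜 n := fun n =>
    { toFun := fun r => ⟨r.1.1, r.2⟩
      map_zero' := rfl
      map_add' := fun _ _ => rfl }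
  have hφ : Function.Injective (DirectSum.map φ) := by
    rw [DirectSum.map_injective]
    intro n a b hab
    exact Subtype.ext (Subtype.ext (congrArg (fun r : 𝒜 n => (r : R)) hab))
  have hcomm : ∀ x, DirectSum.coeAddMonoidHom 𝒜 (DirectSum.map φ x) =
      (DirectSum.coeAddMonoidHom ρ.invGrading x : ρ.invariants).1 := by
    intro x
    induction x using DirectSum.induction_on with
    | zero => simp
    | of n a =>
      rw [DirectSum.map_of, DirectSum.coeAddMonoidHom_of, DirectSum.coeAddMonoidHom_of]
      rfl
    | add x y hx hy => rw [map_add, map_add, map_add, hx, hy]; rfl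
  constructor
  · intro x y hxy
    apply hφ
    apply (DirectSum.Decomposition.isInternal 𝒜).injective
    rw [hcomm, hcomm, hxy]
  · intro r
    refine ⟨∑ n ∈ (DirectSum.decompose 𝒜 (r : R)).support,
      DirectSum.of (fun n => ρ.invGrading n) n
        ⟨⟨DirectSum.decompose 𝒜 (r : R) n, ρ.decompose_mem_invariants r.2 n⟩,
          (DirectSum.decompose 𝒜 (r : R) n).2⟩, ?_⟩
    apply Subtype.ext
    rw [map_sum, AddSubmonoidClass.coe_finsetSum]
    simp only [DirectSum.coeAddMonoidHom_of]
    exact DirectSum.sum_support_decompose 𝒜 (r : R)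

instance invGrading_gradedAlgebra : GradedAlgebra ρ.invGrading :=
  { invGrading_gradedMonoid ρ, ρ.invGrading_isInternal.chooseDecomposition with }

/-- The `G`-orbit of a point of `Proj R`, in terms of homogeneous prime ideals. -/
def orbit (x : Proj 𝒜) : Set (Proj 𝒜) :=
  {y | ∃ g, y.asHomogeneousIdeal.toIdeal = x.asHomogeneousIdeal.toIdeal.comap (ρ.act g)}

/-- The stabilizer in `G` of a point of `Proj R`. -/
def stabilizer (x : Proj 𝒜) : Set G :=
  {g | x.asHomogeneousIdeal.toIdeal.comap (ρ.act g) = x.asHomogeneousIdeal.toIdeal}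

/-- An invariant homogeneous element `f` of positive degree such that all (closed) points of the
affine open subset `D₊(f)` of `Proj R` have finite stabilizers and orbits that are closed in
`D₊(f)`. -/
structure IsStableSection (f : R) : Prop where
  invariant : f ∈ ρ.invariants
  homogeneous : ∃ n, 0 < n ∧ f ∈ 𝒜 n
  finite_stabilizer : ∀ x ∈ Proj.basicOpen 𝒜 f, IsClosed ({x} : Set (Proj 𝒜)) →
    (ρ.stabilizer x).Finite
  closed_orbit : ∀ x ∈ Proj.basicOpen 𝒜 f, IsClosed ({x} : Set (Proj 𝒜)) →
    ∀ y ∈ Proj.basicOpen 𝒜 f, IsClosed ({y} : Set (Proj 𝒜)) →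
      y ∈ closure (ρ.orbit x) → y ∈ ρ.orbit x

/-- The open subset `X^s` of (properly) stable points of `X = Proj R` with respect to the
linearization of `O(1)` given by the action on `R`. -/
def stableLocus : (Proj 𝒜).Opens :=
  ⨆ f : {f : R // ρ.IsStableSection f}, Proj.basicOpen 𝒜 f.1

/-- For an open subset `U` of `X = Proj R`, the union of the affine quotients
`D₊(f) // G = Spec (R_f)_0^G` inside `X // G = Proj R^G`, over all invariant homogeneous `f` of
positive degree with `D₊(f) ⊆ U`. -/
def quotientOpens (U : (Proj 𝒜).Opens) : (Proj ρ.invGrading).Opens :=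
  ⨆ f : {f : ρ.invariants // (∃ n, 0 < n ∧ f ∈ ρ.invGrading n) ∧ Proj.basicOpen 𝒜 f.1 ≤ U},
    Proj.basicOpen ρ.invGrading f.1

/-- The GIT quotient `X^s // G` of the stable locus, as an open subscheme of
`X // G = Proj R^G`. -/
def stableQuotient : Scheme := (ρ.quotientOpens ρ.stableLocus).toScheme

/-- The structure morphism of `X^s // G`. -/
def stableQuotientToSpec : ρ.stableQuotient ⟶ Spec (CommRingCat.of ℂ) :=
  (ρ.quotientOpens ρ.stableLocus).ι ≫ Proj.toSpecZero ρ.invGrading ≫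
    Spec.map (CommRingCat.ofHom (algebraMap ℂ (ρ.invGrading 0)))

end GradedAction

end GIT

/-! ### The scheme `X(Λ, P)` and the torus action on it -/

namespace Toric

open Polyhedral

variable {M Λ B : Type} [AddCommGroup M] [AddCommGroup Λ] [AddCommGroup B]

/-- The monoid `C(P) ∩ (ℤ × Λ)`, where `C(P)` is the closed cone over `P`. The first coordinate
is nonnegative on `C(P)`, so it is taken to be a natural number. -/
def polyMonoid (P : Set (QSpan Λ)) : AddSubmonoid (ℕ × Λ) where
  carrier := {a | ((a.1 : ℚ), latticeVec a.2) ∈ coneOver P}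
  add_mem' := by
    intro a b ha hb
    have h := (coneOver P).add_mem ha hb
    have e : ((((a + b).1 : ℕ) : ℚ), latticeVec (a + b).2) =
        ((a.1 : ℚ), latticeVec a.2) + ((b.1 : ℚ), latticeVec b.2) := by
      simp [latticeVec, TensorProduct.tmul_add]
    exact (congrArg (· ∈ coneOver P) e).mpr h
  zero_mem' := by
    have h := (coneOver P).zero_mem
    have e : ((((0 : ℕ × Λ).1 : ℕ) : ℚ), latticeVec (0 : ℕ × Λ).2) = 0 := by
      simp [latticeVec]
    exact (congrArg (· ∈ coneOver P) e).mpr h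

/-- The degree `C(P) ∩ (ℤ × Λ) → ℕ`, `(n, λ) ↦ n`. -/
def polyDegree (P : Set (QSpan Λ)) : polyMonoid P →+ ℕ :=
  (AddMonoidHom.fst ℕ Λ).comp (polyMonoid P).subtype

/-- The grading of `ℂ[C(P) ∩ (ℤ × Λ)]` by the first coordinate. -/
abbrev polyGrading (P : Set (QSpan Λ)) : ℕ → Submodule ℂ ℂ[polyMonoid P] :=
  AddMonoidAlgebra.gradeBy ℂ (polyDegree P)

/-- `X_P = X(Λ, P) = Proj ℂ[C(P) ∩ (ℤ × Λ)]`. -/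
abbrev polyScheme (P : Set (QSpan Λ)) : Scheme := Proj (polyGrading P)

/-- The torus `T_B = Hom_ℤ(B, ℂ^*)`. -/
abbrev Torus (B : Type) [AddCommGroup B] : Type := Multiplicative B →* ℂˣ

/-- The automorphism `e^(n, λ) ↦ t(d(λ)) e^(n, λ)` of `ℂ[C(P) ∩ (ℤ × Λ)]` given by `t ∈ T_B`. -/
def torusActHom (d : Λ →ₗ[ℤ] B) (P : Set (QSpan Λ)) (t : Torus B) :
    ℂ[polyMonoid P] →ₐ[ℂ] ℂ[polyMonoid P] :=
  AddMonoidAlgebra.lift ℂ _ _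
    { toFun := fun a => AddMonoidAlgebra.single a.toAdd
        (t (Multiplicative.ofAdd (d a.toAdd.1.2)) : ℂ)
      map_one' := by
        have h : (1 : Multiplicative (polyMonoid P)).toAdd = 0 := rfl
        simp [h, AddMonoidAlgebra.one_def]
      map_mul' := by
        intro a b
        have h : (a * b).toAdd = a.toAdd + b.toAdd := rfl
        simp [h, AddMonoidAlgebra.single_mul_single, ofAdd_add] }

theorem torusActHom_single (d : Λ →ₗ[ℤ] B) (P : Set (QSpan Λ)) (t : Torus B) (a : polyMonoid P)
    (c : ℂ) : torusActHom d P t (AddMonoidAlgebra.single a c) =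
      AddMonoidAlgebra.single a (c * (t (Multiplicative.ofAdd (d a.1.2)) : ℂ)) := by
  rw [torusActHom, AddMonoidAlgebra.lift_single, MonoidHom.coe_mk, OneHom.coe_mk,
    AddMonoidAlgebra.smul_single, smul_eq_mul]
  rfl

theorem torusActHom_mul (d : Λ →ₗ[ℤ] B) (P : Set (QSpan Λ)) (t t' : Torus B)
    (x : ℂ[polyMonoid P]) :
    torusActHom d P (t * t') x = torusActHom d P t (torusActHom d P t' x) := by
  induction x using AddMonoidAlgebra.induction_linear with
  | zero => simp
  | add x y hx hy => simp only [map_add, hx, hy]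
  | single a c =>
    rw [torusActHom_single, torusActHom_single, torusActHom_single, MonoidHom.mul_apply,
      Units.val_mul]
    congr 1
    ring

theorem torusActHom_one (d : Λ →ₗ[ℤ] B) (P : Set (QSpan Λ)) (x : ℂ[polyMonoid P]) :
    torusActHom d P (1 : Torus B) x = x := by
  induction x using AddMonoidAlgebra.induction_linear with
  | zero => simp
  | add x y hx hy => rw [map_add, hx, hy]
  | single a c => rw [torusActHom_single, MonoidHom.one_apply, Units.val_one, mul_one]

/-- The action of `T_B` on `ℂ[C(P) ∩ (ℤ × Λ)]` through `T_B → T_Λ` (dual to `d : Λ → B`). -/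
def torusAction (d : Λ →ₗ[ℤ] B) (P : Set (QSpan Λ)) :
    GIT.GradedAction (polyGrading P) (Torus B) where
  act :=
    { toFun := fun t => AlgEquiv.ofAlgHom (torusActHom d P t) (torusActHom d P t⁻¹)
        (AlgHom.ext fun x => by
          rw [AlgHom.comp_apply, ← torusActHom_mul,
            show t * t⁻¹ = 1 from mul_inv_cancel t, torusActHom_one]; rfl)
        (AlgHom.ext fun x => by
          rw [AlgHom.comp_apply, ← torusActHom_mul,
            show t⁻¹ * t = 1 from inv_mul_cancel t, torusActHom_one]; rfl)
      map_one' := AlgEquiv.ext fun x => torusActHom_one d P x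
      map_mul' := fun t t' => AlgEquiv.ext fun x => torusActHom_mul d P t t' x }
  act_mem := by
    intro t n r hr
    change torusActHom d P t r ∈ polyGrading P n
    rw [← r.sum_coeff_single, map_finsuppSum]
    refine Submodule.sum_mem _ fun a ha => ?_
    beta_reduce
    rw [torusActHom_single, ← hr a ha]
    exact AddMonoidAlgebra.single_mem_gradeBy _ _ _

/-! ### `M`-stable faces -/

/-- The inclusion `M_ℚ → Λ_ℚ` induced by `i : M → Λ`. -/
def inclQ (i : M →ₗ[ℤ] Λ) : QSpan M →ₗ[ℚ] QSpan Λ := i.baseChange ℚ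

/-- `F_M = F ∩ M_ℚ`, as a subset of `M_ℚ`. -/
def restrict (i : M →ₗ[ℤ] Λ) (F : Set (QSpan Λ)) : Set (QSpan M) := inclQ i ⁻¹' F

/-- A face `F` of `P` is `M`-stable if `M_ℚ` meets `inn(F)` transversally: `inn(F) ∩ M_ℚ ≠ ∅` and
`⟨F⟩ + M_ℚ = Λ_ℚ`, where `⟨F⟩` is spanned by the differences of elements of `F`. -/
structure IsMStable (i : M →ₗ[ℤ] Λ) (P F : Set (QSpan Λ)) : Prop where
  isFace : IsFace P F
  meets : (relInterior F ∩ (LinearMap.range (inclQ i) : Set (QSpan Λ))).Nonempty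
  transversal : vectorSpan ℚ F ⊔ LinearMap.range (inclQ i) = ⊤

/-- `N^s(P_M)`: the normal cones `N_{F_M} P_M` for the `M`-stable faces `F` of `P`. -/
def stableNormalCones (i : M →ₗ[ℤ] Λ) (P : Set (QSpan Λ)) :
    Set (PointedCone ℚ (Module.Dual ℚ (QSpan M))) :=
  {σ | ∃ F, IsMStable i P F ∧ σ = normalCone (restrict i P) (restrict i F)}

end Toric

end

/-! Write `P` as a finite intersection of half-spaces and describe everything through the
constraints that are active, i.e. hold with equality. A face is the locus where a set of constraints
is active, its relative interior consists of the points with no further active constraint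
(`mem_relInterior_iff`), and by Farkas the normal cone at a point is generated by the active
functionals (`normalCone_eq_hull`). The cones of `N(P_M)` can therefore be indexed by points `m` of
`P_M`. The face with `m` in its relative interior is `M`-stable exactly when the common kernel of
the constraints active at `m` and `M_ℚ` together span `Λ_ℚ` (`IsTransversal`). Passing to a face of
a cone only drops active constraints, which preserves this condition; hence both sets of cones are
generalized fans.

An exponent `a = (n, λ)` with `n > 0` and `λ ∈ M` is an invariant monomial and also marks the point
`λ/n` of `P_M`. The degree-zero part of the localization of `R^{T_B}` at `e^a` and the algebra
`ℂ[σ^∨ ∩ M]`, with `σ` the normal cone at `λ/n`, have the same image in `ℂ[Λ]`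
(`range_awayToGroupAlgebra`). Products of monomials correspond to intersections of cones, so these
charts glue to an open immersion of the toric variety into `Proj R^{T_B}`.

It remains to see that its image is the stable quotient (`mem_quotientOpens_stableLocus`). Closed
points of `Proj R` are given by homomorphisms `R → ℂ`, and at a point of `D₊(e^a)` every monomial in
the face of `a` is nonzero. If `a` is transversal, positive multiples of all weights in `B` occur in
this face, so stabilizers are finite. Orbits are closed because the ratio of two points, one in the
orbit closure of the other, depends only on degree and weight, and extends to a character since `ℂˣ`
is divisible. If `a` is not transversal, a nonzero functional on `B` kills the weights in its face
and yields infinite stabilizers there; hence no `D₊(f)` with a monomial of `f` in that face lies in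
the stable locus (`not_basicOpen_le_stableLocus`). -/

noncomputable section

namespace Polyhedral

/-! ### Faces, normal cones and relative interiors in terms of active constraints. -/

section Halfspaces

variable {W α : Type} [AddCommGroup W] [Module ℚ W]

/-- **Farkas' lemma** over `ℚ`: a functional that is nonnegative wherever finitely many given
functionals are is a nonnegative combination of them. -/
theorem exists_nonneg_combination (s : Finset α) :
    ∀ (ℓ : α → Module.Dual ℚ W) (y : Module.Dual ℚ W),
      (∀ u, (∀ p ∈ s, 0 ≤ ℓ p u) → 0 ≤ y u) →
      ∃ c : α → ℚ, (∀ p, 0 ≤ c p) ∧ y = ∑ p ∈ s, c p • ℓ p := by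
  classical
  induction s using Finset.induction_on with
  | empty =>
    intro ℓ y h
    refine ⟨0, fun _ => le_rfl, LinearMap.ext fun u => ?_⟩
    have h1 := h u (by simp)
    have h2 := h (-u) (by simp)
    rw [map_neg] at h2
    simp only [Finset.sum_empty, LinearMap.zero_apply]
    linarith
  | insert a s ha ih =>
    intro ℓ y h
    by_cases hy : ∀ u, (∀ p ∈ s, 0 ≤ ℓ p u) → 0 ≤ y u
    · obtain ⟨c, hc, e⟩ := ih ℓ y hy
      refine ⟨Function.update c a 0, fun p => ?_, ?_⟩
      · by_cases hp : p = a
        · subst hp; simp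
        · simpa [hp] using hc p
      · rw [Finset.sum_insert ha, Function.update_self, zero_smul, zero_add, e]
        refine Finset.sum_congr rfl fun p hp => ?_
        rw [Function.update_of_ne (by rintro rfl; exact ha hp)]
    · push Not at hy
      obtain ⟨w, hw, hyw⟩ := hy
      have hlw : ℓ a w < 0 := by
        by_contra hcon
        push Not at hcon
        refine absurd (h w fun p hp => ?_) (not_le.2 hyw)
        rcases Finset.mem_insert.1 hp with rfl | hp
        · exact hcon
        · exact hw p hp
      have key : ∀ (g : Module.Dual ℚ W) (u : W),
          (ℓ a w • g - g w • ℓ a) u = ℓ a w * g u - g w * ℓ a u := fun g u => by simp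
      -- Each functional `g` is composed with `u ↦ -ℓ_a(w) u + ℓ_a(u) w`, a positive multiple of the
      -- projection onto `ker ℓ_a` along `w`. This kills `ℓ_a`, so the induction hypothesis applies
      -- to the rest.
      obtain ⟨c, hc, e⟩ := ih (fun p => -(ℓ a w • ℓ p - ℓ p w • ℓ a)) (-(ℓ a w • y - y w • ℓ a))
        (by
          intro u hu
          have := h ((-ℓ a w) • u + ℓ a u • w) (by
            intro p hp
            rcases Finset.mem_insert.1 hp with rfl | hp
            · simp only [map_add, map_smul, smul_eq_mul]
              linarith [mul_comm (ℓ p u) (ℓ p w)]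
            · have := hu p hp
              simp only [LinearMap.neg_apply, key] at this
              simp only [map_add, map_smul, smul_eq_mul]
              linarith [mul_comm (ℓ a u) (ℓ p w)])
          simp only [map_add, map_smul, smul_eq_mul] at this
          simp only [LinearMap.neg_apply, key]
          linarith [mul_comm (ℓ a u) (y w)])
      -- The coefficient of `ℓ_a` is forced by evaluating the required identity at `w`; it is
      -- nonnegative since `y(w) < 0` and `ℓ_a(w) < 0`.
      refine ⟨Function.update c a ((∑ p ∈ s, c p * ℓ p w - y w) / (-ℓ a w)), fun p => ?_, ?_⟩
      · by_cases hp : p = a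
        · subst hp
          rw [Function.update_self]
          refine div_nonneg ?_ (by linarith)
          have := Finset.sum_nonneg fun q hq => mul_nonneg (hc q) (hw q hq)
          linarith
        · simpa [hp] using hc p
      · rw [Finset.sum_insert ha, Function.update_self]
        have e2 : ∑ p ∈ s, Function.update c a ((∑ p ∈ s, c p * ℓ p w - y w) / (-ℓ a w)) p • ℓ p =
            ∑ p ∈ s, c p • ℓ p := by
          refine Finset.sum_congr rfl fun p hp => ?_
          rw [Function.update_of_ne (by rintro rfl; exact ha hp)]
        rw [e2]
        refine LinearMap.ext fun u => ?_
        have e3 := LinearMap.congr_fun e u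
        simp only [LinearMap.neg_apply, key, LinearMap.sum_apply, LinearMap.smul_apply,
          smul_eq_mul, mul_neg, mul_sub, Finset.sum_neg_distrib, Finset.sum_sub_distrib] at e3
        have e4 : ∑ p ∈ s, c p * (ℓ a w * ℓ p u) = ℓ a w * ∑ p ∈ s, c p * ℓ p u := by
          rw [Finset.mul_sum]
          exact Finset.sum_congr rfl fun p _ => by ring
        have e5 : ∑ p ∈ s, c p * (ℓ p w * ℓ a u) = ℓ a u * ∑ p ∈ s, c p * ℓ p w := by
          rw [Finset.mul_sum]
          exact Finset.sum_congr rfl fun p _ => by ring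
        rw [e4, e5] at e3
        simp only [LinearMap.add_apply, LinearMap.sum_apply, LinearMap.smul_apply, smul_eq_mul]
        have hne : ℓ a w ≠ 0 := hlw.ne
        field_simp
        linarith

/-- The intersection of the half-spaces `c p ≤ ℓ p`, `p ∈ s`. -/
def halfspaces (s : Finset α) (ℓ : α → Module.Dual ℚ W) (c : α → ℚ) : Set W :=
  {w | ∀ p ∈ s, c p ≤ ℓ p w}

variable {s : Finset α} {ℓ : α → Module.Dual ℚ W} {c : α → ℚ}

/-- From a point of a polyhedron one can move a little in every direction in which the active
constraints do not decrease; constraints that are not active remain so. -/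
theorem exists_small_step {m : W} (hm : m ∈ halfspaces s ℓ c) {u : W}
    (hu : ∀ p ∈ s, ℓ p m = c p → 0 ≤ ℓ p u) :
    ∃ ε : ℚ, 0 < ε ∧ ∀ t, 0 ≤ t → t ≤ ε →
      ∀ p ∈ s, c p ≤ ℓ p (m + t • u) ∧ (ℓ p m ≠ c p → c p < ℓ p (m + t • u)) := by
  classical
  have key : ∀ p ∈ s, ∃ ε : ℚ, 0 < ε ∧ ∀ t, 0 ≤ t → t ≤ ε →
      c p ≤ ℓ p (m + t • u) ∧ (ℓ p m ≠ c p → c p < ℓ p (m + t • u)) := by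
    intro p hp
    simp only [map_add, map_smul, smul_eq_mul]
    by_cases h : ℓ p m = c p
    · refine ⟨1, one_pos, fun t ht _ => ⟨?_, fun h' => absurd h h'⟩⟩
      rw [h]
      linarith [mul_nonneg ht (hu p hp h)]
    · have hlt : c p < ℓ p m := lt_of_le_of_ne (hm p hp) (Ne.symm h)
      -- The `+ 1` keeps the denominator positive and makes the resulting inequality strict even at
      -- `t = ε`.
      refine ⟨(ℓ p m - c p) / (|ℓ p u| + 1), by positivity, fun t ht hte => ?_⟩
      have h1 : t * (|ℓ p u| + 1) ≤ ℓ p m - c p := (le_div_iff₀ (by positivity)).1 hte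
      have h2 : -(t * |ℓ p u|) ≤ t * ℓ p u := by
        rw [← mul_neg]
        exact mul_le_mul_of_nonneg_left (neg_abs_le _) ht
      have h3 : c p < ℓ p m + t * ℓ p u := by
        rcases ht.eq_or_lt with rfl | ht
        · simpa using hlt
        · linarith
      exact ⟨h3.le, fun _ => h3⟩
  clear hu
  induction s using Finset.induction_on with
  | empty => exact ⟨1, one_pos, by simp⟩
  | insert a s ha ih =>
    obtain ⟨ε, hε, h⟩ := ih (fun p hp => hm p (Finset.mem_insert_of_mem hp))
      fun p hp => key p (Finset.mem_insert_of_mem hp)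
    obtain ⟨δ, hδ, h'⟩ := key a (Finset.mem_insert_self a s)
    refine ⟨min ε δ, lt_min hε hδ, fun t ht hte p hp => ?_⟩
    rcases Finset.mem_insert.1 hp with rfl | hp
    · exact h' t ht (hte.trans (min_le_right _ _))
    · exact h t ht (hte.trans (min_le_left _ _)) p hp

theorem mem_normalCone_singleton {P : Set W} {m : W} {y : Module.Dual ℚ W} :
    y ∈ normalCone P {m} ↔ ∀ z ∈ P, y m ≤ y z := by
  change (∀ x ∈ ({m} : Set W), ∀ z ∈ P, y x ≤ y z) ↔ _
  simp

/-- The normal cone at a point is determined by the active constraints. -/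
theorem mem_normalCone_iff {m : W} (hm : m ∈ halfspaces s ℓ c) {y : Module.Dual ℚ W} :
    y ∈ normalCone (halfspaces s ℓ c) {m} ↔
      ∀ u, (∀ p ∈ s, ℓ p m = c p → 0 ≤ ℓ p u) → 0 ≤ y u := by
  rw [mem_normalCone_singleton]
  constructor
  · intro h u hu
    obtain ⟨ε, hε, hs⟩ := exists_small_step hm hu
    have := h _ fun p hp => (hs ε hε.le le_rfl p hp).1
    rw [map_add, map_smul, smul_eq_mul] at this
    exact nonneg_of_mul_nonneg_right (by linarith) hε
  · intro h z hz
    have := h (z - m) fun p hp e => by rw [map_sub, e]; linarith [hz p hp]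
    rw [map_sub] at this
    linarith

/-- By `mem_normalCone_iff` the normal cone consists of the functionals that are nonnegative
wherever all active ones are; Farkas turns this into generators. -/
theorem normalCone_eq_hull {m : W} (hm : m ∈ halfspaces s ℓ c) :
    normalCone (halfspaces s ℓ c) {m} =
      PointedCone.hull ℚ (ℓ '' {p | p ∈ s ∧ ℓ p m = c p}) := by
  classical
  apply le_antisymm
  · intro y hy
    rw [mem_normalCone_iff hm] at hy
    obtain ⟨k, hk, rfl⟩ := exists_nonneg_combination (s.filter fun p => ℓ p m = c p) ℓ y
      (fun u hu => hy u fun p hp e => hu p (Finset.mem_filter.2 ⟨hp, e⟩))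
    refine Submodule.sum_mem _ fun p hp => ?_
    exact Submodule.smul_mem _ (⟨k p, hk p⟩ : {x : ℚ // 0 ≤ x})
      (Submodule.subset_span ⟨p, Finset.mem_filter.1 hp, rfl⟩)
  · refine Submodule.span_le.2 ?_
    rintro _ ⟨p, ⟨hp, e⟩, rfl⟩
    rw [SetLike.mem_coe, mem_normalCone_iff hm]
    exact fun u hu => hu p hp e

theorem normalCone_fg {m : W} (hm : m ∈ halfspaces s ℓ c) :
    (normalCone (halfspaces s ℓ c) {m}).FG := by
  rw [normalCone_eq_hull hm]
  exact Submodule.fg_span ((s.finite_toSet.subset fun p hp => hp.1).image _)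

/-- The cone depends only on the active set, a subset of `s`. -/
theorem finite_normalCones_singleton :
    {σ | ∃ m ∈ halfspaces s ℓ c, σ = normalCone (halfspaces s ℓ c) {m}}.Finite := by
  classical
  refine ((s.powerset.finite_toSet).image
    fun I : Finset α => PointedCone.hull ℚ (ℓ '' (I : Set α))).subset ?_
  rintro _ ⟨m, hm, rfl⟩
  refine ⟨s.filter fun p => ℓ p m = c p,
    Finset.mem_coe.2 (Finset.mem_powerset.2 (Finset.filter_subset _ _)), ?_⟩
  rw [normalCone_eq_hull hm]
  simp

theorem midpoint_mem_halfspaces {m m' : W} (hm : m ∈ halfspaces s ℓ c)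
    (hm' : m' ∈ halfspaces s ℓ c) : (2⁻¹ : ℚ) • (m + m') ∈ halfspaces s ℓ c := by
  intro p hp
  have := hm p hp
  have := hm' p hp
  rw [map_smul, map_add, smul_eq_mul]
  linarith

/-- The mean of two numbers that are at least `c p` equals `c p` only if both do. Midpoints thus
intersect active sets, as sums of exponents do later. -/
theorem active_midpoint {m m' : W} (hm : m ∈ halfspaces s ℓ c)
    (hm' : m' ∈ halfspaces s ℓ c) {p : α} (hp : p ∈ s) :
    ℓ p ((2⁻¹ : ℚ) • (m + m')) = c p ↔ ℓ p m = c p ∧ ℓ p m' = c p := by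
  have := hm p hp
  have := hm' p hp
  rw [map_smul, map_add, smul_eq_mul]
  constructor
  · intro h
    constructor <;> linarith
  · rintro ⟨h, h'⟩
    linarith

theorem normalCone_midpoint {m m' : W} (hm : m ∈ halfspaces s ℓ c)
    (hm' : m' ∈ halfspaces s ℓ c) :
    normalCone (halfspaces s ℓ c) {(2⁻¹ : ℚ) • (m + m')} =
      normalCone (halfspaces s ℓ c) {m} ⊓ normalCone (halfspaces s ℓ c) {m'} := by
  ext y
  rw [Submodule.mem_inf, mem_normalCone_singleton, mem_normalCone_singleton,
    mem_normalCone_singleton, map_smul, map_add, smul_eq_mul]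
  constructor
  · intro h
    have h1 := h m hm
    have h2 := h m' hm'
    constructor <;> intro z hz <;> linarith [h z hz]
  · rintro ⟨h, h'⟩ z hz
    linarith [h z hz, h' z hz]

/-- The supporting vector is `m' - m`: a functional minimal at `m` is nonnegative on it, and
vanishes on it exactly when it is also minimal at `m'`. -/
theorem isConeFace_inf {P : Set W} {m m' : W} (hm : m ∈ P) (hm' : m' ∈ P) :
    IsConeFace (normalCone P {m} ⊓ normalCone P {m'}) (normalCone P {m}) := by
  refine ⟨m' - m, fun y hy => ?_, fun y => ?_⟩
  · rw [mem_normalCone_singleton] at hy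
    rw [map_sub]
    linarith [hy m' hm']
  · rw [Submodule.mem_inf, map_sub, mem_normalCone_singleton, mem_normalCone_singleton]
    constructor
    · rintro ⟨h, h'⟩
      exact ⟨h, by linarith [h m' hm', h' m hm]⟩
    · rintro ⟨h, h'⟩
      exact ⟨h, fun z hz => by linarith [h z hz]⟩

/-- A face of the normal cone at a point is the normal cone at a point with fewer active
constraints. -/
theorem exists_normalCone_of_isConeFace {m : W} (hm : m ∈ halfspaces s ℓ c)
    {τ : PointedCone ℚ (Module.Dual ℚ W)}
    (hτ : IsConeFace τ (normalCone (halfspaces s ℓ c) {m})) :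
    ∃ m' ∈ halfspaces s ℓ c, (∀ p ∈ s, ℓ p m' = c p → ℓ p m = c p) ∧
      τ = normalCone (halfspaces s ℓ c) {m'} := by
  obtain ⟨u, hu, hτ⟩ := hτ
  -- The active functionals belong to the normal cone, so `u` is nonnegative on them and is an
  -- admissible direction.
  obtain ⟨ε, hε, hs⟩ := exists_small_step hm (u := u) fun p hp e =>
    hu _ ((mem_normalCone_iff hm).2 fun v hv => hv p hp e)
  have hm2 : m + ε • u ∈ halfspaces s ℓ c := fun p hp => (hs ε hε.le le_rfl p hp).1
  -- Half the step makes the new point the midpoint of `m` and `m + ε u`, both in the polyhedron: a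
  -- functional minimal there is minimal at both ends, hence zero on `u`.
  refine ⟨m + (ε / 2) • u, fun p hp => (hs (ε / 2) (by linarith) (by linarith) p hp).1,
    fun p hp h => ?_, ?_⟩
  · by_contra hcon
    exact ((hs (ε / 2) (by linarith) (by linarith) p hp).2 hcon).ne' h
  · ext y
    rw [hτ, mem_normalCone_singleton, mem_normalCone_singleton, map_add, map_smul, smul_eq_mul]
    constructor
    · rintro ⟨h, h'⟩ z hz
      rw [h', mul_zero, add_zero]
      exact h z hz
    · intro h
      have h1 := h m hm
      have h2 := h _ hm2
      rw [map_add, map_smul, smul_eq_mul] at h2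
      have h3 : y u = 0 := by
        have : ε * y u = 0 := by linarith
        exact (mul_eq_zero.1 this).resolve_left hε.ne'
      refine ⟨fun z hz => ?_, h3⟩
      have := h z hz
      rwa [h3, mul_zero, add_zero] at this

/-- If every constraint active at `m ∈ F` is active on `F`, then `F` and `m` have the same normal
cone. -/
theorem normalCone_eq_singleton {F : Set W} (hF : F ⊆ halfspaces s ℓ c) {m : W} (hm : m ∈ F)
    (h : ∀ p ∈ s, ℓ p m = c p → ∀ z ∈ F, ℓ p z = c p) :
    normalCone (halfspaces s ℓ c) F = normalCone (halfspaces s ℓ c) {m} := by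
  ext y
  constructor
  · exact fun hy x hx z hz => by
      rw [Set.mem_singleton_iff.1 hx]
      exact hy m hm z hz
  · intro hy x hx z hz
    have h1 := (mem_normalCone_iff (hF hm)).1 hy (m - x) fun p hp e => by
      rw [map_sub, e, h p hp e x hx, sub_self]
    have h2 := mem_normalCone_singleton.1 hy z hz
    rw [map_sub] at h1
    linarith

/-- A face of a polyhedron has a point at which as few constraints as possible are active. -/
theorem exists_minimal_active {F : Set W} (hF : IsFace (halfspaces s ℓ c) F) :
    ∃ m ∈ F, ∀ p ∈ s, ℓ p m = c p → ∀ z ∈ F, ℓ p z = c p := by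
  classical
  obtain ⟨⟨x, hx⟩, y, rfl⟩ := hF
  -- Minimise the number of active constraints on the face. If a constraint active at the minimiser
  -- `m` were inactive at some `z` in the face, the midpoint of `m` and `z` would have fewer.
  let N : W → ℕ := fun z => (s.filter fun p => ℓ p z = c p).card
  obtain ⟨m, hm, hmin⟩ := WellFounded.has_min (measure N).wf _ ⟨x, hx⟩
  refine ⟨m, hm, fun p hp e z hz => ?_⟩
  by_contra hne
  refine hmin ((2⁻¹ : ℚ) • (m + z)) ⟨midpoint_mem_halfspaces hm.1 hz.1, fun v hv => ?_⟩ ?_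
  · rw [map_smul, map_add, smul_eq_mul]
    linarith [hm.2 v hv, hz.2 v hv]
  · refine Finset.card_lt_card ⟨fun q hq => ?_, fun hsub => ?_⟩
    · rw [Finset.mem_filter] at hq ⊢
      exact ⟨hq.1, ((active_midpoint hm.1 hz.1 hq.1).1 hq.2).1⟩
    · have := hsub (Finset.mem_filter.2 ⟨hp, e⟩)
      exact hne ((active_midpoint hm.1 hz.1 hp).1 (Finset.mem_filter.1 this).2).2

/-- The points of a polyhedron at which all constraints active at `m` are active. -/
def activeFace (s : Finset α) (ℓ : α → Module.Dual ℚ W) (c : α → ℚ) (m : W) : Set W :=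
  {z | z ∈ halfspaces s ℓ c ∧ ∀ p ∈ s, ℓ p m = c p → ℓ p z = c p}

/-- The sum of the active functionals exposes the face: each summand is minimal at `m`, so the sum
attains its minimum only where every summand does. -/
theorem isFace_activeFace {m : W} (hm : m ∈ halfspaces s ℓ c) :
    IsFace (halfspaces s ℓ c) (activeFace s ℓ c m) := by
  classical
  set y : Module.Dual ℚ W := ∑ p ∈ s.filter (fun p => ℓ p m = c p), ℓ p with hy
  have hy' : ∀ z, y z = ∑ p ∈ s.filter (fun p => ℓ p m = c p), ℓ p z := fun z => by
    rw [hy, LinearMap.sum_apply]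
  have hle : ∀ z ∈ halfspaces s ℓ c, ∀ q ∈ s.filter (fun p => ℓ p m = c p), ℓ q m ≤ ℓ q z := by
    intro z hz q hq
    rw [Finset.mem_filter] at hq
    rw [hq.2]
    exact hz q hq.1
  have hmin : ∀ z ∈ halfspaces s ℓ c, y m ≤ y z := by
    intro z hz
    rw [hy', hy']
    exact Finset.sum_le_sum (hle z hz)
  refine ⟨⟨m, hm, fun p _ h => h⟩, y, Set.ext fun z => ⟨fun hz => ⟨hz.1, fun v hv => ?_⟩,
    fun hz => ⟨hz.1, fun p hp e => ?_⟩⟩⟩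
  · refine le_trans (le_of_eq ?_) (hmin v hv)
    rw [hy', hy']
    refine Finset.sum_congr rfl fun p hp => ?_
    rw [Finset.mem_filter] at hp
    rw [hz.2 p hp.1 hp.2, hp.2]
  · have h := le_antisymm (hmin z hz.1) (hz.2 m hm)
    rw [hy', hy'] at h
    rw [← (Finset.sum_eq_sum_iff_of_le (hle z hz.1)).1 h p (Finset.mem_filter.2 ⟨hp, e⟩), e]

/-- Replaces faces by points, which is how both fans are handled from here on. -/
theorem normalCones_halfspaces : normalCones (halfspaces s ℓ c) =
    {σ | ∃ m ∈ halfspaces s ℓ c, σ = normalCone (halfspaces s ℓ c) {m}} := by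
  ext σ
  constructor
  · rintro ⟨F, hF, rfl⟩
    obtain ⟨m, hm, h⟩ := exists_minimal_active hF
    have hsub : F ⊆ halfspaces s ℓ c := by
      obtain ⟨-, y, rfl⟩ := hF
      exact fun z hz => hz.1
    exact ⟨m, hsub hm, normalCone_eq_singleton hsub hm h⟩
  · rintro ⟨m, hm, rfl⟩
    exact ⟨_, isFace_activeFace hm, (normalCone_eq_singleton (fun z hz => hz.1)
      (show m ∈ activeFace s ℓ c m from ⟨hm, fun p _ h => h⟩) fun p hp e z hz => hz.2 p hp e).symm⟩

/-- The directions in a face are those along which the active constraints are constant. -/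
theorem mem_vectorSpan_activeFace {m : W} (hm : m ∈ halfspaces s ℓ c) {v : W} :
    v ∈ vectorSpan ℚ (activeFace s ℓ c m) ↔ ∀ p ∈ s, ℓ p m = c p → ℓ p v = 0 := by
  constructor
  · intro hv p hp e
    have : vectorSpan ℚ (activeFace s ℓ c m) ≤ LinearMap.ker (ℓ p) := by
      refine Submodule.span_le.2 ?_
      rintro _ ⟨x, hx, y, hy, rfl⟩
      change ℓ p (x - y) = 0
      rw [map_sub, hx.2 p hp e, hy.2 p hp e, sub_self]
    exact this hv
  · intro hv
    obtain ⟨ε, hε, hs⟩ := exists_small_step hm (u := v) fun p hp e => (hv p hp e).ge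
    have h1 : m + ε • v ∈ activeFace s ℓ c m := by
      refine ⟨fun p hp => (hs ε hε.le le_rfl p hp).1, fun p hp e => ?_⟩
      rw [map_add, map_smul, hv p hp e, smul_zero, add_zero, e]
    have h2 := vsub_mem_vectorSpan ℚ h1 (⟨hm, fun p _ h => h⟩ : m ∈ activeFace s ℓ c m)
    rw [vsub_eq_sub, add_sub_cancel_left] at h2
    simpa [smul_smul, inv_mul_cancel₀ hε.ne'] using Submodule.smul_mem _ ε⁻¹ h2

/-- A point of a face of a polyhedron lies in its relative interior iff all constraints active at
the point are active on the face. -/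
theorem mem_relInterior_iff {F : Set W} (hF : IsFace (halfspaces s ℓ c) F) {x : W} :
    x ∈ relInterior F ↔ x ∈ F ∧ ∀ p ∈ s, ℓ p x = c p → ∀ z ∈ F, ℓ p z = c p := by
  let _ : TopologicalSpace W := moduleTopology ℚ W
  have _ : IsModuleTopology ℚ W := ⟨rfl⟩
  have _ : ContinuousAdd W := ModuleTopology.continuousAdd ℚ W
  have _ : ContinuousSMul ℚ W := ModuleTopology.continuousSMul ℚ W
  obtain ⟨-, y, rfl⟩ := hF
  change x ∈ intrinsicInterior ℚ _ ↔ _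
  rw [mem_intrinsicInterior]
  constructor
  · rintro ⟨x, hx, rfl⟩
    have hxF := interior_subset hx
    refine ⟨hxF, fun p hp e z hz => ?_⟩
    obtain ⟨O, hO, hOe⟩ := isOpen_induced_iff.1
      (isOpen_interior (s := (Subtype.val ⁻¹' face (halfspaces s ℓ c) y :
        Set (affineSpan ℚ (face (halfspaces s ℓ c) y)))))
    have hxO : (x : W) ∈ O := by
      have : x ∈ Subtype.val ⁻¹' O := hOe ▸ hx
      exact this
    -- Prolong the segment from `z` through `x` a little beyond `x`. It stays in the face, while a
    -- constraint tight at `x` and strict at `z` would be violated there.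
    have hcont : Continuous fun t : ℚ => (x : W) + t • ((x : W) - z) := by fun_prop
    have hmem : (fun t : ℚ => (x : W) + t • ((x : W) - z)) ⁻¹' O ∈ nhds (0 : ℚ) :=
      (hO.preimage hcont).mem_nhds (by simpa using hxO)
    obtain ⟨δ, hδ, hb⟩ := Metric.mem_nhds_iff.1 hmem
    obtain ⟨t, ht0, htδ⟩ := exists_rat_btwn hδ
    have ht0' : (0 : ℚ) < t := by exact_mod_cast ht0
    have htO : (x : W) + t • ((x : W) - z) ∈ O := hb (by
      rw [Metric.mem_ball, Rat.dist_eq]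
      simp only [Rat.cast_zero, sub_zero]
      rwa [abs_of_pos ht0])
    have hspan : (x : W) + t • ((x : W) - z) ∈ affineSpan ℚ (face (halfspaces s ℓ c) y) := by
      have := AffineSubspace.vadd_mem_of_mem_direction
        (Submodule.smul_mem _ t (AffineSubspace.vsub_mem_direction x.2
          (subset_affineSpan ℚ _ hz))) x.2
      rwa [vadd_eq_add, add_comm, vsub_eq_sub] at this
    have hin : (⟨_, hspan⟩ : affineSpan ℚ (face (halfspaces s ℓ c) y)) ∈ Subtype.val ⁻¹' O := htO
    rw [hOe] at hin
    have h3 : (⟨_, hspan⟩ : affineSpan ℚ (face (halfspaces s ℓ c) y)) ∈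
        Subtype.val ⁻¹' face (halfspaces s ℓ c) y := interior_subset hin
    rw [Set.mem_preimage] at h3
    have h4 := h3.1 p hp
    rw [map_add, map_smul, map_sub, smul_eq_mul, e] at h4
    have h5 := hz.1 p hp
    have h6 : 0 ≤ t * (c p - ℓ p z) := by linarith
    linarith [nonneg_of_mul_nonneg_right h6 ht0']
  · rintro ⟨hxF, hact⟩
    refine ⟨⟨x, subset_affineSpan ℚ _ hxF⟩, ?_, rfl⟩
    rw [mem_interior]
    -- The inactive constraints stay strict on the open set `O`. The active ones and `y` are
    -- constant on the face, hence on its affine span, so `O` cuts out a neighbourhood of `x` inside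
    -- the face.
    let O : Set W := ⋂ p ∈ s, {w | ℓ p x ≠ c p → c p < ℓ p w}
    have hO : IsOpen O := by
      refine isOpen_biInter_finset fun p _ => ?_
      by_cases h : ℓ p x = c p
      · simp [h]
      · simp only [ne_eq, h, not_false_eq_true, forall_const]
        exact isOpen_lt continuous_const (IsModuleTopology.continuous_of_linearMap (ℓ p))
    refine ⟨Subtype.val ⁻¹' O, ?_, hO.preimage continuous_subtype_val, ?_⟩
    · rintro ⟨w, hw⟩ hwO
      have hconst : ∀ (g : Module.Dual ℚ W), (∀ z ∈ face (halfspaces s ℓ c) y, g z = g x) →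
          g w = g x := by
        intro g hg
        have hv := AffineSubspace.vsub_mem_direction hw (subset_affineSpan ℚ _ hxF)
        rw [direction_affineSpan] at hv
        have hle : vectorSpan ℚ (face (halfspaces s ℓ c) y) ≤ LinearMap.ker g := by
          refine Submodule.span_le.2 ?_
          rintro _ ⟨a, ha, b, hb, rfl⟩
          change g (a - b) = 0
          rw [map_sub, hg a ha, hg b hb, sub_self]
        have := hle hv
        rw [LinearMap.mem_ker, vsub_eq_sub, map_sub] at this
        linarith
      have hwP : w ∈ halfspaces s ℓ c := by
        intro p hp
        by_cases h : ℓ p x = c p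
        · rw [hconst (ℓ p) fun z hz => by rw [hact p hp h z hz, h], h]
        · exact ((Set.mem_iInter₂.1 hwO p hp) h).le
      have hyw : y w = y x := hconst y fun z hz => le_antisymm (hz.2 x hxF.1) (hxF.2 z hz.1)
      exact ⟨hwP, fun z hz => by rw [hyw]; exact hxF.2 z hz⟩
    · exact Set.mem_iInter₂.2 fun p hp h => lt_of_le_of_ne (hxF.1 p hp) (Ne.symm h)

end Halfspaces
end Polyhedral

/-! ### The generalized fans `N(P_M)` and `N^s(P_M)`. -/

namespace Toric

open Polyhedral

/-- The generalized fan of the normal cones at those points of a polyhedron that satisfy a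
condition which is inherited by points with fewer active constraints. -/
def GenFan.ofPoints {M α : Type} [AddCommGroup M] (s : Finset α)
    (ℓ : α → Module.Dual ℚ (QSpan M)) (c : α → ℚ) (T : QSpan M → Prop)
    (hT : ∀ m, T m → ∀ m', (∀ p ∈ s, ℓ p m' = c p → ℓ p m = c p) → T m') : GenFan M where
  cones := {σ | ∃ m ∈ halfspaces s ℓ c, T m ∧ σ = normalCone (halfspaces s ℓ c) {m}}
  finite := finite_normalCones_singleton.subset fun _ ⟨m, hm, _, h⟩ => ⟨m, hm, h⟩
  polyhedral := by
    rintro _ ⟨m, hm, -, rfl⟩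
    exact normalCone_fg hm
  face_mem := by
    rintro _ ⟨m, hm, h, rfl⟩ τ hτ
    obtain ⟨m', hm', hact, e⟩ := exists_normalCone_of_isConeFace hm hτ
    exact ⟨m', hm', hT m h m' hact, e⟩
  inter_face := by
    rintro _ ⟨m, hm, -, rfl⟩ _ ⟨m', hm', -, rfl⟩
    exact isConeFace_inf hm hm'

section Slice

variable {M Λ : Type} [AddCommGroup M] [AddCommGroup Λ] (i : M →ₗ[ℤ] Λ)
  (s : Finset (Module.Dual ℚ (QSpan Λ) × ℚ))

/-- The polyhedron given by finitely many half-spaces. -/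
abbrev polyhedron {V : Type} [AddCommGroup V] [Module ℚ V]
    (s : Finset (Module.Dual ℚ V × ℚ)) : Set V := halfspaces s Prod.fst Prod.snd

/-- The intersection of a polyhedron with `M_ℚ`. -/
abbrev slice : Set (QSpan M) := halfspaces s (fun p => p.1 ∘ₗ inclQ i) Prod.snd

/-- The directions along which the constraints active at `m` are constant span `Λ_ℚ` together
with `M_ℚ`. -/
def IsTransversal (m : QSpan M) : Prop :=
  ∀ v : QSpan Λ, ∃ u : QSpan M, ∀ p ∈ s, p.1 (inclQ i m) = p.2 → p.1 v = p.1 (inclQ i u)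

variable {i s}

theorem IsTransversal.of_active {m : QSpan M} (h : IsTransversal i s m) {m' : QSpan M}
    (hact : ∀ p ∈ s, p.1 (inclQ i m') = p.2 → p.1 (inclQ i m) = p.2) :
    IsTransversal i s m' := fun v => by
  obtain ⟨u, hu⟩ := h v
  exact ⟨u, fun p hp e => hu p hp (hact p hp e)⟩

/-- The span of the differences in the active face is the common kernel of the active functionals,
so two vectors on which these agree differ by an element of it. -/
theorem isTransversal_iff {m : QSpan M} (hm : m ∈ slice i s) : IsTransversal i s m ↔
    vectorSpan ℚ (activeFace s Prod.fst Prod.snd (inclQ i m)) ⊔ LinearMap.range (inclQ i) = ⊤ := by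
  have hm' : inclQ i m ∈ polyhedron s := hm
  rw [eq_top_iff]
  constructor
  · intro h v _
    obtain ⟨u, hu⟩ := h v
    rw [← sub_add_cancel v (inclQ i u)]
    refine Submodule.add_mem_sup ((mem_vectorSpan_activeFace hm').2 fun p hp e => ?_) ⟨u, rfl⟩
    rw [map_sub, hu p hp e, sub_self]
  · intro h v
    obtain ⟨w, hw, _, ⟨u, rfl⟩, rfl⟩ := Submodule.mem_sup.1 (h (Submodule.mem_top (x := v)))
    refine ⟨u, fun p hp e => ?_⟩
    rw [map_add, (mem_vectorSpan_activeFace hm').1 hw p hp e, zero_add]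

variable (i s)

theorem restrict_polyhedron : restrict i (polyhedron s) = slice i s := rfl

/-- A point of `M_ℚ` in the relative interior of `F` has the same active constraints as `F`, hence
also gives the normal cone of `F_M`. Conversely, a transversal point lies in the relative interior
of its active face. -/
theorem stableNormalCones_polyhedron : stableNormalCones i (polyhedron s) =
    {σ | ∃ m ∈ slice i s, IsTransversal i s m ∧ σ = normalCone (slice i s) {m}} := by
  ext σ
  constructor
  · rintro ⟨F, ⟨hF, ⟨_, hx, m, rfl⟩, htr⟩, rfl⟩
    rw [mem_relInterior_iff hF] at hx
    have hsub : F ⊆ polyhedron s := by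
      obtain ⟨-, y, rfl⟩ := hF
      exact fun z hz => hz.1
    have hm : m ∈ slice i s := hsub hx.1
    refine ⟨m, hm, (isTransversal_iff hm).2 ?_, ?_⟩
    · rw [eq_top_iff, ← htr]
      exact sup_le_sup_right (vectorSpan_mono ℚ fun z hz =>
        show z ∈ activeFace s Prod.fst Prod.snd (inclQ i m) from
          ⟨hsub hz, fun p hp e => hx.2 p hp e z hz⟩) _
    · rw [restrict_polyhedron]
      exact normalCone_eq_singleton (F := restrict i F) (fun z hz => hsub hz) hx.1
        fun p hp e z hz => hx.2 p hp e _ hz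
  · rintro ⟨m, hm, htr, rfl⟩
    have hm' : inclQ i m ∈ polyhedron s := hm
    have hself : inclQ i m ∈ activeFace s Prod.fst Prod.snd (inclQ i m) := ⟨hm', fun p _ h => h⟩
    refine ⟨activeFace s Prod.fst Prod.snd (inclQ i m), ⟨isFace_activeFace hm', ⟨inclQ i m,
      (mem_relInterior_iff (isFace_activeFace hm')).2 ⟨hself, fun p hp e z hz => hz.2 p hp e⟩,
      m, rfl⟩, (isTransversal_iff hm).1 htr⟩, ?_⟩
    rw [restrict_polyhedron]
    exact (normalCone_eq_singleton
      (F := restrict i (activeFace s Prod.fst Prod.snd (inclQ i m))) (fun z hz => hz.1) hself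
      fun p hp e z hz => hz.2 p hp e).symm

theorem normalCones_restrict : normalCones (restrict i (polyhedron s)) =
    {σ | ∃ m ∈ slice i s, True ∧ σ = normalCone (slice i s) {m}} := by
  rw [restrict_polyhedron, normalCones_halfspaces]
  simp only [true_and]

/-- The generalized fan `N^s(P_M)`. -/
def stableFan : GenFan M :=
  GenFan.ofPoints s (fun p => p.1 ∘ₗ inclQ i) Prod.snd (IsTransversal i s)
    fun _ h _ hact => h.of_active hact

/-- The generalized fan `N(P_M)`. -/
def normalFan : GenFan M :=
  GenFan.ofPoints s (fun p => p.1 ∘ₗ inclQ i) Prod.snd (fun _ => True) fun _ _ _ _ => trivial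

/-- If `y` and `-y` are both nonnegative combinations of restricted active functionals, the sum of
the two combinations vanishes on `M_ℚ`, hence on `Λ_ℚ` by transversality. Its terms are nonnegative
on `P - m`, so each vanishes there; as `P` is full-dimensional, each term is zero. -/
theorem stableFan_isFan (h : affineSpan ℚ (polyhedron s) = ⊤) : (stableFan i s).IsFan := by
  classical
  rintro _ ⟨m, hm, htr, rfl⟩ y hy hy'
  have aux : ∀ y ∈ normalCone (slice i s) {m}, ∃ k : Module.Dual ℚ (QSpan Λ) × ℚ → ℚ,
      (∀ p, 0 ≤ k p) ∧
        y = ∑ p ∈ s.filter (fun p => p.1 (inclQ i m) = p.2), k p • (p.1 ∘ₗ inclQ i) :=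
    fun y hy => exists_nonneg_combination _ _ _ fun u hu =>
      (mem_normalCone_iff hm).1 hy u fun p hp e => hu p (Finset.mem_filter.2 ⟨hp, e⟩)
  obtain ⟨k, hk, e⟩ := aux y hy
  obtain ⟨k', hk', e'⟩ := aux (-y) hy'
  set I := s.filter (fun p => p.1 (inclQ i m) = p.2) with hI
  have hzero : ∀ v, ∑ p ∈ I, (k p + k' p) * p.1 v = 0 := by
    intro v
    obtain ⟨u, hu⟩ := htr v
    have h1 := LinearMap.congr_fun e u
    have h2 := LinearMap.congr_fun e' u
    simp only [LinearMap.sum_apply, LinearMap.smul_apply, LinearMap.comp_apply, smul_eq_mul,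
      LinearMap.neg_apply] at h1 h2
    have h3 : ∑ p ∈ I, (k p + k' p) * p.1 v =
        ∑ p ∈ I, k p * p.1 (inclQ i u) + ∑ p ∈ I, k' p * p.1 (inclQ i u) := by
      rw [← Finset.sum_add_distrib]
      refine Finset.sum_congr rfl fun p hp => ?_
      rw [Finset.mem_filter] at hp
      rw [hu p hp.1 hp.2, add_mul]
    rw [h3, ← h1, ← h2, add_neg_cancel]
  rw [e]
  refine Finset.sum_eq_zero fun p hp => ?_
  have hpos : 0 ≤ k p + k' p := add_nonneg (hk p) (hk' p)
  have hspan : vectorSpan ℚ (polyhedron s) ≤ LinearMap.ker ((k p + k' p) • p.1) := by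
    have hz : ∀ z ∈ polyhedron s, (k p + k' p) * p.1 (z - inclQ i m) = 0 := by
      intro z hz
      refine (Finset.sum_eq_zero_iff_of_nonneg fun q hq => ?_).1 (hzero (z - inclQ i m)) p hp
      rw [hI, Finset.mem_filter] at hq
      refine mul_nonneg (add_nonneg (hk q) (hk' q)) ?_
      rw [map_sub, hq.2]
      linarith [hz q hq.1]
    refine Submodule.span_le.2 ?_
    rintro _ ⟨a, ha, b, hb, rfl⟩
    change (k p + k' p) * p.1 (a - b) = 0
    have h1 := hz a ha
    have h2 := hz b hb
    rw [map_sub] at h1 h2 ⊢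
    linarith
  have htop : vectorSpan ℚ (polyhedron s) = ⊤ := by
    rw [← direction_affineSpan, h, AffineSubspace.direction_top]
  refine LinearMap.ext fun u => ?_
  have h1 : (k p + k' p) * p.1 (inclQ i u) = 0 :=
    hspan (htop ▸ Submodule.mem_top : inclQ i u ∈ vectorSpan ℚ (polyhedron s))
  change k p * p.1 (inclQ i u) = 0
  rcases mul_eq_zero.1 h1 with h2 | h2
  · rw [show k p = 0 by linarith [hk p, hk' p], zero_mul]
  · rw [h2, mul_zero]

end Slice

end Toric

/-! ### The closed cone over a polyhedron. -/

namespace Toric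

open Polyhedral

section ConeOver

variable {V : Type} [AddCommGroup V] [Module ℚ V]

/-- Membership in the closed cone over `P` implies every homogeneous linear inequality that holds
on `{1} × P`. -/
theorem nonneg_of_mem_coneOver {P : Set V} (g : ℚ × V →ₗ[ℚ] ℚ) (hg : ∀ x ∈ P, 0 ≤ g (1, x))
    {a : ℚ × V} (ha : a ∈ coneOver P) : 0 ≤ g a := by
  let _ : TopologicalSpace (ℚ × V) := moduleTopology ℚ (ℚ × V)
  have _ : IsModuleTopology ℚ (ℚ × V) := ⟨rfl⟩
  have _ : ContinuousAdd (ℚ × V) := ModuleTopology.continuousAdd ℚ (ℚ × V)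
  have _ : ContinuousSMul ℚ (ℚ × V) := ModuleTopology.continuousSMul ℚ (ℚ × V)
  have hclosed : IsClosed {x : ℚ × V | 0 ≤ g x} :=
    isClosed_le continuous_const (IsModuleTopology.continuous_of_linearMap g)
  have hsub : ((PointedCone.hull ℚ ((fun x => ((1 : ℚ), x)) '' P) : PointedCone ℚ (ℚ × V)) :
      Set (ℚ × V)) ⊆ {x : ℚ × V | 0 ≤ g x} := by
    intro x hx
    induction hx using Submodule.span_induction with
    | mem x hx =>
      obtain ⟨z, hz, rfl⟩ := hx
      exact hg z hz
    | zero => simp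
    | add x y _ _ h1 h2 =>
      change 0 ≤ g x at h1
      change 0 ≤ g y at h2
      change 0 ≤ g (x + y)
      rw [map_add]
      linarith
    | smul c x _ h1 =>
      change 0 ≤ g ((c : ℚ) • x)
      rw [map_smul]
      exact mul_nonneg c.2 h1
  exact closure_minimal hsub hclosed ha

/-- The homogenized inequalities cut out a closed cone. Conversely, for `x ∈ P` the vectors `(t, v)
+ ε (1, x)` with `ε > 0` have positive height, rescale to points of `{1} × P`, and tend to `(t, v)`;
this also covers `t = 0`. -/
theorem mem_coneOver_polyhedron {s : Finset (Module.Dual ℚ V × ℚ)} (hP : (polyhedron s).Nonempty)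
    {t : ℚ} (ht : 0 ≤ t) {v : V} :
    (t, v) ∈ coneOver (polyhedron s) ↔ ∀ p ∈ s, t * p.2 ≤ p.1 v := by
  constructor
  · intro h p hp
    have := nonneg_of_mem_coneOver (p.1 ∘ₗ LinearMap.snd ℚ ℚ V - p.2 • LinearMap.fst ℚ ℚ V)
      (fun x hx => by simpa using hx p hp) h
    simp only [LinearMap.sub_apply, LinearMap.comp_apply, LinearMap.snd_apply,
      LinearMap.smul_apply, LinearMap.fst_apply, smul_eq_mul] at this
    linarith
  · intro h
    let _ : TopologicalSpace (ℚ × V) := moduleTopology ℚ (ℚ × V)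
    have _ : IsModuleTopology ℚ (ℚ × V) := ⟨rfl⟩
    have _ : ContinuousAdd (ℚ × V) := ModuleTopology.continuousAdd ℚ (ℚ × V)
    have _ : ContinuousSMul ℚ (ℚ × V) := ModuleTopology.continuousSMul ℚ (ℚ × V)
    obtain ⟨x, hx⟩ := hP
    have hmem : ∀ ε : ℚ, 0 < ε → (t, v) + ε • ((1 : ℚ), x) ∈
        PointedCone.hull ℚ ((fun x => ((1 : ℚ), x)) '' polyhedron s) := by
      intro ε hε
      have hpos : 0 < t + ε := by linarith
      have hz : (t + ε)⁻¹ • (v + ε • x) ∈ polyhedron s := by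
        intro p hp
        rw [map_smul, map_add, map_smul, smul_eq_mul, smul_eq_mul, inv_mul_eq_div,
          le_div_iff₀ hpos]
        have h1 := h p hp
        have h2 := mul_le_mul_of_nonneg_left (hx p hp) hε.le
        linarith
      have := Submodule.smul_mem (PointedCone.hull ℚ ((fun x => ((1 : ℚ), x)) '' polyhedron s))
        (⟨t + ε, hpos.le⟩ : {x : ℚ // 0 ≤ x}) (Submodule.subset_span ⟨_, hz, rfl⟩)
      convert this using 1
      change _ = (t + ε) • ((1 : ℚ), (t + ε)⁻¹ • (v + ε • x))
      refine Prod.ext ?_ (smul_inv_smul₀ hpos.ne' _).symm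
      change t + ε * 1 = (t + ε) * 1
      ring
    change (t, v) ∈ _root_.closure
      ((PointedCone.hull ℚ ((fun x => ((1 : ℚ), x)) '' polyhedron s) : PointedCone ℚ (ℚ × V)) :
        Set (ℚ × V))
    have hcont : Continuous fun ε : ℚ => (t, v) + ε • ((1 : ℚ), x) := by fun_prop
    have hlim : Filter.Tendsto (fun ε : ℚ => (t, v) + ε • ((1 : ℚ), x))
        (nhdsWithin 0 (Set.Ioi 0)) (nhds (t, v)) := by
      have := hcont.tendsto 0
      simp only [zero_smul, add_zero] at this
      exact this.mono_left nhdsWithin_le_nhds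
    exact mem_closure_of_tendsto hlim (eventually_mem_nhdsWithin.mono fun ε hε => hmem ε hε)

/-- A polyhedron can be given by inequalities whose homogenizations define the closed cone over
it. -/
theorem exists_polyhedron_coneOver [Module.Finite ℚ V] {P : Set V} (hP : IsPolyhedron P) :
    ∃ s : Finset (Module.Dual ℚ V × ℚ), P = polyhedron s ∧
      ∀ (t : ℚ) (v : V), 0 ≤ t → ((t, v) ∈ coneOver P ↔ ∀ p ∈ s, t * p.2 ≤ p.1 v) := by
  classical
  rcases P.eq_empty_or_nonempty with rfl | hne
  -- The cone over the empty set is zero, but an arbitrary infeasible system may homogenize to a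
  -- larger cone. The system `1 ≤ 0`, `± coordinates ≥ 0` homogenizes to `t ≤ 0`, `v = 0`.
  · let b := Module.finBasis ℚ V
    let s : Finset (Module.Dual ℚ V × ℚ) := {((0 : Module.Dual ℚ V), (1 : ℚ))} ∪
      (Finset.univ.image (fun j => (b.coord j, (0 : ℚ))) ∪
        Finset.univ.image fun j => (-b.coord j, (0 : ℚ)))
    refine ⟨s, ?_, fun t v ht => ⟨fun h => ?_, fun h => ?_⟩⟩
    · symm
      refine Set.eq_empty_iff_forall_notMem.2 fun x hx => ?_
      have := hx (0, 1) (by simp [s])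
      simp only [LinearMap.zero_apply] at this
      linarith
    · have hall : ∀ g : ℚ × V →ₗ[ℚ] ℚ, g (t, v) = 0 := by
        intro g
        have h1 := nonneg_of_mem_coneOver g (by simp) h
        have h2 := nonneg_of_mem_coneOver (-g) (by simp) h
        rw [LinearMap.neg_apply] at h2
        linarith
      intro p _
      have h1 := hall (LinearMap.fst ℚ ℚ V)
      have h2 := hall (p.1 ∘ₗ LinearMap.snd ℚ ℚ V)
      simp only [LinearMap.fst_apply, LinearMap.comp_apply, LinearMap.snd_apply] at h1 h2
      rw [h1, h2, zero_mul]
    · have h0 := h (0, 1) (by simp [s])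
      simp only [mul_one, LinearMap.zero_apply] at h0
      have hv : v = 0 := by
        refine b.ext_elem fun j => ?_
        have h1 := h (b.coord j, 0) (by simp [s])
        have h2 := h (-b.coord j, 0) (by simp [s])
        simp only [mul_zero, Module.Basis.coord_apply, LinearMap.neg_apply] at h1 h2
        simp only [map_zero, Finsupp.coe_zero, Pi.zero_apply]
        linarith
      rw [hv, le_antisymm h0 ht]
      exact (coneOver (∅ : Set V)).zero_mem
  · obtain ⟨s, rfl⟩ := hP
    exact ⟨s, rfl, fun t v ht => mem_coneOver_polyhedron hne ht⟩

end ConeOver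

end Toric

/-! ### Closed points of `Proj` as homomorphisms to `ℂ`. -/

namespace GIT

/-- The Nullstellensatz for algebras of countable dimension over `ℂ`: all maximal ideals are
kernels of `ℂ`-algebra homomorphisms to `ℂ`. -/
theorem exists_algHom_ker_eq {R : Type} [CommRing R] [Algebra ℂ R]
    (hR : Module.rank ℂ R ≤ Cardinal.aleph0) (m : Ideal R) [hm : m.IsMaximal] :
    ∃ ψ : R →ₐ[ℂ] ℂ, RingHom.ker ψ = m := by
  let _ : Field (R ⧸ m) := Ideal.Quotient.field m
  have hrank : Module.rank ℂ (R ⧸ m) ≤ Cardinal.aleph0 :=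
    (LinearMap.rank_le_of_surjective (Ideal.Quotient.mkₐ ℂ m).toLinearMap
      (Ideal.Quotient.mkₐ_surjective ℂ m)).trans hR
  have halg : Algebra.IsAlgebraic ℂ (R ⧸ m) := by
    refine ⟨fun x => ?_⟩
    by_contra hx
    -- For transcendental `x` the elements `1/(x - c)`, `c ∈ ℂ`, would be an uncountable linearly
    -- independent family.
    have hli := Transcendental.linearIndependent_sub_inv (F := ℂ) (x := x) hx
    have h1 := hli.cardinal_le_rank.trans hrank
    rw [Cardinal.mk_complex] at h1
    exact absurd h1 (not_le.2 Cardinal.aleph0_lt_continuum)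
  have hbij : Function.Bijective (algebraMap ℂ (R ⧸ m)) :=
    IsAlgClosed.algebraMap_bijective_of_isIntegral
  let e : ℂ ≃ₐ[ℂ] (R ⧸ m) := AlgEquiv.ofBijective (Algebra.ofId ℂ (R ⧸ m)) hbij
  refine ⟨(e.symm : (R ⧸ m) →ₐ[ℂ] ℂ).comp (Ideal.Quotient.mkₐ ℂ m), ?_⟩
  ext r
  rw [RingHom.mem_ker, AlgHom.comp_apply]
  change e.symm (Ideal.Quotient.mk m r) = 0 ↔ _
  rw [map_eq_zero_iff _ e.symm.injective, Ideal.Quotient.eq_zero_iff_mem]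

section Points

variable {R : Type} [CommRing R] [Algebra ℂ R] {𝒜 : ℕ → Submodule ℂ R} [GradedAlgebra 𝒜]

theorem mem_homogeneousCore_ker {ψ : R →ₐ[ℂ] ℂ} {k : ℕ} {r : R} (hr : r ∈ 𝒜 k) :
    r ∈ (RingHom.ker ψ).homogeneousCore 𝒜 ↔ ψ r = 0 :=
  ⟨fun h => Ideal.toIdeal_homogeneousCore_le 𝒜 _ h,
    fun h => Ideal.mem_homogeneousCore_of_homogeneous_of_mem ⟨k, hr⟩ h⟩

/-- The closed point of `Proj` given by a homomorphism `ψ` to `ℂ` that does not vanish on some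
homogeneous element of positive degree. -/
def pointOf (ψ : R →ₐ[ℂ] ℂ) {f : R} {n : ℕ} (hf : f ∈ 𝒜 n) (hn : 0 < n) (h : ψ f ≠ 0) :
    Proj 𝒜 :=
  ProjectiveSpectrum.mk ((RingHom.ker ψ).homogeneousCore 𝒜)
    (Ideal.IsPrime.homogeneousCore (RingHom.ker_isPrime ψ))
    (fun hle => h ((mem_homogeneousCore_ker hf).1
      (hle ((HomogeneousIdeal.mem_irrelevant_iff 𝒜 f).2 (by
        rw [GradedRing.proj_apply, DirectSum.decompose_of_mem_ne 𝒜 hf hn.ne'])))))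

theorem mem_pointOf {ψ : R →ₐ[ℂ] ℂ} {f : R} {n : ℕ} {hf : f ∈ 𝒜 n} {hn : 0 < n} {h : ψ f ≠ 0}
    {k : ℕ} {r : R} (hr : r ∈ 𝒜 k) :
    r ∈ (pointOf ψ hf hn h).asHomogeneousIdeal ↔ ψ r = 0 :=
  mem_homogeneousCore_ker hr

/-- Two points of `Proj` agree if one contains the other on homogeneous elements and vice versa. -/
theorem point_ext {x y : Proj 𝒜}
    (h : ∀ k, ∀ r ∈ 𝒜 k, r ∈ x.asHomogeneousIdeal ↔ r ∈ y.asHomogeneousIdeal) : x = y := by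
  classical
  refine ProjectiveSpectrum.ext (HomogeneousIdeal.ext (Ideal.ext fun r => ?_))
  have key : ∀ z : Proj 𝒜, r ∈ z.asHomogeneousIdeal.toIdeal ↔
      ∀ k, (DirectSum.decompose 𝒜 r k : R) ∈ z.asHomogeneousIdeal := fun z =>
    ⟨fun hr k => z.asHomogeneousIdeal.isHomogeneous k hr, fun hr => by
      rw [← DirectSum.sum_support_decompose 𝒜 r]
      exact Ideal.sum_mem _ fun k _ => hr k⟩
  rw [key, key]
  exact forall_congr' fun k => h k _ (DirectSum.decompose 𝒜 r k).2

/-- If `ψ` vanishes on the homogeneous elements of `y` of a point, then all homogeneous elements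
of the kernel of `ψ` determine the point. -/
theorem eq_pointOf_of_le {ψ : R →ₐ[ℂ] ℂ} {f : R} {n : ℕ} (hf : f ∈ 𝒜 n) (hn : 0 < n)
    (h : ψ f ≠ 0) {y : Proj 𝒜} (hy : ∀ k, ∀ r ∈ 𝒜 k, ψ r = 0 → r ∈ y.asHomogeneousIdeal) :
    y = pointOf ψ hf hn h := by
  classical
  have hprime : y.asHomogeneousIdeal.toIdeal.IsPrime := y.isPrime
  -- This element is homogeneous of degree `nk` and is killed by `ψ`. It shows that modulo `y` every
  -- homogeneous `r` is governed by `ψ(r)` and `f`.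
  have hrel : ∀ k, ∀ r ∈ 𝒜 k, (ψ f) ^ k • r ^ n - (ψ r) ^ n • f ^ k ∈
      y.asHomogeneousIdeal.toIdeal := by
    intro k r hr
    refine hy (n * k) _ (Submodule.sub_mem _ (Submodule.smul_mem _ _ ?_)
      (Submodule.smul_mem _ _ ?_)) ?_
    · simpa using SetLike.pow_mem_graded n hr
    · rw [mul_comm]
      simpa using SetLike.pow_mem_graded k hf
    · simp only [map_sub, map_smul, map_pow, smul_eq_mul]
      ring
  have hsmul : ∀ {c : ℂ} {r : R}, c ≠ 0 → c • r ∈ y.asHomogeneousIdeal.toIdeal →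
      r ∈ y.asHomogeneousIdeal.toIdeal := by
    intro c r hc hr
    have := Submodule.smul_of_tower_mem y.asHomogeneousIdeal.toIdeal c⁻¹ hr
    rwa [smul_smul, inv_mul_cancel₀ hc, one_smul] at this
  have hfy : f ∉ y.asHomogeneousIdeal.toIdeal := by
    intro hfy
    refine y.not_irrelevant_le fun r hr => ?_
    have hr' : r ∈ HomogeneousIdeal.irrelevant 𝒜 := hr
    rw [HomogeneousIdeal.mem_irrelevant_iff, GradedRing.proj_apply] at hr'
    change r ∈ y.asHomogeneousIdeal.toIdeal
    rw [← DirectSum.sum_support_decompose 𝒜 r]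
    refine Ideal.sum_mem _ fun k _ => ?_
    rcases Nat.eq_zero_or_pos k with rfl | hk
    · rw [hr']
      exact zero_mem _
    · have h1 := hrel k _ (DirectSum.decompose 𝒜 r k).2
      have h2 : (ψ (DirectSum.decompose 𝒜 r k : R)) ^ n • f ^ k ∈
          y.asHomogeneousIdeal.toIdeal := Submodule.smul_of_tower_mem _ _
        (Ideal.pow_mem_of_mem _ hfy k hk)
      have h3 := (Ideal.add_mem _ h1 h2)
      rw [sub_add_cancel] at h3
      exact hprime.mem_of_pow_mem n (hsmul (pow_ne_zero k h) h3)
  refine point_ext fun k r hr => ?_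
  rw [mem_pointOf hr]
  refine ⟨fun hry => ?_, hy k r hr⟩
  by_contra hne
  have h1 := hrel k r hr
  have h2 : (ψ f) ^ k • r ^ n ∈ y.asHomogeneousIdeal.toIdeal := Submodule.smul_of_tower_mem _ _
    (Ideal.pow_mem_of_mem _ hry n hn)
  have h3 := Ideal.sub_mem _ h2 h1
  rw [sub_sub_cancel] at h3
  exact hfy (hprime.mem_of_pow_mem k (hsmul (pow_ne_zero n hne) h3))

theorem mem_closure_singleton_iff {x y : Proj 𝒜} : y ∈ closure ({x} : Set (Proj 𝒜)) ↔
    ∀ r ∈ x.asHomogeneousIdeal.toIdeal, r ∈ y.asHomogeneousIdeal.toIdeal :=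
  (ProjectiveSpectrum.le_iff_mem_closure 𝒜 x y).symm

/-- A specialization contains the homogeneous elements of the kernel, and `eq_pointOf_of_le` leaves
no room for a larger point. -/
theorem isClosed_pointOf {ψ : R →ₐ[ℂ] ℂ} {f : R} {n : ℕ} (hf : f ∈ 𝒜 n) (hn : 0 < n)
    (h : ψ f ≠ 0) : IsClosed ({pointOf ψ hf hn h} : Set (Proj 𝒜)) := by
  refine closure_subset_iff_isClosed.1 fun y hy => ?_
  exact eq_pointOf_of_le hf hn h fun k r hr h0 =>
    mem_closure_singleton_iff.1 hy r ((mem_pointOf hr).2 h0)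

/-- A closed point of `D₊(f)` comes from a homomorphism to `ℂ`. -/
theorem exists_eq_pointOf (hR : Module.rank ℂ R ≤ Cardinal.aleph0) {f : R} {n : ℕ}
    (hf : f ∈ 𝒜 n) (hn : 0 < n) {x : Proj 𝒜} (hfx : x ∈ Proj.basicOpen 𝒜 f)
    (hx : IsClosed ({x} : Set (Proj 𝒜))) :
    ∃ ψ : R →ₐ[ℂ] ℂ, ∃ h : ψ f ≠ 0, x = pointOf ψ hf hn h := by
  classical
  have hprime : x.asHomogeneousIdeal.toIdeal.IsPrime := x.isPrime
  have hfx' : f ∉ x.asHomogeneousIdeal.toIdeal := hfx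
  -- Dehomogenize at `f`. If `1 ≡ r (f - 1)` up to sign modulo the prime of `x`, comparing
  -- components in degrees `jn` gives `r_{jn} ≡ -f^j`; since `r` has finitely many components, a
  -- power of `f` would lie in that prime.
  have hne : x.asHomogeneousIdeal.toIdeal ⊔ Ideal.span {f - 1} ≠ ⊤ := by
    intro htop
    rw [Ideal.eq_top_iff_one, Submodule.mem_sup] at htop
    obtain ⟨ξ, hξ, _, hr, e⟩ := htop
    obtain ⟨r, rfl⟩ := Ideal.mem_span_singleton'.1 hr
    let D : ℕ → R →ₗ[ℂ] R := fun k => GradedAlgebra.proj 𝒜 k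
    have hD : ∀ k z, D k z = (DirectSum.decompose 𝒜 z k : R) := fun k z => rfl
    have hDmem : ∀ k, ∀ z ∈ x.asHomogeneousIdeal.toIdeal, D k z ∈ x.asHomogeneousIdeal.toIdeal :=
      fun k z hz => x.asHomogeneousIdeal.isHomogeneous k hz
    have he : r * f - r - 1 ∈ x.asHomogeneousIdeal.toIdeal := by
      have : r * f - r - 1 = -ξ := by linear_combination e
      rw [this]
      exact neg_mem hξ
    have hone : ∀ k, D k 1 = if k = 0 then 1 else 0 := by
      intro k
      rw [hD]
      split_ifs with h0
      · subst h0
        exact DirectSum.decompose_of_mem_same 𝒜 (SetLike.GradedOne.one_mem)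
      · exact DirectSum.decompose_of_mem_ne 𝒜 (SetLike.GradedOne.one_mem) (Ne.symm h0)
    have hind : ∀ j, D (j * n) r + f ^ j ∈ x.asHomogeneousIdeal.toIdeal := by
      intro j
      induction j with
      | zero =>
        have h1 := hDmem 0 _ he
        have h2 : D 0 (r * f) = 0 := by
          rw [hD]
          exact DirectSum.coe_decompose_mul_of_right_mem_of_not_le 𝒜 hf (by omega)
        rw [map_sub, map_sub, h2, hone, if_pos rfl] at h1
        have := neg_mem h1
        rw [zero_mul, pow_zero]
        convert this using 1
        ring
      | succ j ih =>
        have h1 := hDmem (j * n + n) _ he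
        have h2 : D (j * n + n) (r * f) = D (j * n) r * f := by
          rw [hD, hD]
          exact DirectSum.coe_decompose_mul_add_of_right_mem 𝒜 hf
        rw [map_sub, map_sub, h2, hone, if_neg (by omega)] at h1
        have h3 := Ideal.sub_mem _ (Ideal.mul_mem_right f _ ih) h1
        rw [Nat.succ_mul]
        convert h3 using 1
        ring
    obtain ⟨j, hj⟩ : ∃ j, D (j * n) r = 0 := by
      refine ⟨(DirectSum.decompose 𝒜 r).support.sup id + 1, ?_⟩
      rw [hD]
      by_contra h0
      have hmem : ((DirectSum.decompose 𝒜 r).support.sup id + 1) * n ∈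
          (DirectSum.decompose 𝒜 r).support := DFinsupp.mem_support_iff.2 fun h1 => h0 (by
            rw [h1]; rfl)
      have := Finset.le_sup (f := id) hmem
      simp only [id_eq] at this
      nlinarith
    have := hind j
    rw [hj, zero_add] at this
    exact hfx' (hprime.mem_of_pow_mem j this)
  obtain ⟨m, hm, hle⟩ := Ideal.exists_le_maximal _ hne
  obtain ⟨ψ, hψ⟩ := exists_algHom_ker_eq hR m
  have hψf : ψ f = 1 := by
    have : f - 1 ∈ RingHom.ker ψ := by
      rw [hψ]
      exact hle (Ideal.mem_sup_right (Ideal.mem_span_singleton_self _))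
    rw [RingHom.mem_ker, map_sub, map_one, sub_eq_zero] at this
    exact this
  have h : ψ f ≠ 0 := by rw [hψf]; exact one_ne_zero
  refine ⟨ψ, h, ?_⟩
  have hle' : pointOf ψ hf hn h ∈ closure ({x} : Set (Proj 𝒜)) := by
    rw [mem_closure_singleton_iff]
    intro r hr
    rw [← DirectSum.sum_support_decompose 𝒜 r]
    refine Ideal.sum_mem _ fun k _ => ?_
    refine (mem_pointOf (DirectSum.decompose 𝒜 r k).2).2 ?_
    rw [← RingHom.mem_ker, hψ]
    exact hle (Ideal.mem_sup_left (x.asHomogeneousIdeal.isHomogeneous k hr))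
  rw [hx.closure_eq] at hle'
  exact hle'.symm

end Points

end GIT

/-! ### Exponents, their faces and their weights in `B`. -/

namespace Toric

open Polyhedral

section Lattice

variable {M Λ B : Type} [AddCommGroup M] [AddCommGroup Λ] [AddCommGroup B]

theorem latticeVec_add (a b : Λ) : latticeVec (a + b) = latticeVec a + latticeVec b :=
  TensorProduct.tmul_add _ _ _

theorem latticeVec_sub (a b : Λ) : latticeVec (a - b) = latticeVec a - latticeVec b :=
  TensorProduct.tmul_sub _ _ _

theorem latticeVec_nsmul (n : ℕ) (a : Λ) : latticeVec (n • a) = (n : ℚ) • latticeVec a := by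
  rw [latticeVec, TensorProduct.tmul_smul, Nat.cast_smul_eq_nsmul]

theorem inclQ_latticeVec (i : M →ₗ[ℤ] Λ) (m : M) : inclQ i (latticeVec m) = latticeVec (i m) :=
  LinearMap.baseChange_tmul _ _ _

/-- The value at `(n, λ)` of the homogenization of the inequality `p.2 ≤ p.1`. -/
def slack (p : Module.Dual ℚ (QSpan Λ) × ℚ) : ℕ × Λ →+ ℚ where
  toFun b := p.1 (latticeVec b.2) - b.1 * p.2
  map_zero' := by simp [latticeVec]
  map_add' a b := by
    rw [Prod.snd_add, Prod.fst_add, latticeVec_add, map_add]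
    push_cast
    ring

theorem slack_apply (p : Module.Dual ℚ (QSpan Λ) × ℚ) (b : ℕ × Λ) :
    slack p b = p.1 (latticeVec b.2) - b.1 * p.2 := rfl

/-- The monoid `C(P) ∩ (ℤ × Λ)` is cut out by the homogenizations of the inequalities in `s`. -/
def Presents (s : Finset (Module.Dual ℚ (QSpan Λ) × ℚ)) (P : Set (QSpan Λ)) : Prop :=
  ∀ b : ℕ × Λ, b ∈ polyMonoid P ↔ ∀ p ∈ s, 0 ≤ slack p b

variable {s : Finset (Module.Dual ℚ (QSpan Λ) × ℚ)} {P : Set (QSpan Λ)}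

/-- A vector on which the inequalities active at `a` are nonnegative is brought into the monoid by
adding multiples of `a`. -/
theorem exists_mem_add_nsmul (hS : Presents s P) {a : ℕ × Λ} (ha : a ∈ polyMonoid P)
    (hn : 0 < a.1) (k : ℤ) (l : Λ)
    (hk : ∀ p ∈ s, slack p a = 0 → 0 ≤ p.1 (latticeVec l) - k * p.2) :
    ∃ N₀ : ℕ, ∀ N, N₀ ≤ N → ∃ b ∈ polyMonoid P, (b.1 : ℤ) = k + N * a.1 ∧ b.2 = l + N • a.2 := by
  classical
  have key : ∀ p ∈ s, ∃ N₀ : ℕ, ∀ N : ℕ, N₀ ≤ N →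
      0 ≤ (p.1 (latticeVec l) - k * p.2) + N * slack p a := by
    intro p hp
    rcases ((hS a).1 ha p hp).eq_or_lt with h0 | h0
    · refine ⟨0, fun N _ => ?_⟩
      rw [← h0, mul_zero, add_zero]
      exact hk p hp h0.symm
    · obtain ⟨N₀, hN₀⟩ := exists_nat_ge (-(p.1 (latticeVec l) - k * p.2) / slack p a)
      refine ⟨N₀, fun N hN => ?_⟩
      rw [div_le_iff₀ h0] at hN₀
      have : (N₀ : ℚ) * slack p a ≤ N * slack p a :=
        mul_le_mul_of_nonneg_right (by exact_mod_cast hN) h0.le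
      linarith
  choose! N₀ hN₀ using key
  -- The first bound makes all inequalities hold; the second makes the degree `k + N a.1`
  -- nonnegative, using `a.1 ≥ 1`.
  refine ⟨max (s.sup N₀) k.natAbs, fun N hN => ?_⟩
  have hkN : 0 ≤ k + N * a.1 := by
    have h1 : k.natAbs ≤ N := (le_max_right _ _).trans hN
    have h2 : (N : ℤ) ≤ N * a.1 := by
      have : (1 : ℤ) ≤ a.1 := by exact_mod_cast hn
      nlinarith
    omega
  have hcast : (((k + N * a.1).toNat : ℕ) : ℤ) = k + N * a.1 := Int.toNat_of_nonneg hkN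
  refine ⟨((k + N * a.1).toNat, l + N • a.2), (hS _).2 fun p hp => ?_, hcast, rfl⟩
  have h1 := hN₀ p hp N (((Finset.le_sup hp).trans (le_max_left _ _)).trans hN)
  have hcast' : (((k + N * a.1).toNat : ℕ) : ℚ) = k + N * a.1 := by exact_mod_cast hcast
  rw [slack_apply] at h1 ⊢
  change 0 ≤ p.1 (latticeVec (l + N • a.2)) - (((k + N * a.1).toNat : ℕ) : ℚ) * p.2
  rw [hcast', latticeVec_add, latticeVec_nsmul, map_add, map_smul, smul_eq_mul]
  linarith

/-- The elements of the monoid in the smallest face containing `a`. -/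
def InFace (s : Finset (Module.Dual ℚ (QSpan Λ) × ℚ)) (a b : ℕ × Λ) : Prop :=
  ∀ p ∈ s, slack p a = 0 → slack p b = 0

/-- The inequalities active at `a` vanish on `-b`, so `-b + N a` lies in the monoid for large `N`.
Thus `e^b` divides a power of `e^a` and is invertible where `e^a` is. -/
theorem InFace.exists_add_eq (hS : Presents s P) {a b : ℕ × Λ} (ha : a ∈ polyMonoid P)
    (hn : 0 < a.1) (hb : InFace s a b) : ∃ (N : ℕ) (b' : polyMonoid P), b + b'.1 = N • a := by
  obtain ⟨N, hN⟩ := exists_mem_add_nsmul hS ha hn (-b.1) (-b.2) fun p hp e => by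
    have := hb p hp e
    rw [slack_apply] at this
    rw [latticeVec, TensorProduct.tmul_neg, map_neg]
    push_cast
    linarith
  obtain ⟨b', hb', h1, h2⟩ := hN N le_rfl
  refine ⟨N, ⟨b', hb'⟩, Prod.ext ?_ ?_⟩
  · have : ((b.1 + b'.1 : ℕ) : ℤ) = ((N * a.1 : ℕ) : ℤ) := by
      push_cast
      rw [h1]
      ring
    change b.1 + b'.1 = N • a.1
    rw [smul_eq_mul]
    exact_mod_cast this
  · change b.2 + b'.2 = N • a.2
    rw [h2]
    abel

variable {i : M →ₗ[ℤ] Λ} {d : Λ →ₗ[ℤ] B}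

/-- The exponents of positive degree in `M` that lie in the relative interior of the cone over an
`M`-stable face. -/
structure IsStableExponent (i : M →ₗ[ℤ] Λ) (s : Finset (Module.Dual ℚ (QSpan Λ) × ℚ))
    (P : Set (QSpan Λ)) (a : ℕ × Λ) : Prop where
  mem : a ∈ polyMonoid P
  pos : 0 < a.1
  mem_range : ∃ m, i m = a.2
  transversal : ∀ v : QSpan Λ, ∃ u : QSpan M, ∀ p ∈ s, slack p a = 0 → p.1 v = p.1 (inclQ i u)

/-- The weights of the exponents in the face of a stable exponent generate a subgroup of finite
index. -/
theorem IsStableExponent.exists_weight (hS : Presents s P) (hid : Function.Exact i d)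
    (hd : Function.Surjective d) {a : ℕ × Λ} (ha : IsStableExponent i s P a) (β : B) :
    ∃ (N : ℕ) (b : polyMonoid P), 0 < N ∧ InFace s a b.1 ∧ d b.1.2 = N • β := by
  obtain ⟨l, rfl⟩ := hd β
  obtain ⟨u, hu⟩ := ha.transversal (latticeVec l)
  -- After clearing denominators, `k l - i m` is a direction of the face of weight `k β`; a multiple
  -- of `a`, of weight zero, moves it into the monoid.
  obtain ⟨k, m, hk, hm⟩ := exists_lattice_multiple u
  have hact : ∀ p ∈ s, slack p a = 0 → p.1 (latticeVec (k • l - i m)) = 0 := by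
    intro p hp e
    rw [latticeVec_sub, latticeVec_nsmul, ← inclQ_latticeVec, ← hm, map_sub, map_smul, map_smul,
      map_smul, hu p hp e, sub_self]
  obtain ⟨N, hN⟩ := exists_mem_add_nsmul hS ha.mem ha.pos 0 (k • l - i m) fun p hp e => by
    rw [hact p hp e]
    simp
  obtain ⟨b, hb, h1, h2⟩ := hN N le_rfl
  have hdi : ∀ m, d (i m) = 0 := fun m => (hid (i m)).2 ⟨m, rfl⟩
  refine ⟨k, ⟨b, hb⟩, hk, fun p hp e => ?_, ?_⟩
  · have h3 : ((b.1 : ℕ) : ℚ) = N * a.1 := by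
      have : ((b.1 : ℕ) : ℤ) = N * a.1 := by rw [h1]; ring
      exact_mod_cast this
    have h4 := e
    rw [slack_apply] at h4
    change p.1 (latticeVec b.2) - (b.1 : ℚ) * p.2 = 0
    rw [h2, h3, latticeVec_add, map_add, hact p hp e, latticeVec_nsmul, map_smul, smul_eq_mul]
    linear_combination (N : ℚ) * h4
  · obtain ⟨m', hm'⟩ := ha.mem_range
    change d b.2 = k • d l
    rw [h2, ← hm', map_add, map_sub, map_nsmul, map_nsmul, hdi, hdi, smul_zero, add_zero, sub_zero]

/-- If an exponent is not stable, then some nonzero functional on `B` vanishes on the weights in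
its face. -/
theorem exists_functional_of_not_transversal (hid : Function.Exact i d)
    (hd : Function.Surjective d) {a : ℕ × Λ} (hn : 0 < a.1) (ha : ∃ m, i m = a.2)
    (h : ¬ ∀ v : QSpan Λ, ∃ u : QSpan M, ∀ p ∈ s, slack p a = 0 → p.1 v = p.1 (inclQ i u)) :
    ∃ g : B →+ ℚ, (∃ β, g β ≠ 0) ∧ ∀ b : ℕ × Λ, InFace s a b → g (d b.2) = 0 := by
  classical
  -- `L₀` is the space of directions of the face. Since `L₀ + M_ℚ` is proper, a nonzero functional
  -- kills it; it vanishes on `M` and so descends to `B`.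
  let L₀ : Submodule ℚ (QSpan Λ) := ⨅ p ∈ s.filter (fun p => slack p a = 0), LinearMap.ker p.1
  have hL₀ : ∀ v, v ∈ L₀ ↔ ∀ p ∈ s, slack p a = 0 → p.1 v = 0 := by
    intro v
    simp [L₀, Submodule.mem_iInf, Finset.mem_filter]
  have hlt : L₀ ⊔ LinearMap.range (inclQ i) < ⊤ := by
    refine lt_top_iff_ne_top.2 fun htop => h fun v => ?_
    obtain ⟨w, hw, _, ⟨u, rfl⟩, rfl⟩ := Submodule.mem_sup.1 (htop ▸ Submodule.mem_top (x := v))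
    refine ⟨u, fun p hp e => ?_⟩
    rw [map_add, (hL₀ w).1 hw p hp e, zero_add]
  obtain ⟨f, hf, hker⟩ := Submodule.exists_le_ker_of_lt_top _ hlt
  have hfi : ∀ m, f (latticeVec (i m)) = 0 := fun m => by
    rw [← inclQ_latticeVec]
    exact hker (Submodule.mem_sup_right ⟨_, rfl⟩)
  let f' : Λ →+ ℚ := f.toAddMonoidHom.comp (TensorProduct.mk ℤ ℚ Λ 1).toAddMonoidHom
  have hf' : ∀ l, f' l = f (latticeVec l) := fun l => rfl
  let g : B →+ ℚ := AddMonoidHom.liftOfSurjective d.toAddMonoidHom hd ⟨f', fun l hl => by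
    obtain ⟨m, rfl⟩ := (hid l).1 hl
    rw [AddMonoidHom.mem_ker, hf']
    exact hfi m⟩
  have hg : ∀ l, g (d l) = f (latticeVec l) := fun l =>
    AddMonoidHom.liftOfRightInverse_comp_apply d.toAddMonoidHom _ _ _ l
  refine ⟨g, ?_, fun b hb => ?_⟩
  · by_contra hcon
    push Not at hcon
    refine hf (LinearMap.ext fun v => ?_)
    obtain ⟨k, l, hk, hl⟩ := exists_lattice_multiple v
    have h1 := hg l
    rw [hcon, ← hl, map_smul, smul_eq_mul] at h1
    have hk' : (k : ℚ) ≠ 0 := by exact_mod_cast hk.ne'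
    rw [LinearMap.zero_apply]
    exact (mul_eq_zero.1 h1.symm).resolve_left hk'
  · obtain ⟨m, hm⟩ := ha
    have hn' : (a.1 : ℚ) ≠ 0 := by exact_mod_cast hn.ne'
    -- Subtracting the multiple of `a` with the same degree as `b` leaves a direction of the face,
    -- and `a.2 ∈ M` does not contribute to `f`.
    have h1 : latticeVec b.2 - ((b.1 : ℚ) / a.1) • latticeVec a.2 ∈ L₀ := by
      refine (hL₀ _).2 fun p hp e => ?_
      have h2 := hb p hp e
      rw [slack_apply] at h2 e
      rw [map_sub, map_smul, smul_eq_mul]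
      field_simp
      linear_combination (a.1 : ℚ) * h2 - (b.1 : ℚ) * e
    have h3 : f (latticeVec b.2 - ((b.1 : ℚ) / a.1) • latticeVec a.2) = 0 :=
      hker (Submodule.mem_sup_left h1)
    rw [map_sub, map_smul, ← hm, hfi, smul_zero, sub_zero] at h3
    rw [hg, h3]

/-- The character `β ↦ exp (t g(β))` of a group with values in `ℂˣ`. -/
def expChar (g : B →+ ℚ) (t : ℝ) : Torus B where
  toFun β := Units.mk0 (Complex.exp ((t * (g β.toAdd : ℝ) : ℝ) : ℂ)) (Complex.exp_ne_zero _)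
  map_one' := by
    ext
    simp
  map_mul' a b := by
    ext
    have : g (a * b).toAdd = g a.toAdd + g b.toAdd := map_add g a.toAdd b.toAdd
    simp only [this, Units.val_mk0, Units.val_mul]
    rw [← Complex.exp_add]
    congr 1
    push_cast
    ring

theorem expChar_apply (g : B →+ ℚ) (t : ℝ) (β : B) : (expChar g t (Multiplicative.ofAdd β) : ℂ) =
    Complex.exp ((t * (g β : ℝ) : ℝ) : ℂ) := rfl

theorem expChar_injOn (g : B →+ ℚ) {β : B} (hβ : g β ≠ 0) {t t' : ℝ}
    (h : expChar g t (Multiplicative.ofAdd β) = expChar g t' (Multiplicative.ofAdd β)) :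
    t = t' := by
  have h1 := congrArg Units.val h
  rw [expChar_apply, expChar_apply, ← Complex.ofReal_exp, ← Complex.ofReal_exp] at h1
  have h2 := Real.exp_injective (Complex.ofReal_injective h1)
  have h3 : (g β : ℝ) ≠ 0 := by exact_mod_cast hβ
  exact mul_right_cancel₀ h3 h2

theorem expChar_eq_one (g : B →+ ℚ) (t : ℝ) {β : B} (hβ : g β = 0) :
    expChar g t (Multiplicative.ofAdd β) = 1 := by
  ext
  rw [expChar_apply, hβ]
  simp

/-- Characters of a lattice separate its points. -/
theorem exists_torus_ne_one [Module.Free ℤ B] {β : B} (hβ : β ≠ 0) :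
    ∃ t : Torus B, t (Multiplicative.ofAdd β) ≠ 1 := by
  let b := Module.Free.chooseBasis ℤ B
  obtain ⟨j, hj⟩ : ∃ j, b.repr β j ≠ 0 := by
    by_contra hcon
    push Not at hcon
    exact hβ (b.repr.map_eq_zero_iff.1 (Finsupp.ext hcon))
  let g : B →+ ℚ := (Int.castAddHom ℚ).comp (b.coord j).toAddMonoidHom
  have hg : g β ≠ 0 := by
    change ((b.repr β j : ℤ) : ℚ) ≠ 0
    exact_mod_cast hj
  refine ⟨expChar g 1, fun h => ?_⟩
  have h0 : expChar g 0 (Multiplicative.ofAdd β) = 1 := by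
    ext
    rw [expChar_apply]
    simp
  exact one_ne_zero (expChar_injOn g hg (h.trans h0.symm))

end Lattice

end Toric

/-! ### Extension of homomorphisms into `ℂˣ`. -/

/-- `ℂˣ` is a divisible group. -/
theorem Complex.baer_additive_units : Module.Baer ℤ (Additive ℂˣ) := by
  let _ : DivisibleBy (Additive ℂˣ) ℕ := divisibleByOfSMulRightSurj (Additive ℂˣ) ℕ (by
    intro n hn z
    obtain ⟨w, hw⟩ := IsAlgClosed.exists_pow_nat_eq ((Additive.toMul z : ℂˣ) : ℂ)
      (Nat.pos_of_ne_zero hn)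
    have hw0 : w ≠ 0 := by
      rintro rfl
      rw [zero_pow hn] at hw
      exact (Additive.toMul z).ne_zero hw.symm
    refine ⟨Additive.ofMul (Units.mk0 w hw0), ?_⟩
    change Additive.ofMul ((Units.mk0 w hw0) ^ n) = z
    rw [← ofMul_toMul z]
    congr 1
    ext
    simpa using hw)
  let _ : DivisibleBy (Additive ℂˣ) ℤ := AddGroup.divisibleByIntOfDivisibleByNat (Additive ℂˣ)
  exact Module.Baer.of_divisible _

/-- A homomorphism `g` from a commutative monoid to a divisible group factors through a
homomorphism `f` to a group if it is constant on the fibres of `f`. -/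
theorem exists_addMonoidHom_comp_eq {A C D : Type} [AddCommMonoid A] [AddCommGroup C]
    [AddCommGroup D] (hD : Module.Baer ℤ D) (f : A →+ C) (g : A →+ D)
    (h : ∀ a b, f a = f b → g a = g b) : ∃ k : C →+ D, ∀ a, k (f a) = g a := by
  let F := Algebra.GrothendieckAddGroup.lift f
  let G := Algebra.GrothendieckAddGroup.lift g
  have hF : ∀ a, F (Algebra.GrothendieckAddGroup.of a) = f a := fun a =>
    DFunLike.congr_fun (Algebra.GrothendieckAddGroup.lift.symm_apply_apply f) a
  have hG : ∀ a, G (Algebra.GrothendieckAddGroup.of a) = g a := fun a =>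
    DFunLike.congr_fun (Algebra.GrothendieckAddGroup.lift.symm_apply_apply g) a
  -- An element of the Grothendieck group is a difference of two elements of `A`; if `F` kills it,
  -- they lie in one fibre of `f`, where `g` is constant.
  have hker : F.ker ≤ G.ker := by
    intro z hz
    obtain ⟨⟨a, b⟩, hab⟩ := (AddLocalization.addMonoidOf (⊤ : AddSubmonoid A)).surj z
    have hab' : z + Algebra.GrothendieckAddGroup.of (b : A) =
        Algebra.GrothendieckAddGroup.of a := hab
    have h1 := congrArg F hab'
    have h2 := congrArg G hab'
    rw [map_add, hF, hF, AddMonoidHom.mem_ker.1 hz, zero_add] at h1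
    rw [map_add, hG, hG, h _ _ h1] at h2
    exact AddMonoidHom.mem_ker.2 (add_eq_right.1 h2)
  -- `G` factors through the quotient by `ker F`, which embeds into `C`; divisibility extends the
  -- factored map to `C`.
  obtain ⟨k, hk⟩ := hD.extension_property_addMonoidHom (QuotientAddGroup.kerLift F)
    (QuotientAddGroup.kerLift_injective F) (QuotientAddGroup.lift F.ker G hker)
  refine ⟨k, fun a => ?_⟩
  have := DFunLike.congr_fun hk (QuotientAddGroup.mk (Algebra.GrothendieckAddGroup.of a))
  rw [AddMonoidHom.comp_apply, QuotientAddGroup.kerLift_mk, QuotientAddGroup.lift_mk, hF, hG] at this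
  exact this

/-! ### Orbits in `Proj`, and finiteness of torsion subsets of a torus. -/

namespace GIT

section Points

variable {R : Type} [CommRing R] [Algebra ℂ R] {𝒜 : ℕ → Submodule ℂ R} [GradedAlgebra 𝒜]
  {G : Type} [Group G] (ρ : GradedAction 𝒜 G)

theorem mem_iff_decompose_mem (x : Proj 𝒜) (r : R) : r ∈ x.asHomogeneousIdeal.toIdeal ↔
    ∀ k, (DirectSum.decompose 𝒜 r k : R) ∈ x.asHomogeneousIdeal.toIdeal := by
  classical
  exact ⟨fun hr k => x.asHomogeneousIdeal.isHomogeneous k hr, fun hr => by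
    rw [← DirectSum.sum_support_decompose 𝒜 r]
    exact Ideal.sum_mem _ fun k _ => hr k⟩

/-- Points given by homomorphisms to `ℂ` that agree up to the action of `g` on homogeneous
elements are related by `g`. -/
theorem pointOf_eq_comap {ψ φ : R →ₐ[ℂ] ℂ} {f f' : R} {n n' : ℕ} {hf : f ∈ 𝒜 n} {hn : 0 < n}
    {h : ψ f ≠ 0} {hf' : f' ∈ 𝒜 n'} {hn' : 0 < n'} {h' : φ f' ≠ 0} (g : G)
    (hg : ∀ k, ∀ r ∈ 𝒜 k, φ r = 0 ↔ ψ (ρ.act g r) = 0) :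
    (pointOf φ hf' hn' h').asHomogeneousIdeal.toIdeal =
      (pointOf ψ hf hn h).asHomogeneousIdeal.toIdeal.comap (ρ.act g) := by
  ext r
  rw [Ideal.mem_comap, mem_iff_decompose_mem, mem_iff_decompose_mem]
  refine forall_congr' fun k => ?_
  rw [ρ.decompose_act]
  exact ((mem_pointOf (DirectSum.decompose 𝒜 r k).2).trans
    (hg k _ (DirectSum.decompose 𝒜 r k).2)).trans
    (mem_pointOf (ρ.act_mem g k _ (DirectSum.decompose 𝒜 r k).2)).symm

/-- A homogeneous element vanishing on the orbit of a point vanishes on its closure. -/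
theorem mem_of_mem_closure_orbit {x y : Proj 𝒜} (hy : y ∈ closure (ρ.orbit x)) {r : R}
    (hr : ∀ g, ρ.act g r ∈ x.asHomogeneousIdeal.toIdeal) :
    r ∈ y.asHomogeneousIdeal.toIdeal := by
  have hclosed : IsClosed (ProjectiveSpectrum.zeroLocus 𝒜 {r}) :=
    ProjectiveSpectrum.isClosed_zeroLocus 𝒜 {r}
  have hsub : ρ.orbit x ⊆ ProjectiveSpectrum.zeroLocus 𝒜 {r} := by
    rintro z ⟨g, hg⟩
    refine (ProjectiveSpectrum.mem_zeroLocus 𝒜 z {r}).2 (Set.singleton_subset_iff.2 ?_)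
    change r ∈ z.asHomogeneousIdeal.toIdeal
    rw [hg]
    exact hr g
  exact Set.singleton_subset_iff.1
    ((ProjectiveSpectrum.mem_zeroLocus 𝒜 y {r}).1 (closure_minimal hsub hclosed hy))

end Points

end GIT

namespace Toric

/-- A character is determined by its values on a basis of `B`, each of which is a root of unity of
prescribed order bound. -/
theorem finite_torus_of_pow_eq_one {B : Type} [AddCommGroup B] [Module.Finite ℤ B]
    [Module.Free ℤ B] (N : B → ℕ) (hN : ∀ β, 0 < N β) :
    {t : Torus B | ∀ β, t (Multiplicative.ofAdd β) ^ N β = 1}.Finite := by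
  let b := Module.Free.chooseBasis ℤ B
  let ev : Torus B → (Module.Free.ChooseBasisIndex ℤ B → ℂˣ) :=
    fun t j => t (Multiplicative.ofAdd (b j))
  have hinj : Function.Injective ev := by
    intro t t' h
    apply MonoidHom.toAdditiveRight.injective
    have : (MonoidHom.toAdditiveRight t).toIntLinearMap =
        (MonoidHom.toAdditiveRight t').toIntLinearMap :=
      b.ext fun j => congrArg Additive.ofMul (congrFun h j)
    ext β
    exact congrArg (fun z : Additive ℂˣ => (z.toMul : ℂ)) (LinearMap.congr_fun this β)
  refine Set.Finite.of_finite_image (f := ev) ?_ hinj.injOn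
  refine (Set.Finite.pi' (t := fun j => (rootsOfUnity (N (b j)) ℂ : Set ℂˣ)) fun j => ?_).subset ?_
  · have : NeZero (N (b j)) := ⟨(hN _).ne'⟩
    exact inferInstanceAs (Finite (rootsOfUnity (N (b j)) ℂ))
  · rintro _ ⟨t, ht, rfl⟩ j
    exact ht (b j)

end Toric

/-! ### Monomials with stable exponents are stable sections. -/

namespace Toric

open Polyhedral GIT

section Monomials

variable {M Λ B : Type} [AddCommGroup M] [AddCommGroup Λ] [AddCommGroup B]
  {i : M →ₗ[ℤ] Λ} {d : Λ →ₗ[ℤ] B} {s : Finset (Module.Dual ℚ (QSpan Λ) × ℚ)} {P : Set (QSpan Λ)}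

/-- The monomial with exponent `b`. -/
abbrev monomial (b : polyMonoid P) : ℂ[polyMonoid P] := AddMonoidAlgebra.single b 1

theorem monomial_add (b c : polyMonoid P) : monomial (b + c) = monomial b * monomial c := by
  rw [AddMonoidAlgebra.single_mul_single, mul_one]

theorem monomial_nsmul (n : ℕ) (b : polyMonoid P) : monomial (n • b) = monomial b ^ n := by
  rw [AddMonoidAlgebra.single_pow, one_pow]

theorem monomial_mem (b : polyMonoid P) : monomial b ∈ polyGrading P b.1.1 :=
  AddMonoidAlgebra.single_mem_gradeBy (polyDegree P) b 1

theorem eq_sum_monomial (r : ℂ[polyMonoid P]) :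
    r = ∑ b ∈ r.coeff.support, r.coeff b • monomial b := by
  conv_lhs => rw [← r.sum_coeff_single]
  refine Finset.sum_congr rfl fun b _ => ?_
  rw [AddMonoidAlgebra.smul_single, smul_eq_mul, mul_one]

theorem act_monomial (t : Torus B) (b : polyMonoid P) :
    (torusAction d P).act t (monomial b) =
      (t (Multiplicative.ofAdd (d b.1.2)) : ℂ) • monomial b := by
  change torusActHom d P t _ = _
  rw [torusActHom_single, one_mul, AddMonoidAlgebra.smul_single, smul_eq_mul, mul_one]

theorem coeff_act (t : Torus B) (r : ℂ[polyMonoid P]) (b : polyMonoid P) :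
    ((torusAction d P).act t r).coeff b = r.coeff b * (t (Multiplicative.ofAdd (d b.1.2)) : ℂ) := by
  classical
  induction r using AddMonoidAlgebra.induction_linear with
  | zero => simp
  | add x y hx hy => rw [map_add, AddMonoidAlgebra.coeff_add, Finsupp.add_apply, hx, hy,
      AddMonoidAlgebra.coeff_add, Finsupp.add_apply, add_mul]
  | single a c =>
    change (torusActHom d P t _).coeff b = _
    rw [torusActHom_single, AddMonoidAlgebra.coeff_single, AddMonoidAlgebra.coeff_single,
      Finsupp.single_apply, Finsupp.single_apply]
    split_ifs with h
    · rw [h]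
    · rw [zero_mul]

/-- The torus acts diagonally on monomials, and characters of the lattice `B` separate a nonzero
weight from zero. -/
theorem mem_invariants_iff [Module.Free ℤ B] {r : ℂ[polyMonoid P]} :
    r ∈ (torusAction d P).invariants ↔ ∀ b ∈ r.coeff.support, d b.1.2 = 0 := by
  constructor
  · intro h b hb
    by_contra hne
    obtain ⟨t, ht⟩ := exists_torus_ne_one hne
    have h1 := coeff_act (d := d) t r b
    rw [h t] at h1
    refine ht (Units.ext ?_)
    rw [Units.val_one]
    exact (mul_eq_left₀ (Finsupp.mem_support_iff.1 hb)).1 h1.symm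
  · intro h t
    refine AddMonoidAlgebra.coeff_injective (Finsupp.ext fun b => ?_)
    rw [coeff_act]
    by_cases hb : b ∈ r.coeff.support
    · rw [h b hb, ofAdd_zero, map_one, Units.val_one, mul_one]
    · rw [Finsupp.notMem_support_iff.1 hb, zero_mul]

theorem monomial_mem_invariants {b : polyMonoid P} (hb : d b.1.2 = 0) :
    monomial b ∈ (torusAction d P).invariants := by
  intro t
  rw [act_monomial, hb, ofAdd_zero, map_one, Units.val_one, one_smul]

/-- Supplies the countability needed for the Nullstellensatz, so finite generation of the algebra is
never required. -/
theorem rank_polyMonoid_le [Module.Finite ℤ Λ] (P : Set (QSpan Λ)) :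
    Module.rank ℂ ℂ[polyMonoid P] ≤ Cardinal.aleph0 := by
  have : Countable Λ := Finsupp.Countable.of_moduleFinite (R := ℤ)
  rw [(AddMonoidAlgebra.coeffLinearEquiv ℂ : ℂ[polyMonoid P] ≃ₗ[ℂ] _).rank_eq, rank_finsupp_self']
  exact Cardinal.mk_le_aleph0

/-- A homomorphism to `ℂ` that does not vanish at a monomial does not vanish at the monomials in
its face. -/
theorem InFace.map_monomial_ne_zero (hS : Presents s P) {a b : polyMonoid P} (hn : 0 < a.1.1)
    (hb : InFace s a.1 b.1) {ψ : ℂ[polyMonoid P] →ₐ[ℂ] ℂ} (h : ψ (monomial a) ≠ 0) :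
    ψ (monomial b) ≠ 0 := by
  obtain ⟨N, b', e⟩ := hb.exists_add_eq hS a.2 hn
  have e' : b + b' = N • a := Subtype.ext (by simpa using e)
  have h1 := congrArg (fun c => ψ (monomial c)) e'
  simp only [monomial_add, monomial_nsmul, map_mul, map_pow] at h1
  exact left_ne_zero_of_mul (h1 ▸ pow_ne_zero N h)

/-- Two monomials of the same degree and weight satisfy a linear relation at all points of an
orbit closure. -/
theorem monomial_relation {ψ φ : ℂ[polyMonoid P] →ₐ[ℂ] ℂ} {f f' : ℂ[polyMonoid P]} {n n' : ℕ}
    {hf : f ∈ polyGrading P n} {hn : 0 < n} {h : ψ f ≠ 0} {hf' : f' ∈ polyGrading P n'}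
    {hn' : 0 < n'} {h' : φ f' ≠ 0}
    (hcl : pointOf φ hf' hn' h' ∈ closure ((torusAction d P).orbit (pointOf ψ hf hn h)))
    {b c : polyMonoid P} (hdeg : b.1.1 = c.1.1) (hw : d b.1.2 = d c.1.2) :
    ψ (monomial c) * φ (monomial b) = ψ (monomial b) * φ (monomial c) := by
  have hhom : ψ (monomial c) • monomial b - ψ (monomial b) • monomial c ∈
      polyGrading P b.1.1 :=
    Submodule.sub_mem _ (Submodule.smul_mem _ _ (monomial_mem b))
      (Submodule.smul_mem _ _ (hdeg ▸ monomial_mem c))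
  have h1 := mem_of_mem_closure_orbit (torusAction d P) hcl
    (r := ψ (monomial c) • monomial b - ψ (monomial b) • monomial c) fun t => by
      refine (mem_pointOf ((torusAction d P).act_mem t _ _ hhom)).2 ?_
      rw [map_sub, map_smul, map_smul, act_monomial, act_monomial, hw]
      simp only [map_sub, map_smul, smul_eq_mul]
      ring
  have h2 := (mem_pointOf hhom).1 h1
  simp only [map_sub, map_smul, smul_eq_mul] at h2
  exact sub_eq_zero.1 h2

variable [Module.Finite ℤ Λ]

/-- For each `β` the face of `a` contains an exponent `b` of weight `N β`, and `e^b` does not vanish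
at `x`. Comparing `b` and the invariant `a` in a common degree, an element `t` fixing `x` satisfies
`t(β)^{N deg a} = 1`. -/
theorem IsStableExponent.finite_stabilizer [Module.Free ℤ B] [Module.Finite ℤ B]
    (hS : Presents s P) (hid : Function.Exact i d)
    (hd : Function.Surjective d) {a : polyMonoid P} (ha : IsStableExponent i s P a.1)
    {x : polyScheme P} (hax : x ∈ Proj.basicOpen (polyGrading P) (monomial a))
    (hx : IsClosed ({x} : Set (polyScheme P))) : ((torusAction d P).stabilizer x).Finite := by
  obtain ⟨ψ, hψ, rfl⟩ := exists_eq_pointOf (rank_polyMonoid_le P) (monomial_mem a) ha.pos hax hx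
  have hda : d a.1.2 = 0 := (hid _).2 ha.mem_range
  choose N b hN hb hdb using ha.exists_weight hS hid hd
  refine (finite_torus_of_pow_eq_one (fun β => N β * a.1.1)
    fun β => Nat.mul_pos (hN β) ha.pos).subset fun t ht β => ?_
  have hψb := (hb β).map_monomial_ne_zero hS ha.pos hψ
  set u := ψ (monomial a)
  set w := ψ (monomial (b β))
  have hhom : u ^ (b β).1.1 • monomial (b β) ^ a.1.1 - w ^ a.1.1 • monomial a ^ (b β).1.1 ∈
      polyGrading P (a.1.1 * (b β).1.1) := by
    refine Submodule.sub_mem _ (Submodule.smul_mem _ _ ?_) (Submodule.smul_mem _ _ ?_)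
    · simpa using SetLike.pow_mem_graded a.1.1 (monomial_mem (b β))
    · rw [mul_comm]
      simpa using SetLike.pow_mem_graded (b β).1.1 (monomial_mem a)
  have h0 : u ^ (b β).1.1 • monomial (b β) ^ a.1.1 - w ^ a.1.1 • monomial a ^ (b β).1.1 ∈
      (pointOf ψ (monomial_mem a) ha.pos hψ).asHomogeneousIdeal.toIdeal := by
    refine (mem_pointOf hhom).2 ?_
    simp only [map_sub, map_smul, map_pow, smul_eq_mul]
    ring
  rw [← (show _ = _ from ht), Ideal.mem_comap] at h0
  have h1 := (mem_pointOf ((torusAction d P).act_mem t _ _ hhom)).1 h0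
  have h2 : (torusAction d P).act t (monomial a) = monomial a := by
    rw [act_monomial, hda, ofAdd_zero, map_one, Units.val_one, one_smul]
  have h3 : (torusAction d P).act t (monomial (b β)) =
      ((t (Multiplicative.ofAdd β) : ℂ) ^ N β) • monomial (b β) := by
    rw [act_monomial, hdb, ofAdd_nsmul, map_pow, Units.val_pow_eq_pow_val]
  simp only [map_sub, map_smul, map_pow, h2, h3, smul_eq_mul] at h1
  have h4 : u ^ (b β).1.1 * w ^ a.1.1 *
      (((t (Multiplicative.ofAdd β) : ℂ) ^ N β) ^ a.1.1 - 1) = 0 := by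
    rw [← h1, mul_pow]
    ring
  have h5 := (mul_eq_zero.1 h4).resolve_left
    (mul_ne_zero (pow_ne_zero _ hψ) (pow_ne_zero _ hψb))
  refine Units.ext ?_
  rw [Units.val_pow_eq_pow_val, pow_mul, Units.val_one]
  exact sub_eq_zero.1 h5

/-- Let `ψ`, `φ` give `x`, `y`. They vanish on the same monomials, and on the others the ratio `φ/ψ`
depends only on degree and weight. It therefore extends to a homomorphism `ℤ × B → ℂˣ`; its
restriction to `B` is the torus element carrying `x` to `y`. -/
theorem IsStableExponent.closed_orbit (hS : Presents s P) (hid : Function.Exact i d)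
    (hd : Function.Surjective d) {a : polyMonoid P} (ha : IsStableExponent i s P a.1)
    {x : polyScheme P} (hax : x ∈ Proj.basicOpen (polyGrading P) (monomial a))
    (hx : IsClosed ({x} : Set (polyScheme P))) {y : polyScheme P}
    (hay : y ∈ Proj.basicOpen (polyGrading P) (monomial a))
    (hy : IsClosed ({y} : Set (polyScheme P)))
    (hxy : y ∈ closure ((torusAction d P).orbit x)) : y ∈ (torusAction d P).orbit x := by
  obtain ⟨ψ, hψ, rfl⟩ := exists_eq_pointOf (rank_polyMonoid_le P) (monomial_mem a) ha.pos hax hx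
  obtain ⟨φ, hφ, rfl⟩ := exists_eq_pointOf (rank_polyMonoid_le P) (monomial_mem a) ha.pos hay hy
  have hda : d a.1.2 = 0 := (hid _).2 ha.mem_range
  have hrel : ∀ {b c : polyMonoid P}, b.1.1 = c.1.1 → d b.1.2 = d c.1.2 →
      ψ (monomial c) * φ (monomial b) = ψ (monomial b) * φ (monomial c) :=
    fun h1 h2 => monomial_relation hxy h1 h2
  have hzero : ∀ b : polyMonoid P, ψ (monomial b) = 0 → φ (monomial b) = 0 := by
    intro b hb
    refine (mem_pointOf (monomial_mem b)).1 (mem_of_mem_closure_orbit _ hxy fun t =>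
      (mem_pointOf ((torusAction d P).act_mem t _ _ (monomial_mem b))).2 ?_)
    rw [act_monomial, map_smul, hb, smul_zero]
  -- Some `c` in the face of `a` has weight `-N d(b)`, so `e^{N b + c}` is invariant. Powers of it
  -- and of `e^a` in the same degree are related at `x` and `y`, so it does not vanish at `y`
  -- either.
  have hnonzero : ∀ b : polyMonoid P, ψ (monomial b) ≠ 0 → φ (monomial b) ≠ 0 := by
    intro b hb
    obtain ⟨N, c, hN, hc, hdc⟩ := ha.exists_weight hS hid hd (-d b.1.2)
    have hψc := hc.map_monomial_ne_zero hS ha.pos hψ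
    have hdw : d (N • b + c).1.2 = 0 := by
      change d (N • b.1.2 + c.1.2) = 0
      rw [map_add, map_nsmul, hdc, smul_neg, add_neg_cancel]
    have h1 := hrel (b := a.1.1 • (N • b + c)) (c := (N • b + c).1.1 • a)
      (show a.1.1 • (N • b + c).1.1 = (N • b + c).1.1 • a.1.1 by
        rw [smul_eq_mul, smul_eq_mul, mul_comm])
      (show d (a.1.1 • (N • b + c).1.2) = d ((N • b + c).1.1 • a.1.2) by
        rw [map_nsmul, map_nsmul, hdw, hda, smul_zero, smul_zero])
    simp only [monomial_nsmul, monomial_add, map_pow, map_mul] at h1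
    intro hb0
    have h2 : ψ (monomial a) ^ (N • b + c).1.1 *
        (φ (monomial b) ^ N * φ (monomial c)) ^ a.1.1 = 0 := by
      rw [hb0, zero_pow hN.ne', zero_mul, zero_pow ha.pos.ne', mul_zero]
    rw [h2] at h1
    exact mul_ne_zero (pow_ne_zero _ (mul_ne_zero (pow_ne_zero _ hb) hψc)) (pow_ne_zero _ hφ)
      h1.symm
  let A : AddSubmonoid (polyMonoid P) :=
    { carrier := {b | ψ (monomial b) ≠ 0}
      add_mem' := fun {b c} hb hc => by
        change ψ (monomial (b + c)) ≠ 0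
        rw [monomial_add, map_mul]
        exact mul_ne_zero hb hc
      zero_mem' := by
        change ψ (monomial 0) ≠ 0
        rw [monomial, ← AddMonoidAlgebra.one_def, map_one]
        exact one_ne_zero }
  let F : A →+ ℤ × B :=
    { toFun := fun b => ((b.1.1.1 : ℤ), d b.1.1.2)
      map_zero' := Prod.ext (by simp) (by simp)
      map_add' := fun b c => Prod.ext (by simp) (by simp) }
  have hval : ∀ b : A, φ (monomial b.1) / ψ (monomial b.1) ≠ 0 :=
    fun b => div_ne_zero (hnonzero _ b.2) b.2
  let g : A →+ Additive ℂˣ :=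
    { toFun := fun b => Additive.ofMul (Units.mk0 _ (hval b))
      map_zero' := by
        rw [← ofMul_one]
        congr 1
        ext
        change φ (monomial 0) / ψ (monomial 0) = 1
        rw [monomial, ← AddMonoidAlgebra.one_def, map_one, map_one, div_one]
      map_add' := fun b c => by
        rw [← ofMul_mul]
        congr 1
        ext
        change φ (monomial (b.1 + c.1)) / ψ (monomial (b.1 + c.1)) = _ / _ * (_ / _)
        rw [monomial_add, map_mul, map_mul, div_mul_div_comm] }
  obtain ⟨k, hk⟩ := exists_addMonoidHom_comp_eq Complex.baer_additive_units F g fun b c hbc => by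
    have h1 : (b.1.1.1 : ℤ) = c.1.1.1 := congrArg Prod.fst hbc
    have h2 : d b.1.1.2 = d c.1.1.2 := congrArg Prod.snd hbc
    refine congrArg Additive.ofMul (Units.ext ?_)
    change φ (monomial b.1) / ψ (monomial b.1) = φ (monomial c.1) / ψ (monomial c.1)
    rw [div_eq_div_iff b.2 c.2]
    have := hrel (b := b.1) (c := c.1) (by exact_mod_cast h1) h2
    linear_combination this
  let t : Torus B := AddMonoidHom.toMultiplicativeLeft (k.comp (AddMonoidHom.inr ℤ B))
  have ht : ∀ β, (t (Multiplicative.ofAdd β) : ℂ) = ((k (0, β)).toMul : ℂ) := fun β => rfl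
  have hmono : ∀ b : polyMonoid P, φ (monomial b) =
      ((k ((b.1.1 : ℤ), 0)).toMul : ℂ) * (t (Multiplicative.ofAdd (d b.1.2)) * ψ (monomial b)) := by
    intro b
    by_cases hb : ψ (monomial b) = 0
    · rw [hzero b hb, hb, mul_zero, mul_zero]
    · have h1 := congrArg (fun z : Additive ℂˣ => (z.toMul : ℂ)) (hk ⟨b, hb⟩)
      have h2 : F ⟨b, hb⟩ = ((b.1.1 : ℤ), 0) + (0, d b.1.2) := by
        change ((b.1.1 : ℤ), d b.1.2) = _
        rw [Prod.mk_add_mk, add_zero, zero_add]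
      rw [h2, map_add] at h1
      have h3 : ((k ((b.1.1 : ℤ), 0)).toMul : ℂ) * ((k (0, d b.1.2)).toMul : ℂ) =
          φ (monomial b) / ψ (monomial b) := h1
      rw [ht, ← mul_assoc, h3, div_mul_cancel₀ _ hb]
  refine ⟨t, pointOf_eq_comap _ t fun j r hr => ?_⟩
  -- The `ℤ`-component of `k` contributes a scalar depending only on the degree `j`, which does not
  -- affect vanishing of homogeneous elements.
  have h1 : φ r = ((k ((j : ℤ), 0)).toMul : ℂ) * ψ ((torusAction d P).act t r) := by
    conv_lhs => rw [eq_sum_monomial r]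
    conv_rhs => rw [eq_sum_monomial r]
    rw [map_sum, map_sum, map_sum, Finset.mul_sum]
    refine Finset.sum_congr rfl fun b hb => ?_
    have hj : b.1.1 = j := hr b hb
    rw [map_smul, map_smul, map_smul, act_monomial, map_smul, hmono, hj]
    simp only [smul_eq_mul]
    ring
  rw [h1, mul_eq_zero, or_iff_right (Units.ne_zero _)]

/-- The monomials with stable exponents are stable sections. -/
theorem IsStableExponent.isStableSection [Module.Free ℤ B] [Module.Finite ℤ B]
    (hS : Presents s P) (hid : Function.Exact i d)
    (hd : Function.Surjective d) {a : polyMonoid P} (ha : IsStableExponent i s P a.1) :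
    (torusAction d P).IsStableSection (monomial a) where
  invariant := monomial_mem_invariants ((hid _).2 ha.mem_range)
  homogeneous := ⟨_, ha.pos, monomial_mem a⟩
  finite_stabilizer _ hax hx := ha.finite_stabilizer hS hid hd hax hx
  closed_orbit _ hax hx _ hay hy hxy := ha.closed_orbit hS hid hd hax hx hay hy hxy

end Monomials

end Toric

/-! ### The stable locus and its quotient. -/

namespace Toric

open Polyhedral GIT

section StableLocus

variable {M Λ B : Type} [AddCommGroup M] [AddCommGroup Λ] [AddCommGroup B]
  {i : M →ₗ[ℤ] Λ} {d : Λ →ₗ[ℤ] B} {s : Finset (Module.Dual ℚ (QSpan Λ) × ℚ)} {P : Set (QSpan Λ)}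

/-- A nonzero finite combination of characters of a torus does not vanish identically. -/
theorem exists_torus_sum_ne_zero [Module.Free ℤ Λ] {α : Type} (I : Finset α) (e : α → Λ)
    (he : Set.InjOn e I) (c : α → ℂ) {a : α} (ha : a ∈ I) (hc : c a ≠ 0) :
    ∃ χ : Torus Λ, ∑ b ∈ I, c b * (χ (Multiplicative.ofAdd (e b)) : ℂ) ≠ 0 := by
  classical
  by_contra hcon
  push Not at hcon
  let ev : Λ → (Torus Λ →* ℂ) := fun l =>
    { toFun := fun χ => (χ (Multiplicative.ofAdd l) : ℂ)
      map_one' := rfl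
      map_mul' := fun _ _ => rfl }
  have hev : Function.Injective ev := by
    intro l l' h
    by_contra hne
    obtain ⟨χ, hχ⟩ := exists_torus_ne_one (sub_ne_zero.2 hne)
    refine hχ ?_
    have h1 : χ (Multiplicative.ofAdd l) = χ (Multiplicative.ofAdd l') :=
      Units.ext (DFunLike.congr_fun h χ)
    rw [ofAdd_sub, map_div, h1, div_self']
  -- Evaluations at distinct lattice points are distinct characters of the torus, hence independent
  -- by Dedekind.
  have hli : LinearIndependent ℂ fun b : I => (ev (e b) : Torus Λ → ℂ) :=
    (linearIndependent_monoidHom (Torus Λ) ℂ).comp (fun b : I => ev (e b)) fun x y hxy =>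
      Subtype.ext (he x.2 y.2 (hev hxy))
  refine hc (linearIndependent_iff'.1 hli Finset.univ (fun b => c b) ?_ ⟨a, ha⟩
    (Finset.mem_univ _))
  funext χ
  rw [Finset.sum_apply]
  have := hcon χ
  rw [← Finset.sum_coe_sort] at this
  exact this

open Classical in
/-- The homomorphism `e^b ↦ χ(b)` for `b` in the face of `a` and `e^b ↦ 0` otherwise. -/
def faceHom (hS : Presents s P) (a : polyMonoid P) (χ : Torus Λ) : ℂ[polyMonoid P] →ₐ[ℂ] ℂ :=
  AddMonoidAlgebra.lift ℂ ℂ (polyMonoid P)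
    { toFun := fun b => if InFace s a.1 b.toAdd.1 then
        (χ (Multiplicative.ofAdd b.toAdd.1.2) : ℂ) else 0
      map_one' := by
        refine (if_pos (show InFace s a.1 (0 : ℕ × Λ) from fun p _ _ => map_zero (slack p))).trans ?_
        change (χ 1 : ℂ) = 1
        rw [map_one, Units.val_one]
      map_mul' := by
        intro b c
        -- Slacks are nonnegative on the monoid, so a sum has zero slack only if both terms do: the
        -- complement of the face spans an ideal.
        have key : InFace s a.1 (b * c).toAdd.1 ↔
            InFace s a.1 b.toAdd.1 ∧ InFace s a.1 c.toAdd.1 := by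
          have hadd : ∀ p, slack p (b * c).toAdd.1 = slack p b.toAdd.1 + slack p c.toAdd.1 :=
            fun p => map_add (slack p) b.toAdd.1 c.toAdd.1
          constructor
          · intro h
            constructor <;> intro p hp e
            all_goals
              have h1 := h p hp e
              rw [hadd] at h1
              have h2 := (hS _).1 b.toAdd.2 p hp
              have h3 := (hS _).1 c.toAdd.2 p hp
              linarith
          · rintro ⟨h, h'⟩ p hp e
            rw [hadd, h p hp e, h' p hp e, add_zero]
        by_cases hb : InFace s a.1 b.toAdd.1
        · by_cases hc : InFace s a.1 c.toAdd.1
          · rw [if_pos hb, if_pos hc, if_pos (key.2 ⟨hb, hc⟩), ← Units.val_mul, ← map_mul]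
            rfl
          · rw [if_neg hc, if_neg fun h => hc (key.1 h).2, mul_zero]
        · rw [if_neg hb, if_neg fun h => hb (key.1 h).1, zero_mul] }

open Classical in
theorem faceHom_monomial (hS : Presents s P) (a : polyMonoid P) (χ : Torus Λ)
    (b : polyMonoid P) : faceHom hS a χ (monomial b) =
      if InFace s a.1 b.1 then (χ (Multiplicative.ofAdd b.1.2) : ℂ) else 0 := by
  rw [faceHom, AddMonoidAlgebra.lift_single, one_smul]
  rfl

/-- If an invariant exponent `a` is not stable, then no homogeneous element with a monomial in the
face of `a` has its nonvanishing locus in the stable locus. -/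
theorem not_basicOpen_le_stableLocus [Module.Free ℤ Λ] (hS : Presents s P)
    (hid : Function.Exact i d) (hd : Function.Surjective d) {a : polyMonoid P} (hn : 0 < a.1.1)
    (ha : ∃ m, i m = a.1.2)
    (h : ¬ ∀ v : QSpan Λ, ∃ u : QSpan M, ∀ p ∈ s, slack p a.1 = 0 → p.1 v = p.1 (inclQ i u))
    {f : ℂ[polyMonoid P]} {n : ℕ} (hn' : 0 < n) (hf : f ∈ polyGrading P n) {b : polyMonoid P}
    (hb : b ∈ f.coeff.support) (hab : InFace s a.1 b.1) :
    ¬ Proj.basicOpen (polyGrading P) f ≤ (torusAction d P).stableLocus := by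
  classical
  -- Choose a point of the torus of the face at which `f` is nonzero. All exponents of `f` have
  -- degree `n`, so their lattice parts are distinct.
  obtain ⟨χ, hχ⟩ := exists_torus_sum_ne_zero (f.coeff.support.filter fun c => InFace s a.1 c.1)
    (fun c => c.1.2) (fun c hc c' hc' e => by
      have h1 : c.1.1 = n := hf c (Finset.mem_filter.1 hc).1
      have h2 : c'.1.1 = n := hf c' (Finset.mem_filter.1 hc').1
      exact Subtype.ext (Prod.ext (h1.trans h2.symm) e)) f.coeff
    (Finset.mem_filter.2 ⟨hb, hab⟩) (Finsupp.mem_support_iff.1 hb)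
  set ψ := faceHom hS a χ
  have hψ : ψ f ≠ 0 := by
    rw [eq_sum_monomial f, map_sum]
    rw [Finset.sum_filter] at hχ
    convert hχ using 2 with c
    rw [map_smul, faceHom_monomial, smul_eq_mul]
    split_ifs <;> simp
  intro hle
  have hx : pointOf ψ hf hn' hψ ∈ (torusAction d P).stableLocus :=
    hle (show f ∉ (pointOf ψ hf hn' hψ).asHomogeneousIdeal from fun hmem =>
      hψ ((mem_pointOf hf).1 hmem))
  obtain ⟨⟨g, hg⟩, hxg⟩ := Opens.mem_iSup.1 hx
  have hfin := hg.finite_stabilizer _ hxg (isClosed_pointOf hf hn' hψ)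
  -- The characters `exp (t w)`, `t ∈ ℝ`, act trivially on the monomials of the face, the only ones
  -- seen by `ψ`. They form an infinite family in the stabilizer.
  obtain ⟨w, ⟨β, hβ⟩, hw⟩ := exists_functional_of_not_transversal hid hd hn ha h
  refine Set.infinite_univ (α := ℝ) (Set.Finite.of_finite_image (f := expChar w)
    (hfin.subset ?_) fun t _ t' _ htt => expChar_injOn w hβ (by rw [htt]))
  rintro _ ⟨t, -, rfl⟩
  refine (pointOf_eq_comap (torusAction d P) (expChar w t) fun k r hr => ?_).symm
  have : ψ ((torusAction d P).act (expChar w t) r) = ψ r := by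
    conv_lhs => rw [eq_sum_monomial r]
    conv_rhs => rw [eq_sum_monomial r]
    rw [map_sum, map_sum, map_sum]
    refine Finset.sum_congr rfl fun c _ => ?_
    rw [map_smul, map_smul, map_smul, act_monomial, map_smul, faceHom_monomial]
    split_ifs with hc
    · rw [expChar_eq_one w t (hw c.1 hc), Units.val_one, one_smul]
    · rw [smul_zero]
  rw [this]

/-- An invariant monomial. -/
def invMonomial (b : polyMonoid P) (hb : d b.1.2 = 0) : (torusAction d P).invariants :=
  ⟨monomial b, monomial_mem_invariants hb⟩

theorem invMonomial_mem (b : polyMonoid P) (hb : d b.1.2 = 0) :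
    invMonomial b hb ∈ (torusAction d P).invGrading b.1.1 := monomial_mem b

theorem invMonomial_add {b c : polyMonoid P} (hb : d b.1.2 = 0) (hc : d c.1.2 = 0)
    (hbc : d (b + c).1.2 = 0) :
    invMonomial (b + c) hbc = invMonomial b hb * invMonomial c hc :=
  Subtype.ext (monomial_add b c)

/-- The stable GIT quotient is covered by the nonvanishing loci of the monomials with stable
exponents. -/
theorem mem_quotientOpens_stableLocus [Module.Free ℤ Λ] [Module.Finite ℤ Λ] [Module.Free ℤ B]
    [Module.Finite ℤ B] (hS : Presents s P) (hid : Function.Exact i d)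
    (hd : Function.Surjective d) (z : Proj (torusAction d P).invGrading) :
    z ∈ (torusAction d P).quotientOpens (torusAction d P).stableLocus ↔
      ∃ (a : polyMonoid P) (ha : d a.1.2 = 0), IsStableExponent i s P a.1 ∧
        z ∈ Proj.basicOpen (torusAction d P).invGrading (invMonomial a ha) := by
  classical
  constructor
  · intro hz
    obtain ⟨⟨f, ⟨n, hn, hf⟩, hle⟩, hzf⟩ := Opens.mem_iSup.1 hz
    have hzf' : f ∉ z.asHomogeneousIdeal.toIdeal := hzf
    have hprime : z.asHomogeneousIdeal.toIdeal.IsPrime := z.isPrime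
    have hdf : ∀ b ∈ f.1.coeff.support, d b.1.2 = 0 := mem_invariants_iff.1 f.2
    obtain ⟨b, hb, hbz⟩ : ∃ (b : polyMonoid P) (hb : b ∈ f.1.coeff.support),
        invMonomial b (hdf b hb) ∉ z.asHomogeneousIdeal.toIdeal := by
      by_contra hcon
      push Not at hcon
      refine hzf' ?_
      have e : f = ∑ b ∈ f.1.coeff.support.attach,
          f.1.coeff b.1 • invMonomial (d := d) b.1 (hdf b.1 b.2) := by
        apply Subtype.ext
        rw [AddSubmonoidClass.coe_finsetSum]
        conv_lhs => rw [eq_sum_monomial f.1, ← Finset.sum_attach]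
        rfl
      rw [e]
      exact Ideal.sum_mem _ fun b _ => Submodule.smul_of_tower_mem _ _ (hcon b.1 b.2)
    have hbn : b.1.1 = n := hf b hb
    -- Among the invariant monomials nonzero at `z`, choose `a` with the fewest vanishing slacks.
    -- Adding `b` cannot lower the number, so `b` lies in the face of `a`; this lets instability of
    -- `a` contradict `D₊(f)` lying in the stable locus.
    let T : Set (polyMonoid P) := {c | 0 < c.1.1 ∧
      ∃ hc : d c.1.2 = 0, invMonomial c hc ∉ z.asHomogeneousIdeal.toIdeal}
    let N : polyMonoid P → ℕ := fun c => (s.filter fun p => slack p c.1 = 0).card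
    obtain ⟨a, ⟨hapos, had, haz⟩, hmin⟩ := WellFounded.has_min (measure N).wf T
      ⟨b, hbn ▸ hn, hdf b hb, hbz⟩
    have hface : InFace s a.1 b.1 := by
      intro p hp e
      by_contra hne
      have hdab : d (a + b).1.2 = 0 := by
        change d (a.1.2 + b.1.2) = 0
        rw [map_add, had, hdf b hb, add_zero]
      refine hmin (a + b) ⟨Nat.add_pos_left hapos _, hdab, fun hmem => ?_⟩ ?_
      · rw [invMonomial_add had (hdf b hb) hdab] at hmem
        exact (hprime.mem_or_mem hmem).elim haz hbz
      · have hadd : ∀ p, slack p (a + b).1 = slack p a.1 + slack p b.1 :=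
          fun p => map_add (slack p) a.1 b.1
        refine Finset.card_lt_card ⟨fun q hq => ?_, fun hsub => ?_⟩
        · rw [Finset.mem_filter, hadd] at hq
          rw [Finset.mem_filter]
          have h2 := (hS _).1 a.2 q hq.1
          have h3 := (hS _).1 b.2 q hq.1
          exact ⟨hq.1, by linarith [hq.2]⟩
        · have h1 := (Finset.mem_filter.1 (hsub (Finset.mem_filter.2 ⟨hp, e⟩))).2
          rw [hadd, e, zero_add] at h1
          exact hne h1
    refine ⟨a, had, ⟨a.2, hapos, (hid _).1 had, ?_⟩, haz⟩
    by_contra hcon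
    exact not_basicOpen_le_stableLocus hS hid hd hapos ((hid _).1 had) hcon hn hf hb hface hle
  · rintro ⟨a, had, ha, haz⟩
    exact Opens.mem_iSup.2 ⟨⟨invMonomial a had, ⟨a.1.1, ha.pos, invMonomial_mem a had⟩,
      le_iSup_of_le ⟨monomial a, ha.isStableSection hS hid hd⟩ le_rfl⟩, haz⟩

end StableLocus

end Toric

/-! ### The chart rings inside `ℂ[Λ]`. -/

namespace Toric

open Polyhedral GIT HomogeneousLocalization

theorem awayLift_val_awayMap {A S : Type*} [CommRing A] [CommRing S] [Algebra ℂ A]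
    (𝒜 : ℕ → Submodule ℂ A) [GradedAlgebra 𝒜] {f g x : A} {n : ℕ} (hg : g ∈ 𝒜 n)
    (hx : x = f * g) (φ : A →+* S) (hf : IsUnit (φ f)) (hφx : IsUnit (φ x)) (z : Away 𝒜 f) :
    Localization.awayLift φ x hφx (awayMap 𝒜 hg hx z).val =
      Localization.awayLift φ f hf z.val := by
  rw [val_awayMap, ← RingHom.comp_apply]
  congr 1
  apply IsLocalization.ringHom_ext (M := .powers f)
  ext r
  simp

section Charts

variable {M Λ B : Type} [AddCommGroup M] [AddCommGroup Λ] [AddCommGroup B]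
  {i : M →ₗ[ℤ] Λ} {d : Λ →ₗ[ℤ] B} {s : Finset (Module.Dual ℚ (QSpan Λ) × ℚ)} {P : Set (QSpan Λ)}

/-- The cone spanned by the restrictions to `M_ℚ` of the inequalities active at `a`. -/
def exponentCone (i : M →ₗ[ℤ] Λ) (s : Finset (Module.Dual ℚ (QSpan Λ) × ℚ)) (a : ℕ × Λ) :
    PointedCone ℚ (Module.Dual ℚ (QSpan M)) :=
  PointedCone.hull ℚ ((fun p => p.1 ∘ₗ inclQ i) '' {p | p ∈ s ∧ slack p a = 0})

theorem mem_dualMonoid_exponentCone {a : ℕ × Λ} {u : M} :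
    u ∈ dualMonoid (exponentCone i s a) ↔
      ∀ p ∈ s, slack p a = 0 → 0 ≤ p.1 (latticeVec (i u)) := by
  rw [mem_dualMonoid]
  constructor
  · intro h p hp e
    rw [← inclQ_latticeVec]
    exact h _ (Submodule.subset_span ⟨p, ⟨hp, e⟩, rfl⟩)
  · intro h y hy
    induction hy using Submodule.span_induction with
    | mem y hy =>
      obtain ⟨p, ⟨hp, e⟩, rfl⟩ := hy
      change 0 ≤ p.1 (inclQ i (latticeVec u))
      rw [inclQ_latticeVec]
      exact h p hp e
    | zero => simp
    | add x y _ _ h1 h2 => exact add_nonneg h1 h2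
    | smul c y _ h1 => exact mul_nonneg c.2 h1

/-- Forgetting the degree of exponents. -/
def invProj (d : Λ →ₗ[ℤ] B) (P : Set (QSpan Λ)) : (torusAction d P).invariants →ₐ[ℂ] ℂ[Λ] :=
  (AddMonoidAlgebra.mapDomainAlgHom ℂ ℂ
    ((AddMonoidHom.snd ℕ Λ).comp (polyMonoid P).subtype)).comp (torusAction d P).invariants.val

theorem invProj_apply (r : (torusAction d P).invariants) : invProj d P r =
    AddMonoidAlgebra.mapDomain (fun b : polyMonoid P => b.1.2) r.1 := rfl

theorem invProj_invMonomial (b : polyMonoid P) (hb : d b.1.2 = 0) :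
    invProj d P (invMonomial b hb) = AddMonoidAlgebra.single b.1.2 1 := by
  rw [invProj_apply]
  exact AddMonoidAlgebra.mapDomain_single

/-- Within one degree an exponent is determined by its lattice part. This suffices, because
fractions in `Away` have homogeneous numerators. -/
theorem invProj_injOn {n : ℕ} {r : (torusAction d P).invariants}
    (hr : r ∈ (torusAction d P).invGrading n) (h : invProj d P r = 0) : r = 0 := by
  classical
  apply Subtype.ext
  refine AddMonoidAlgebra.coeff_injective ?_
  have hdeg : ∀ b ∈ r.1.coeff.support, b.1.1 = n := hr
  have hinj : Set.InjOn (fun b : polyMonoid P => b.1.2) {b | b.1.1 = n} := fun b hb c hc e =>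
    Subtype.ext (Prod.ext (Eq.trans hb (Eq.symm hc)) e)
  refine Finsupp.mapDomain_injOn {b : polyMonoid P | b.1.1 = n} hinj (fun b hb => hdeg b hb)
    (by simp) ?_
  have := congrArg AddMonoidAlgebra.coeff h
  rw [invProj_apply] at this
  rw [ZeroMemClass.coe_zero, AddMonoidAlgebra.coeff_zero, Finsupp.mapDomain_zero]
  exact this

theorem isUnit_single (l : Λ) : IsUnit (AddMonoidAlgebra.single l (1 : ℂ)) :=
  IsUnit.of_mul_eq_one (AddMonoidAlgebra.single (-l) 1) (by
    rw [AddMonoidAlgebra.single_mul_single, add_neg_cancel, mul_one, AddMonoidAlgebra.one_def])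

theorem isUnit_invProj_invMonomial (a : polyMonoid P) (ha : d a.1.2 = 0) :
    IsUnit ((invProj d P).toRingHom (invMonomial a ha)) := by
  change IsUnit (invProj d P (invMonomial a ha))
  rw [invProj_invMonomial]
  exact isUnit_single _

/-- The ring of the affine open subset `D₊(e^a)` of `X // T_B`. -/
abbrev invAway (a : polyMonoid P) (ha : d a.1.2 = 0) : Type :=
  Away (torusAction d P).invGrading (invMonomial a ha)

/-- The embedding of the ring of `D₊(e^a)` into `ℂ[Λ]`. -/
def awayToGroupAlgebra (a : polyMonoid P) (ha : d a.1.2 = 0) : invAway a ha →+* ℂ[Λ] :=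
  (Localization.awayLift (invProj d P).toRingHom (invMonomial a ha)
    (isUnit_invProj_invMonomial a ha)).comp
    (algebraMap (invAway a ha) (Localization.Away (invMonomial a ha)))

theorem awayToGroupAlgebra_mk (a : polyMonoid P) (ha : d a.1.2 = 0) (k : ℕ)
    (r : (torusAction d P).invariants) (hr : r ∈ (torusAction d P).invGrading (k • a.1.1)) :
    awayToGroupAlgebra a ha (Away.mk _ (invMonomial_mem a ha) k r hr) =
      invProj d P r * AddMonoidAlgebra.single (-(k • a.1.2)) 1 := by
  rw [awayToGroupAlgebra, RingHom.comp_apply]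
  change Localization.awayLift _ _ _
    (Away.mk (torusAction d P).invGrading (invMonomial_mem a ha) k r hr).val = _
  rw [Away.val_mk, Localization.mk_eq_mk']
  refine (IsLocalization.lift_mk'_spec _ _ _ _).2 ?_
  change invProj d P r = invProj d P (invMonomial a ha ^ k) * _
  rw [map_pow, invProj_invMonomial, mul_left_comm, AddMonoidAlgebra.single_pow,
    AddMonoidAlgebra.single_mul_single, add_neg_cancel, one_pow, mul_one,
    ← AddMonoidAlgebra.one_def, mul_one]

theorem awayToGroupAlgebra_injective (a : polyMonoid P) (ha : d a.1.2 = 0) :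
    Function.Injective (awayToGroupAlgebra a ha) := by
  rw [injective_iff_map_eq_zero]
  intro z hz
  obtain ⟨k, r, hr, rfl⟩ := Away.mk_surjective _ (invMonomial_mem a ha) z
  rw [awayToGroupAlgebra_mk, (isUnit_single _).mul_left_eq_zero] at hz
  have h0 := invProj_injOn hr hz
  subst h0
  ext
  rw [Away.val_mk, Localization.mk_zero, HomogeneousLocalization.val_zero]

/-- Inside `ℂ[Λ]` the restriction maps between chart rings become inclusions, so all later
compatibilities are checked there. -/
theorem awayToGroupAlgebra_awayMap {a b c : polyMonoid P} (ha : d a.1.2 = 0) (hb : d b.1.2 = 0)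
    (hc : d c.1.2 = 0) (h : invMonomial c hc = invMonomial a ha * invMonomial b hb)
    (z : invAway a ha) :
    awayToGroupAlgebra c hc (awayMap (torusAction d P).invGrading (invMonomial_mem b hb) h z) =
      awayToGroupAlgebra a ha z :=
  awayLift_val_awayMap _ (invMonomial_mem b hb) h (invProj d P).toRingHom
    (isUnit_invProj_invMonomial a ha) (isUnit_invProj_invMonomial c hc) z

/-- The embedding of `ℂ[σ^∨ ∩ M]` into `ℂ[Λ]`. -/
def dualToGroupAlgebra (i : M →ₗ[ℤ] Λ) (σ : PointedCone ℚ (Module.Dual ℚ (QSpan M))) :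
    ℂ[dualMonoid σ] →ₐ[ℂ] ℂ[Λ] :=
  AddMonoidAlgebra.mapDomainAlgHom ℂ ℂ (i.toAddMonoidHom.comp (dualMonoid σ).subtype)

theorem dualToGroupAlgebra_single (σ : PointedCone ℚ (Module.Dual ℚ (QSpan M)))
    (u : dualMonoid σ) (c : ℂ) :
    dualToGroupAlgebra i σ (AddMonoidAlgebra.single u c) = AddMonoidAlgebra.single (i u) c := by
  simp [dualToGroupAlgebra]

theorem dualToGroupAlgebra_injective (hi : Function.Injective i)
    (σ : PointedCone ℚ (Module.Dual ℚ (QSpan M))) :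
    Function.Injective (dualToGroupAlgebra i σ) :=
  AddMonoidAlgebra.mapDomain_injective (hi.comp Subtype.val_injective)

theorem dualToGroupAlgebra_chartMap {σ τ : PointedCone ℚ (Module.Dual ℚ (QSpan M))} (h : τ ≤ σ)
    (x : ℂ[dualMonoid σ]) :
    dualToGroupAlgebra i τ (chartMap h x) = dualToGroupAlgebra i σ x := by
  induction x using AddMonoidAlgebra.induction_linear with
  | zero => simp
  | add x y hx hy => rw [map_add, map_add, map_add, hx, hy]
  | single u c =>
    rw [chartMap_single, dualToGroupAlgebra_single, dualToGroupAlgebra_single]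
    rfl

/-- The ring of `D₊(e^a)` and the ring of the chart of the cone of `a` agree inside `ℂ[Λ]`. -/
theorem range_awayToGroupAlgebra [Module.Free ℤ B] (hS : Presents s P) (hid : Function.Exact i d)
    {a : polyMonoid P} (ha : d a.1.2 = 0) (hn : 0 < a.1.1)
    {σ : PointedCone ℚ (Module.Dual ℚ (QSpan M))} (hσ : σ = exponentCone i s a.1) :
    (awayToGroupAlgebra a ha).rangeS =
      (dualToGroupAlgebra i σ : ℂ[dualMonoid σ] →+* ℂ[Λ]).rangeS := by
  classical
  subst hσ
  apply le_antisymm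
  · rintro _ ⟨z, rfl⟩
    obtain ⟨k, r, hr, rfl⟩ := Away.mk_surjective _ (invMonomial_mem a ha) z
    rw [awayToGroupAlgebra_mk, invProj_apply, eq_sum_monomial r.1]
    change AddMonoidAlgebra.mapDomainAlgHom ℂ ℂ
      ((AddMonoidHom.snd ℕ Λ).comp (polyMonoid P).subtype) _ * _ ∈ _
    rw [map_sum, Finset.sum_mul]
    refine Subsemiring.sum_mem _ fun b hb => ?_
    obtain ⟨m, hm⟩ := (hid _).1 ha
    obtain ⟨m', hm'⟩ := (hid b.1.2).1
      (mem_invariants_iff.1 r.2 b hb)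
    have hdeg : b.1.1 = k • a.1.1 := hr b hb
    -- Since `deg b = k deg a`, a constraint active at `a` takes on this vector the value of its
    -- slack at `b`, which is nonnegative.
    have hu : m' - k • m ∈ dualMonoid (exponentCone i s a.1) := by
      refine mem_dualMonoid_exponentCone.2 fun p hp e => ?_
      rw [map_sub, map_nsmul, hm, hm', latticeVec_sub, latticeVec_nsmul, map_sub, map_smul,
        smul_eq_mul]
      have h1 := (hS _).1 b.2 p hp
      rw [slack_apply] at e h1
      rw [hdeg, smul_eq_mul] at h1
      push_cast at h1
      linear_combination h1 + (k : ℚ) * e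
    refine ⟨AddMonoidAlgebra.single ⟨_, hu⟩ (r.1.coeff b), ?_⟩
    refine (dualToGroupAlgebra_single _ _ _).trans ?_
    rw [map_smul]
    change _ = r.1.coeff b • AddMonoidAlgebra.mapDomain (fun b : polyMonoid P => b.1.2)
      (AddMonoidAlgebra.single b 1) * _
    rw [AddMonoidAlgebra.mapDomain_single, AddMonoidAlgebra.smul_single,
      AddMonoidAlgebra.single_mul_single, smul_eq_mul, mul_one, mul_one]
    congr 1
    change i (m' - k • m) = _
    rw [map_sub, map_nsmul, hm, hm', sub_eq_add_neg]
  · rintro _ ⟨x, rfl⟩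
    change dualToGroupAlgebra i _ x ∈ _
    induction x using AddMonoidAlgebra.induction_linear with
    | zero => rw [map_zero]; exact Subsemiring.zero_mem _
    | add x y hx hy => rw [map_add]; exact Subsemiring.add_mem _ hx hy
    | single u c =>
      -- Moving `u` into the monoid by `N a` writes `e^u` as `e^b / e^{N a}`, a fraction of degree
      -- zero.
      obtain ⟨N, hN⟩ := exists_mem_add_nsmul hS a.2 hn 0 (i u) fun p hp e => by
        have := mem_dualMonoid_exponentCone.1 u.2 p hp e
        simpa using this
      obtain ⟨b, hb, h1, h2⟩ := hN N le_rfl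
      have h1' : b.1 = N • a.1.1 := by
        rw [zero_add] at h1
        rw [smul_eq_mul]
        exact_mod_cast h1
      have hdb : d b.2 = 0 := by
        rw [h2, map_add, map_nsmul, ha, smul_zero, add_zero]
        exact (hid _).2 ⟨_, rfl⟩
      refine ⟨Away.mk _ (invMonomial_mem a ha) N (c • invMonomial ⟨b, hb⟩ hdb)
        (Submodule.smul_mem _ c (h1' ▸ invMonomial_mem ⟨b, hb⟩ hdb)), ?_⟩
      rw [awayToGroupAlgebra_mk, map_smul, invProj_invMonomial, dualToGroupAlgebra_single,
        AddMonoidAlgebra.smul_single, AddMonoidAlgebra.single_mul_single, smul_eq_mul, mul_one,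
        mul_one, h2, add_neg_cancel_right]

end Charts

end Toric

theorem RingHom.exists_ringEquiv_of_rangeS_eq {A B S : Type*} [Semiring A] [Semiring B]
    [Semiring S] {f : A →+* S} {g : B →+* S} (hf : Function.Injective f)
    (hg : Function.Injective g) (h : f.rangeS = g.rangeS) :
    ∃ e : A ≃+* B, ∀ x, g (e x) = f x := by
  have hf' : Function.Bijective f.rangeSRestrict :=
    ⟨fun x y hxy => hf (congrArg Subtype.val hxy), f.rangeSRestrict_surjective⟩
  have hg' : Function.Bijective g.rangeSRestrict :=
    ⟨fun x y hxy => hg (congrArg Subtype.val hxy), g.rangeSRestrict_surjective⟩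
  refine ⟨((RingEquiv.ofBijective _ hf').trans (RingEquiv.subsemiringCongr h)).trans
    (RingEquiv.ofBijective _ hg').symm, fun x => ?_⟩
  exact congrArg Subtype.val ((RingEquiv.ofBijective _ hg').apply_symm_apply _)

theorem AlgebraicGeometry.Proj.awayι_congr {σ A : Type} [CommRing A] [SetLike σ A]
    [AddSubgroupClass σ A] (𝒜 : ℕ → σ) [GradedRing 𝒜] {f : A} {m m' : ℕ} (hf : f ∈ 𝒜 m)
    (hf' : f ∈ 𝒜 m') (hm : 0 < m) (hm' : 0 < m') (h : m = m') :
    Proj.awayι 𝒜 f hf hm = Proj.awayι 𝒜 f hf' hm' := by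
  subst h
  rfl

/-! ### Charts of the fan as open subschemes of `Proj R^{T_B}`. -/

namespace Toric

open Polyhedral GIT HomogeneousLocalization

theorem awayLift_val_fromZeroRingHom {A S : Type*} [CommRing A] [CommRing S] [Algebra ℂ A]
    (𝒜 : ℕ → Submodule ℂ A) [GradedAlgebra 𝒜] {f : A} (φ : A →+* S) (hf : IsUnit (φ f))
    (z : 𝒜 0) : Localization.awayLift φ f hf (fromZeroRingHom 𝒜 (.powers f) z).val = φ z := by
  change Localization.awayLift φ f hf (HomogeneousLocalization.mk ⟨0, z, 1, _⟩).val = _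
  rw [HomogeneousLocalization.val_mk]
  change Localization.awayLift φ f hf (Localization.mk (z : A) 1) = _
  rw [Localization.mk_one_eq_algebraMap]
  exact IsLocalization.lift_eq _ _

section ChartMorphisms

variable {M Λ B : Type} [AddCommGroup M] [AddCommGroup Λ] [AddCommGroup B]
  {i : M →ₗ[ℤ] Λ} {d : Λ →ₗ[ℤ] B} {s : Finset (Module.Dual ℚ (QSpan Λ) × ℚ)} {P : Set (QSpan Λ)}
  {σ τ : PointedCone ℚ (Module.Dual ℚ (QSpan M))} {a b : polyMonoid P}

/-- For `a = (n, λ)` the point is `λ/n`; dividing by `n > 0` scales slacks without changing which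
vanish. -/
theorem exists_mem_slice (hS : Presents s P) (ha : 0 < a.1.1) {m₀ : M} (hm₀ : i m₀ = a.1.2) :
    ∃ m ∈ slice i s, ∀ p : Module.Dual ℚ (QSpan Λ) × ℚ,
      p.1 (inclQ i m) = p.2 ↔ slack p a.1 = 0 := by
  have hpos : (0 : ℚ) < a.1.1 := by exact_mod_cast ha
  have key : ∀ p : Module.Dual ℚ (QSpan Λ) × ℚ,
      p.1 (inclQ i ((a.1.1 : ℚ)⁻¹ • latticeVec m₀)) - p.2 = (a.1.1 : ℚ)⁻¹ * slack p a.1 := by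
    intro p
    rw [map_smul, map_smul, inclQ_latticeVec, hm₀, slack_apply, smul_eq_mul, mul_sub,
      inv_mul_cancel_left₀ hpos.ne']
  refine ⟨(a.1.1 : ℚ)⁻¹ • latticeVec m₀, fun p hp => ?_, fun p => ?_⟩
  · exact sub_nonneg.1 ((key p).symm ▸ mul_nonneg (inv_nonneg.2 hpos.le) ((hS _).1 a.2 p hp))
  · rw [← sub_eq_zero, key, mul_eq_zero, or_iff_right (inv_ne_zero hpos.ne')]

/-- Inverse to `exists_mem_slice`: clear denominators in `m` and take the common denominator as the
degree. -/
theorem exists_exponent (hS : Presents s P) {m : QSpan M} (hm : m ∈ slice i s) :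
    ∃ a : polyMonoid P, 0 < a.1.1 ∧ (∃ m₀, i m₀ = a.1.2) ∧
      ∀ p : Module.Dual ℚ (QSpan Λ) × ℚ, p.1 (inclQ i m) = p.2 ↔ slack p a.1 = 0 := by
  obtain ⟨k, m₀, hk, e⟩ := exists_lattice_multiple m
  have hpos : (0 : ℚ) < k := by exact_mod_cast hk
  have key : ∀ p : Module.Dual ℚ (QSpan Λ) × ℚ,
      slack p (k, i m₀) = k * (p.1 (inclQ i m) - p.2) := by
    intro p
    rw [slack_apply]
    change p.1 (latticeVec (i m₀)) - (k : ℚ) * p.2 = _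
    rw [← inclQ_latticeVec, ← e, map_smul, map_smul, smul_eq_mul, mul_sub]
  refine ⟨⟨(k, i m₀), (hS _).2 fun p hp => ?_⟩, hk, ⟨m₀, rfl⟩, fun p => ?_⟩
  · rw [key]
    exact mul_nonneg hpos.le (sub_nonneg.2 (hm p hp))
  · change _ ↔ slack p (k, i m₀) = 0
    rw [key, mul_eq_zero, or_iff_right hpos.ne', sub_eq_zero]

theorem exponentCone_eq_normalCone {m : QSpan M} (hm : m ∈ slice i s) {a : ℕ × Λ}
    (h : ∀ p ∈ s, p.1 (inclQ i m) = p.2 ↔ slack p a = 0) :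
    exponentCone i s a = normalCone (slice i s) {m} := by
  rw [normalCone_eq_hull hm, exponentCone]
  congr 2
  ext p
  exact and_congr_right fun hp => (h p hp).symm

theorem slack_add_eq_zero (hS : Presents s P) {p : Module.Dual ℚ (QSpan Λ) × ℚ} (hp : p ∈ s) :
    slack p (a + b).1 = 0 ↔ slack p a.1 = 0 ∧ slack p b.1 = 0 := by
  have h1 := (hS _).1 a.2 p hp
  have h2 := (hS _).1 b.2 p hp
  rw [show slack p (a + b).1 = slack p a.1 + slack p b.1 from map_add (slack p) a.1 b.1]
  constructor
  · intro h
    constructor <;> linarith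
  · rintro ⟨h3, h4⟩
    rw [h3, h4, add_zero]

/-- `a` is an invariant exponent of positive degree whose cone is `σ`. -/
structure IsChartExponent (d : Λ →ₗ[ℤ] B) (i : M →ₗ[ℤ] Λ)
    (s : Finset (Module.Dual ℚ (QSpan Λ) × ℚ)) (a : polyMonoid P)
    (σ : PointedCone ℚ (Module.Dual ℚ (QSpan M))) : Prop where
  map_eq_zero : d a.1.2 = 0
  pos : 0 < a.1.1
  cone_eq : σ = exponentCone i s a.1

/-- The exponent `a + b` has the same vanishing slacks as the midpoint of the points of `a` and `b`,
and midpoints realise intersections of normal cones. -/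
theorem IsChartExponent.add (hS : Presents s P) (hid : Function.Exact i d)
    (ha : IsChartExponent d i s a σ) (hb : IsChartExponent d i s b τ) :
    IsChartExponent d i s (a + b) (σ ⊓ τ) := by
  obtain ⟨m₀, hm₀⟩ := (hid _).1 ha.map_eq_zero
  obtain ⟨m, hm, hact⟩ := exists_mem_slice hS ha.pos hm₀
  obtain ⟨m₀', hm₀'⟩ := (hid _).1 hb.map_eq_zero
  obtain ⟨m', hm', hact'⟩ := exists_mem_slice hS hb.pos hm₀'
  refine ⟨?_, Nat.add_pos_left ha.pos _, ?_⟩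
  · change d (a.1.2 + b.1.2) = 0
    rw [map_add, ha.map_eq_zero, hb.map_eq_zero, add_zero]
  · rw [ha.cone_eq, hb.cone_eq, exponentCone_eq_normalCone hm fun p _ => hact p,
      exponentCone_eq_normalCone hm' fun p _ => hact' p, ← normalCone_midpoint hm hm',
      exponentCone_eq_normalCone (midpoint_mem_halfspaces hm hm') fun p hp => ?_]
    rw [slack_add_eq_zero hS hp, ← hact, ← hact']
    exact active_midpoint hm hm' hp

section Equiv

variable [Module.Free ℤ B] (hS : Presents s P) (hi : Function.Injective i)
  (hid : Function.Exact i d)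
include hS hi hid

/-- Both rings embed in `ℂ[Λ]` with the same image. -/
theorem exists_chartEquiv (ha : IsChartExponent d i s a σ) :
    ∃ e : invAway a ha.map_eq_zero ≃+* ℂ[dualMonoid σ], ∀ z,
      dualToGroupAlgebra i σ (e z) = awayToGroupAlgebra a ha.map_eq_zero z :=
  RingHom.exists_ringEquiv_of_rangeS_eq (g := (dualToGroupAlgebra i σ : ℂ[dualMonoid σ] →+* ℂ[Λ]))
    (awayToGroupAlgebra_injective a _)
    (dualToGroupAlgebra_injective hi σ) (range_awayToGroupAlgebra hS hid _ ha.pos ha.cone_eq)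

/-- The ring of `D₊(e^a)` is the ring of the chart of the cone of `a`. -/
def chartEquiv (ha : IsChartExponent d i s a σ) :
    invAway a ha.map_eq_zero ≃+* ℂ[dualMonoid σ] := (exists_chartEquiv hS hi hid ha).choose

theorem dualToGroupAlgebra_chartEquiv (ha : IsChartExponent d i s a σ)
    (z : invAway a ha.map_eq_zero) :
    dualToGroupAlgebra i σ (chartEquiv hS hi hid ha z) =
      awayToGroupAlgebra a ha.map_eq_zero z := (exists_chartEquiv hS hi hid ha).choose_spec z

theorem chartMap_chartEquiv {c : polyMonoid P} (ha : IsChartExponent d i s a σ)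
    (hb : d b.1.2 = 0) (hc : IsChartExponent d i s c τ)
    (h : invMonomial c hc.map_eq_zero = invMonomial a ha.map_eq_zero * invMonomial b hb)
    (hle : τ ≤ σ) (z : invAway a ha.map_eq_zero) :
    chartMap hle (chartEquiv hS hi hid ha z) = chartEquiv hS hi hid hc
      (awayMap (torusAction d P).invGrading (invMonomial_mem b hb) h z) := by
  apply dualToGroupAlgebra_injective hi
  rw [dualToGroupAlgebra_chartMap, dualToGroupAlgebra_chartEquiv, dualToGroupAlgebra_chartEquiv,
    awayToGroupAlgebra_awayMap]

/-- The open immersion of the chart of the cone of `a` with image `D₊(e^a)`. -/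
def chartι (ha : IsChartExponent d i s a σ) :
    Spec (CommRingCat.of ℂ[dualMonoid σ]) ⟶ Proj (torusAction d P).invGrading :=
  Spec.map (chartEquiv hS hi hid ha).toCommRingCatIso.hom ≫
    Proj.awayι (torusAction d P).invGrading (invMonomial a ha.map_eq_zero)
      (invMonomial_mem a ha.map_eq_zero) ha.pos

theorem isOpenImmersion_chartι (ha : IsChartExponent d i s a σ) :
    IsOpenImmersion (chartι hS hi hid ha) := by
  unfold chartι
  infer_instance

theorem range_chartι (ha : IsChartExponent d i s a σ) : Set.range (chartι hS hi hid ha) =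
    Proj.basicOpen (torusAction d P).invGrading (invMonomial a ha.map_eq_zero) := by
  have := isOpenImmersion_chartι hS hi hid ha
  have h : (chartι hS hi hid ha).opensRange =
      Proj.basicOpen (torusAction d P).invGrading (invMonomial a ha.map_eq_zero) := by
    unfold chartι
    rw [Scheme.Hom.opensRange_comp_of_isIso, Proj.opensRange_awayι]
  rw [← h]
  rfl

theorem map_chartMap_chartι_of_mul {c : polyMonoid P} (ha : IsChartExponent d i s a σ)
    (hb : d b.1.2 = 0) (hc : IsChartExponent d i s c τ) (hcab : c = a + b)
    (h : invMonomial c hc.map_eq_zero = invMonomial a ha.map_eq_zero * invMonomial b hb)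
    (hle : τ ≤ σ) :
    Spec.map (CommRingCat.ofHom (chartMap hle).toRingHom) ≫ chartι hS hi hid ha =
      chartι hS hi hid hc := by
  have hdeg : c.1.1 = a.1.1 + b.1.1 := congrArg (fun x : polyMonoid P => x.1.1) hcab
  have e := Proj.SpecMap_awayMap_awayι (torusAction d P).invGrading
    (invMonomial_mem a ha.map_eq_zero) ha.pos (invMonomial_mem b hb) h
  unfold chartι
  rw [Proj.awayι_congr _ (invMonomial_mem c hc.map_eq_zero) (hdeg ▸ invMonomial_mem c _) hc.pos
    (hdeg ▸ hc.pos) hdeg, ← e, ← Category.assoc, ← Category.assoc, ← Spec.map_comp,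
    ← Spec.map_comp]
  congr 2
  exact CommRingCat.hom_ext (RingHom.ext (chartMap_chartEquiv hS hi hid ha hb hc h hle))

theorem chartι_toSpecZero (ha : IsChartExponent d i s a σ) :
    chartι hS hi hid ha ≫ Proj.toSpecZero (torusAction d P).invGrading ≫
      Spec.map (CommRingCat.ofHom (algebraMap ℂ ((torusAction d P).invGrading 0))) =
    Spec.map (CommRingCat.ofHom (algebraMap ℂ ℂ[dualMonoid σ])) := by
  unfold chartι
  rw [Category.assoc, Proj.awayι_toSpecZero_assoc, ← Spec.map_comp, ← Spec.map_comp]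
  congr 1
  refine CommRingCat.hom_ext (RingHom.ext fun x => ?_)
  apply dualToGroupAlgebra_injective hi
  refine (dualToGroupAlgebra_chartEquiv hS hi hid ha _).trans ?_
  refine Eq.trans ?_ ((dualToGroupAlgebra i σ).commutes x).symm
  refine Eq.trans ?_ ((invProj d P).commutes x)
  exact awayLift_val_fromZeroRingHom (torusAction d P).invGrading (invProj d P).toRingHom
    (isUnit_invProj_invMonomial a ha.map_eq_zero)
    (algebraMap ℂ ((torusAction d P).invGrading 0) x)

end Equiv

end ChartMorphisms

end Toric

/-! ### Gluing the charts and identifying the image. -/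

namespace Toric

open Polyhedral GIT

/-- A compatible family of open immersions of the charts of a fan, in which the images of two
charts meet in the image of the chart of the intersection, glues to an open immersion. -/
theorem GenFan.isOpenImmersion_desc {M : Type} [AddCommGroup M] (Δ : GenFan M)
    (c : Cocone Δ.diagram) (hc : ∀ σ, IsOpenImmersion (c.ι.app σ))
    (h : ∀ σ τ : Δ.cones, ∃ (υ : Δ.cones) (_ : υ ≤ σ) (_ : υ ≤ τ),
      Set.range (c.ι.app σ) ∩ Set.range (c.ι.app τ) ⊆ Set.range (c.ι.app υ)) :
    IsOpenImmersion (colimit.desc Δ.diagram c) := by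
  have hdesc : ∀ (σ : Δ.cones) (x : Δ.diagram.obj σ),
      colimit.desc Δ.diagram c (colimit.ι Δ.diagram σ x) = c.ι.app σ x := by
    intro σ x
    rw [← Scheme.Hom.comp_apply, colimit.ι_desc]
  have hmap : ∀ {υ σ : Δ.cones} (f : υ ⟶ σ) (x : Δ.diagram.obj υ),
      c.ι.app σ (Δ.diagram.map f x) = c.ι.app υ x := by
    intro υ σ f x
    rw [← c.w f]
    exact (Scheme.Hom.comp_apply _ _ _).symm
  refine IsOpenImmersion.of_openCover_source _ (Scheme.IsLocallyDirected.openCover Δ.diagram) ?_ ?_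
  · intro x y hxy
    obtain ⟨σ, x, rfl⟩ := Scheme.IsLocallyDirected.ι_jointly_surjective Δ.diagram x
    obtain ⟨τ, y, rfl⟩ := Scheme.IsLocallyDirected.ι_jointly_surjective Δ.diagram y
    rw [hdesc, hdesc] at hxy
    obtain ⟨υ, h1, h2, hsub⟩ := h σ τ
    obtain ⟨z, hz⟩ : c.ι.app σ x ∈ Set.range (c.ι.app υ) := hsub ⟨⟨x, rfl⟩, y, hxy.symm⟩
    have e1 := (hmap (homOfLE h1) z).trans hz
    have e2 := (hmap (homOfLE h2) z).trans (hz.trans hxy)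
    have := hc σ
    have := hc τ
    refine (Scheme.IsLocallyDirected.ι_eq_ι_iff Δ.diagram).2
      ⟨υ, homOfLE h1, homOfLE h2, z, (c.ι.app σ).isOpenEmbedding.injective e1,
        (c.ι.app τ).isOpenEmbedding.injective e2⟩
  · intro σ
    have e : colimit.ι Δ.diagram σ ≫ colimit.desc Δ.diagram c = c.ι.app σ := colimit.ι_desc c σ
    exact e.symm ▸ hc σ

theorem GenFan.range_desc {M : Type} [AddCommGroup M] (Δ : GenFan M) (c : Cocone Δ.diagram) :
    Set.range (colimit.desc Δ.diagram c) = ⋃ σ, Set.range (c.ι.app σ) := by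
  ext y
  rw [Set.mem_iUnion]
  constructor
  · rintro ⟨x, rfl⟩
    obtain ⟨σ, x, rfl⟩ := Scheme.IsLocallyDirected.ι_jointly_surjective Δ.diagram x
    exact ⟨σ, x, by rw [← Scheme.Hom.comp_apply, colimit.ι_desc]⟩
  · rintro ⟨σ, x, rfl⟩
    exact ⟨colimit.ι Δ.diagram σ x, by rw [← Scheme.Hom.comp_apply, colimit.ι_desc]⟩

section Gluing

variable {M Λ B : Type} [AddCommGroup M] [AddCommGroup Λ] [AddCommGroup B]
  {i : M →ₗ[ℤ] Λ} {d : Λ →ₗ[ℤ] B} {s : Finset (Module.Dual ℚ (QSpan Λ) × ℚ)} {P : Set (QSpan Λ)}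
  {σ τ : PointedCone ℚ (Module.Dual ℚ (QSpan M))} {a b : polyMonoid P}

theorem exists_stable_chartExponent (hS : Presents s P) (hid : Function.Exact i d)
    (hσ : σ ∈ (stableFan i s).cones) :
    ∃ a : polyMonoid P, IsStableExponent i s P a.1 ∧ IsChartExponent d i s a σ := by
  obtain ⟨m, hm, htr, rfl⟩ := hσ
  obtain ⟨a, hpos, hmem, hact⟩ := exists_exponent (i := i) hS hm
  exact ⟨a, ⟨a.2, hpos, hmem, fun v => (htr v).imp fun u hu p hp e => hu p hp ((hact p).2 e)⟩,
    (hid _).2 hmem, hpos, (exponentCone_eq_normalCone hm fun p _ => hact p).symm⟩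

theorem IsStableExponent.exponentCone_mem (hS : Presents s P)
    (ha : IsStableExponent i s P a.1) : exponentCone i s a.1 ∈ (stableFan i s).cones := by
  obtain ⟨m₀, hm₀⟩ := ha.mem_range
  obtain ⟨m, hm, hact⟩ := exists_mem_slice hS ha.pos hm₀
  exact ⟨m, hm, fun v => (ha.transversal v).imp fun u hu p hp e => hu p hp ((hact p).1 e),
    exponentCone_eq_normalCone hm fun p _ => hact p⟩

variable (hS : Presents s P) (hi : Function.Injective i) (hid : Function.Exact i d)

/-- The exponent whose chart represents a cone of `N^s(P_M)`. -/
def fanExponent (σ : (stableFan i s).cones) : polyMonoid P :=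
  (exists_stable_chartExponent hS hid σ.2).choose

theorem isStableExponent_fanExponent (σ : (stableFan i s).cones) :
    IsStableExponent i s P (fanExponent hS hid σ).1 :=
  (exists_stable_chartExponent hS hid σ.2).choose_spec.1

theorem isChartExponent_fanExponent (σ : (stableFan i s).cones) :
    IsChartExponent d i s (fanExponent hS hid σ) σ.1 :=
  (exists_stable_chartExponent hS hid σ.2).choose_spec.2

variable [Module.Free ℤ B]

/-- Both exponents are compared with `a + b`, whose cone is `σ ∩ τ = τ`. For `σ = τ` this says that
a chart depends only on its cone and not on the exponent representing it. -/
theorem map_chartMap_chartι (ha : IsChartExponent d i s a σ) (hb : IsChartExponent d i s b τ)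
    (hle : τ ≤ σ) : Spec.map (CommRingCat.ofHom (chartMap hle).toRingHom) ≫
      chartι hS hi hid ha = chartι hS hi hid hb := by
  have hab : IsChartExponent d i s (a + b) τ := inf_eq_right.2 hle ▸ ha.add hS hid hb
  rw [map_chartMap_chartι_of_mul hS hi hid ha hb.map_eq_zero hab rfl
    (invMonomial_add ha.map_eq_zero hb.map_eq_zero _) hle,
    ← map_chartMap_chartι_of_mul hS hi hid hb ha.map_eq_zero hab (add_comm a b) ?_ le_rfl,
    chartMap_refl]
  · exact (congrArg (· ≫ _) (Spec.map_id _)).trans (Category.id_comp _)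
  · rw [mul_comm]
    exact invMonomial_add ha.map_eq_zero hb.map_eq_zero _

theorem range_chartι_inter (ha : IsChartExponent d i s a σ) (hb : IsChartExponent d i s b τ) :
    Set.range (chartι hS hi hid ha) ∩ Set.range (chartι hS hi hid hb) =
      Set.range (chartι hS hi hid (ha.add hS hid hb)) := by
  rw [range_chartι, range_chartι, range_chartι, invMonomial_add ha.map_eq_zero hb.map_eq_zero,
    Proj.basicOpen_mul]
  rfl

/-- The charts of the toric variety of `N^s(P_M)` as open subschemes of the GIT quotient. -/
def chartCocone : Cocone (stableFan i s).diagram where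
  pt := Proj (torusAction d P).invGrading
  ι :=
    { app := fun σ => chartι hS hi hid (isChartExponent_fanExponent hS hid σ)
      naturality := fun _ _ f => (map_chartMap_chartι hS hi hid _ _ f.le).trans
        (Category.comp_id _).symm }

/-- The morphism from the toric variety of `N^s(P_M)` to the GIT quotient. -/
def quotientMorphism : (stableFan i s).variety ⟶ Proj (torusAction d P).invGrading :=
  colimit.desc _ (chartCocone hS hi hid)

/-- Two chart images meet in `D₊(e^{a + b})`. This is the chart image of the intersection cone,
whichever exponent was chosen to represent that cone. -/
theorem isOpenImmersion_quotientMorphism : IsOpenImmersion (quotientMorphism hS hi hid) := by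
  refine GenFan.isOpenImmersion_desc _ _ (fun σ => isOpenImmersion_chartι hS hi hid _)
    fun σ τ => ?_
  let υ : (stableFan i s).cones := ⟨σ.1 ⊓ τ.1, (stableFan i s).face_mem _ σ.2 _
    ((stableFan i s).inter_face _ σ.2 _ τ.2)⟩
  refine ⟨υ, inf_le_left (a := σ.1) (b := τ.1), inf_le_right (a := σ.1) (b := τ.1), ?_⟩
  refine (range_chartι_inter hS hi hid (isChartExponent_fanExponent hS hid σ)
    (isChartExponent_fanExponent hS hid τ)).subset.trans ?_
  rw [← map_chartMap_chartι hS hi hid (isChartExponent_fanExponent hS hid υ) _ le_rfl]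
  rintro _ ⟨x, rfl⟩
  rw [Scheme.Hom.comp_apply]
  exact ⟨_, rfl⟩

/-- Each cone has a stable exponent, and conversely the cone of any stable exponent lies in the fan.
Independence of the exponent then lets the chosen charts cover every `D₊(e^a)` with `a` stable. -/
theorem range_quotientMorphism [Module.Free ℤ Λ] [Module.Finite ℤ Λ] [Module.Finite ℤ B]
    (hd : Function.Surjective d) :
    Set.range (quotientMorphism hS hi hid) =
      ((torusAction d P).quotientOpens (torusAction d P).stableLocus :
        Set (Proj (torusAction d P).invGrading)) := by
  refine (GenFan.range_desc _ (chartCocone hS hi hid)).trans (Set.ext fun z => ?_)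
  refine Set.mem_iUnion.trans (Iff.trans ?_ (mem_quotientOpens_stableLocus hS hid hd z).symm)
  constructor
  · rintro ⟨σ, hz⟩
    have hz' := (range_chartι hS hi hid (isChartExponent_fanExponent hS hid σ)).subset hz
    exact ⟨_, _, isStableExponent_fanExponent hS hid σ, hz'⟩
  · rintro ⟨a, ha, hst, hz⟩
    have hσ := hst.exponentCone_mem hS
    have hch : IsChartExponent d i s a (exponentCone i s a.1) := ⟨ha, hst.pos, rfl⟩
    have hz' := (range_chartι hS hi hid hch).symm.subset hz
    refine ⟨⟨_, hσ⟩, ?_⟩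
    rw [← map_chartMap_chartι hS hi hid
      (isChartExponent_fanExponent hS hid ⟨exponentCone i s a.1, hσ⟩) hch le_rfl] at hz'
    obtain ⟨x, rfl⟩ := hz'
    rw [Scheme.Hom.comp_apply]
    exact ⟨_, rfl⟩

theorem quotientMorphism_toSpecZero :
    quotientMorphism hS hi hid ≫ Proj.toSpecZero (torusAction d P).invGrading ≫
      Spec.map (CommRingCat.ofHom (algebraMap ℂ ((torusAction d P).invGrading 0))) =
    (stableFan i s).varietyToSpec := by
  refine colimit.hom_ext fun σ => ?_
  have e : colimit.ι (stableFan i s).diagram σ ≫ quotientMorphism hS hi hid =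
      chartι hS hi hid (isChartExponent_fanExponent hS hid σ) :=
    colimit.ι_desc (chartCocone hS hi hid) σ
  rw [GenFan.varietyToSpec, colimit.ι_desc]
  refine (Category.assoc _ _ _).symm.trans ((congrArg (· ≫ _) e).trans ?_)
  exact chartι_toSpecZero hS hi hid _

-- The glued morphism and the inclusion of the stable quotient are open immersions into `Proj
-- R^{T_B}` with the same range.
include hS hi hid in
theorem exists_iso_stableQuotient [Module.Free ℤ Λ] [Module.Finite ℤ Λ] [Module.Finite ℤ B]
    (hd : Function.Surjective d) :
    ∃ e : (stableFan i s).variety ≅ (torusAction d P).stableQuotient,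
      e.hom ≫ (torusAction d P).stableQuotientToSpec = (stableFan i s).varietyToSpec := by
  have := isOpenImmersion_quotientMorphism hS hi hid
  let e := IsOpenImmersion.isoOfRangeEq (quotientMorphism hS hi hid)
    ((torusAction d P).quotientOpens (torusAction d P).stableLocus).ι
    ((range_quotientMorphism hS hi hid hd).trans (Scheme.Opens.range_ι _).symm)
  refine ⟨e, ?_⟩
  have he : e.hom ≫ ((torusAction d P).quotientOpens (torusAction d P).stableLocus).ι =
      quotientMorphism hS hi hid := IsOpenImmersion.isoOfRangeEq_hom_fac _ _ _
  rw [← quotientMorphism_toSpecZero hS hi hid, ← he]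
  exact (Category.assoc _ _ _).symm

end Gluing

theorem presents_polyhedron {Λ : Type} [AddCommGroup Λ] {P : Set (QSpan Λ)}
    {s : Finset (Module.Dual ℚ (QSpan Λ) × ℚ)}
    (h : ∀ t v, 0 ≤ t → ((t, v) ∈ coneOver P ↔ ∀ p ∈ s, t * p.2 ≤ p.1 v)) : Presents s P := by
  intro b
  refine (h _ _ (Nat.cast_nonneg b.1)).trans (forall₂_congr fun p _ => ?_)
  rw [slack_apply, sub_nonneg]

end Toric

end

theorem mainTheorem4 (M Λ B : Type) [AddCommGroup M] [AddCommGroup Λ] [AddCommGroup B]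
    [Module.Free ℤ M] [Module.Finite ℤ M] [Module.Free ℤ Λ] [Module.Finite ℤ Λ]
    [Module.Free ℤ B] [Module.Finite ℤ B]
    (i : M →ₗ[ℤ] Λ) (d : Λ →ₗ[ℤ] B)
    (hi : Function.Injective i) (hid : Function.Exact i d) (hd : Function.Surjective d)
    (P : Set (Toric.QSpan Λ)) (hP : Polyhedral.IsPolyhedron P) :
    ∃ Δ N : Toric.GenFan M,
      Δ.cones = Toric.stableNormalCones i P ∧
      N.cones = Polyhedral.normalCones (Toric.restrict i P) ∧
      Δ.cones ⊆ N.cones ∧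
      (affineSpan ℚ P = ⊤ → Δ.IsFan) ∧
      ∃ e : Δ.variety ≅ (Toric.torusAction d P).stableQuotient,
        e.hom ≫ (Toric.torusAction d P).stableQuotientToSpec = Δ.varietyToSpec := by
  obtain ⟨s, rfl, hs⟩ := Toric.exists_polyhedron_coneOver hP
  exact ⟨Toric.stableFan i s, Toric.normalFan i s, (Toric.stableNormalCones_polyhedron i s).symm,
    (Toric.normalCones_restrict i s).symm, fun _ ⟨m, hm, _, h⟩ => ⟨m, hm, trivial, h⟩,
    Toric.stableFan_isFan i s,
    Toric.exists_iso_stableQuotient (Toric.presents_polyhedron hs) hi hid hd⟩
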